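/- Let $R$ be a commutative Noetherian ring, $\mathfrak a$ an ideal of $R$, and $c$ the arithmetic rank of $\mathfrak a$, i.e. the least integer $c\ge 0$ for which there are $x_1,\dots,x_c\in R$ with $\sqrt{\mathfrak a}=\sqrt{(x_1,\dots,x_c)}$ (this is finite since $R$ is Noetherian). Let $X$ be an arbitrary $R$-module and let $N$ be an $\mathfrak a$-torsion $R$-module, i.e. every element of $N$ is annihilated by some power of $\mathfrak a$. Then there is a first quadrant homological spectral sequence of $R$-modules $$E^2_{p,q}=\operatorname{Tor}^R_p\bigl(N,H^{c-q}_{\mathfrak a}(X)\bigr)\;\underset{p}{\Longrightarrow}\;\operatorname{Tor}^R_{p+q-c}(N,X),$$ where $p,q\ge 0$, the differential $d^r$ has bidegree $(-r,r-1)$, and $\operatorname{Tor}_i$ and $H^i_{\mathfrak a}$ are zero for $i<0$. Convergence means that each $H_n:=\operatorname{Tor}^R_{n-c}(N,X)$ has a filtration $0=\phi^{-1}H_n\subseteq\phi^0H_n\subseteq\dots\subseteq\phi^nH_n=H_n$ with $E^\infty_{p,q}\cong\phi^pH_{p+q}/\phi^{p-1}H_{p+q}$, where $E^\infty_{p,q}$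 denotes the stable value $E^r_{p,q}$ for $r>\max(p,q+1)$. More precisely, elements $x_1,\dots,x_c$ as above and free resolutions of $N$ exist, and for every choice of such elements and every free resolution $F_\bullet$ of $N$ the spectral sequence can be taken to be the spectral sequence of the total complex of the first quadrant double complex $$\mathcal T_{p,q}=C(F_p\otimes_R X)^{c-q}$$ with respect to its first filtration, whose $p$-th term in degree $n$ is $\bigoplus_{i\le p}\mathcal T_{i,n-i}$. Here $C(M)^\bullet$ is the Čech complex of $M$ with respect to $x_1,\dots,x_c$, whose term in degree $i$ is $\bigoplus_{|S|=i}M_{x_S}$ with $S\subseteq\{1,\dots,c\}$ and $x_S=\prod_{j\in S}x_j$. Moreover, there are isomorphisms $H_n(\operatorname{Tot}(\mathcal T))\cong\operatorname{Tor}^R_{n-c}(N,X)$ for all $n\ge 0$, under which $\phi$ is the filtration induced by the first filtration of $\operatorname{Tot}(\mathcal T)$. -/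

import Mathlib

open CategoryTheory CategoryTheory.Limits

universe u

noncomputable section

/-! ### Arithmetic rank, torsion modules, local cohomology and Tor in integral degrees -/

/-- The arithmetic rank of an ideal `𝔞`: the least `c` such that `𝔞` is, up to radical,
generated by `c` elements. (The set is nonempty when `R` is Noetherian.) -/
def arithmeticRank {R : Type u} [CommRing R] (𝔞 : Ideal R) : ℕ :=
  sInf {c : ℕ | ∃ x : Fin c → R, (Ideal.span (Set.range x)).radical = 𝔞.radical}

/-- A module is `𝔞`-torsion if each of its elements is annihilated by some power of `𝔞`. -/
def IsIdealTorsion {R : Type u} [CommRing R] (𝔞 : Ideal R)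
    (N : Type u) [AddCommGroup N] [Module R N] : Prop :=
  ∀ m : N, ∃ k : ℕ, ∀ a ∈ 𝔞 ^ k, a • m = 0

variable {R : Type u} [CommRing R]

/-- Local cohomology `H^i_𝔞(X)` for an integer `i`; it is zero for negative `i`. -/
def localCohomologyInt (𝔞 : Ideal R) (i : ℤ) (X : ModuleCat.{u} R) : ModuleCat.{u} R :=
  match i with
  | Int.ofNat n => (localCohomology 𝔞 n).obj X
  | Int.negSucc _ => ModuleCat.of R PUnit.{u + 1}

/-- `Tor_i(N, X)` for an integer `i`, computed by projective resolutions of the first variable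
`N`; it is zero for negative `i`. -/
def torInt (i : ℤ) (N X : ModuleCat.{u} R) : ModuleCat.{u} R :=
  match i with
  | Int.ofNat n => ((Tor' (ModuleCat.{u} R) n).obj N).obj X
  | Int.negSucc _ => ModuleCat.of R PUnit.{u + 1}

/-! ### The Čech complex -/

section Cech

variable {c : ℕ} (x : Fin c → R)

/-- The submonoid of powers of `x_S = ∏_{j ∈ S} x_j`. -/
def cechPowers (S : Finset (Fin c)) : Submonoid R :=
  Submonoid.powers (∏ j ∈ S, x j)

/-- The localization of `M` at `x_S = ∏_{j ∈ S} x_j`. -/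
abbrev CechPiece (M : Type u) [AddCommGroup M] [Module R M] (S : Finset (Fin c)) : Type u :=
  LocalizedModule (cechPowers x S) M

theorem cechPiece_isUnit (M : Type u) [AddCommGroup M] [Module R M] {S T : Finset (Fin c)}
    (h : S ⊆ T) (s : cechPowers x S) :
    IsUnit (algebraMap R (Module.End R (CechPiece x M T)) s) := by
  obtain ⟨_, k, rfl⟩ := s
  have hu : IsUnit (algebraMap R (Module.End R (CechPiece x M T)) (∏ j ∈ T, x j)) :=
    IsLocalizedModule.map_units (LocalizedModule.mkLinearMap (cechPowers x T) M)
      (⟨∏ j ∈ T, x j, Submonoid.mem_powers _⟩ : cechPowers x T)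
  rw [← Finset.prod_sdiff h, map_mul] at hu
  have hc : Commute (algebraMap R (Module.End R (CechPiece x M T)) (∏ j ∈ T \ S, x j))
      (algebraMap R (Module.End R (CechPiece x M T)) (∏ j ∈ S, x j)) :=
    Algebra.commutes _ _
  simpa using ((hc.isUnit_mul_iff.1 hu).2).pow k

/-- The localization map `M_{x_S} → M_{x_T}`, `m / 1 ↦ m / 1`, for `S ⊆ T`. -/
def cechFace (M : Type u) [AddCommGroup M] [Module R M] {S T : Finset (Fin c)} (h : S ⊆ T) :
    CechPiece x M S →ₗ[R] CechPiece x M T :=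
  LocalizedModule.lift _ (LocalizedModule.mkLinearMap (cechPowers x T) M)
    (cechPiece_isUnit x M h)

theorem cechFace_comp_mk (M : Type u) [AddCommGroup M] [Module R M] {S T : Finset (Fin c)}
    (h : S ⊆ T) :
    (cechFace x M h).comp (LocalizedModule.mkLinearMap (cechPowers x S) M) =
      LocalizedModule.mkLinearMap (cechPowers x T) M :=
  LocalizedModule.lift_comp _ _ _

theorem cechFace_comp (M : Type u) [AddCommGroup M] [Module R M] {S T U : Finset (Fin c)}
    (h : S ⊆ T) (h' : T ⊆ U) :
    (cechFace x M h').comp (cechFace x M h) = cechFace x M (h.trans h') := by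
  apply IsLocalizedModule.ext (cechPowers x S) (LocalizedModule.mkLinearMap (cechPowers x S) M)
    (cechPiece_isUnit x M (h.trans h'))
  rw [LinearMap.comp_assoc, cechFace_comp_mk, cechFace_comp_mk, cechFace_comp_mk]

/-- The map induced by `f : M → M'` on localizations at `x_S`. -/
def cechPieceMap {M M' : Type u} [AddCommGroup M] [Module R M] [AddCommGroup M'] [Module R M']
    (f : M →ₗ[R] M') (S : Finset (Fin c)) : CechPiece x M S →ₗ[R] CechPiece x M' S :=
  IsLocalizedModule.map (cechPowers x S) (LocalizedModule.mkLinearMap (cechPowers x S) M)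
    (LocalizedModule.mkLinearMap (cechPowers x S) M') f

theorem cechPieceMap_comp_mk {M M' : Type u} [AddCommGroup M] [Module R M] [AddCommGroup M']
    [Module R M'] (f : M →ₗ[R] M') (S : Finset (Fin c)) :
    (cechPieceMap x f S).comp (LocalizedModule.mkLinearMap (cechPowers x S) M) =
      (LocalizedModule.mkLinearMap (cechPowers x S) M').comp f :=
  IsLocalizedModule.lift_comp _ _ _ _

theorem cechPieceMap_id (M : Type u) [AddCommGroup M] [Module R M] (S : Finset (Fin c)) :
    cechPieceMap x (LinearMap.id : M →ₗ[R] M) S = LinearMap.id :=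
  IsLocalizedModule.map_id _ _

theorem cechPieceMap_zero (M M' : Type u) [AddCommGroup M] [Module R M] [AddCommGroup M']
    [Module R M'] (S : Finset (Fin c)) :
    cechPieceMap x (0 : M →ₗ[R] M') S = 0 :=
  map_zero (IsLocalizedModule.map (cechPowers x S) _ _)

theorem cechPieceMap_comp {M M' M'' : Type u} [AddCommGroup M] [Module R M] [AddCommGroup M']
    [Module R M'] [AddCommGroup M''] [Module R M''] (f : M →ₗ[R] M') (f' : M' →ₗ[R] M'')
    (S : Finset (Fin c)) :
    cechPieceMap x (f'.comp f) S = (cechPieceMap x f' S).comp (cechPieceMap x f S) :=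
  IsLocalizedModule.map_comp' _ _ _ _ _ _

theorem cechPieceMap_face {M M' : Type u} [AddCommGroup M] [Module R M] [AddCommGroup M']
    [Module R M'] (f : M →ₗ[R] M') {S T : Finset (Fin c)} (h : S ⊆ T) :
    (cechPieceMap x f T).comp (cechFace x M h) = (cechFace x M' h).comp (cechPieceMap x f S) := by
  apply IsLocalizedModule.ext (cechPowers x S) (LocalizedModule.mkLinearMap (cechPowers x S) M)
    (cechPiece_isUnit x M' h)
  rw [LinearMap.comp_assoc, cechFace_comp_mk, LinearMap.comp_assoc, cechPieceMap_comp_mk,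
    cechPieceMap_comp_mk, ← LinearMap.comp_assoc, cechFace_comp_mk]

/-- The degree `i` term `⨁_{|S| = i} M_{x_S}` of the Čech complex, for an integer `i`
(a finite product; it is zero unless `0 ≤ i ≤ c`). -/
abbrev CechTerm (M : Type u) [AddCommGroup M] [Module R M] (i : ℤ) : Type u :=
  ∀ S : {S : Finset (Fin c) // (S.card : ℤ) = i}, CechPiece x M S.1

/-- The component of a Čech cochain at an arbitrary `S`, taken to be `0` if `|S| ≠ i`. -/
def cechComponent (M : Type u) [AddCommGroup M] [Module R M] (i : ℤ) (S : Finset (Fin c)) :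
    CechTerm x M i →ₗ[R] CechPiece x M S :=
  if h : (S.card : ℤ) = i then LinearMap.proj (R := R)
    (φ := fun S : {S : Finset (Fin c) // (S.card : ℤ) = i} => CechPiece x M S.1) ⟨S, h⟩ else 0

variable (R) in
/-- The sign `(-1) ^ #{l ∈ T | l < k}`. -/
def cechSign (T : Finset (Fin c)) (k : Fin c) : R := (-1) ^ (T.filter (· < k)).card

/-- The Čech differential
`(d f)_T = ∑_{k ∈ T} (-1) ^ #{l ∈ T | l < k} • f_{T \ {k}}|_T` (zero unless `j = i + 1`). -/
def cechD (M : Type u) [AddCommGroup M] [Module R M] (i j : ℤ) :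
    CechTerm x M i →ₗ[R] CechTerm x M j :=
  LinearMap.pi fun T => ∑ k ∈ T.1, cechSign R T.1 k •
    (cechFace x M (Finset.erase_subset k T.1)).comp (cechComponent x M i (T.1.erase k))

theorem cechD_apply (M : Type u) [AddCommGroup M] [Module R M] (i j : ℤ) (f : CechTerm x M i)
    (T : {S : Finset (Fin c) // (S.card : ℤ) = j}) :
    cechD x M i j f T = ∑ k ∈ T.1, cechSign R T.1 k •
      cechFace x M (Finset.erase_subset k T.1) (cechComponent x M i (T.1.erase k) f) := by
  simp only [cechD, LinearMap.pi_apply, LinearMap.sum_apply, LinearMap.smul_apply,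
    LinearMap.comp_apply]

theorem cechD_shape (M : Type u) [AddCommGroup M] [Module R M] (i j : ℤ) (h : i + 1 ≠ j) :
    cechD x M i j = 0 := by
  refine LinearMap.ext fun f => funext fun T => ?_
  rw [cechD_apply]
  refine Finset.sum_eq_zero fun k hk => ?_
  have hT := T.2
  have h1 := Finset.card_erase_add_one hk
  have h2 : ¬ (((T.1.erase k).card : ℤ) = i) := by
    intro h3
    apply h
    omega
  rw [cechComponent, dif_neg h2, LinearMap.zero_apply, map_zero, smul_zero]

theorem cechSign_erase {U : Finset (Fin c)} {a b : Fin c} (ha : a ∈ U)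
    (hab : a < b) :
    cechSign R U a * cechSign R (U.erase a) b =
      -(cechSign R U b * cechSign R (U.erase b) a) := by
  have h1 : (U.erase b).filter (· < a) = U.filter (· < a) := by
    ext l
    simp only [Finset.mem_filter, Finset.mem_erase]
    constructor
    · rintro ⟨⟨_, h⟩, h'⟩
      exact ⟨h, h'⟩
    · rintro ⟨h, h'⟩
      exact ⟨⟨(h'.trans hab).ne, h⟩, h'⟩
  have h2 : (U.erase a).filter (· < b) = (U.filter (· < b)).erase a := by
    ext l
    simp only [Finset.mem_filter, Finset.mem_erase]
    tauto
  have h3 : ((U.filter (· < b)).erase a).card + 1 = (U.filter (· < b)).card :=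
    Finset.card_erase_add_one (by simp [ha, hab])
  unfold cechSign
  rw [h1, h2, ← h3, pow_succ]
  ring

theorem cechFace_component_congr (M : Type u) [AddCommGroup M] [Module R M] (i : ℤ)
    (f : CechTerm x M i) {S S' U : Finset (Fin c)} (e : S = S') (h : S ⊆ U) (h' : S' ⊆ U) :
    cechFace x M h (cechComponent x M i S f) = cechFace x M h' (cechComponent x M i S' f) := by
  subst e
  rfl

theorem cechD_comp (M : Type u) [AddCommGroup M] [Module R M] (i j k : ℤ)
    (hjk : j + 1 = k) : (cechD x M j k).comp (cechD x M i j) = 0 := by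
  refine LinearMap.ext fun f => funext fun U => ?_
  have key : ∀ a ∈ U.1, cechComponent x M j (U.1.erase a) (cechD x M i j f) =
      ∑ b ∈ U.1.erase a, cechSign R (U.1.erase a) b •
        cechFace x M (Finset.erase_subset b (U.1.erase a))
          (cechComponent x M i ((U.1.erase a).erase b) f) := by
    intro a ha
    have h1 := Finset.card_erase_add_one ha
    have h2 := U.2
    have h3 : ((U.1.erase a).card : ℤ) = j := by omega
    rw [cechComponent, dif_pos h3, LinearMap.proj_apply, cechD_apply]
  rw [LinearMap.comp_apply, cechD_apply]
  have step : ∀ a ∈ U.1, cechSign R U.1 a • cechFace x M (Finset.erase_subset a U.1)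
      (cechComponent x M j (U.1.erase a) (cechD x M i j f)) =
      ∑ b ∈ U.1.erase a, (cechSign R U.1 a * cechSign R (U.1.erase a) b) •
        cechFace x M ((Finset.erase_subset b (U.1.erase a)).trans (Finset.erase_subset a U.1))
          (cechComponent x M i ((U.1.erase a).erase b) f) := by
    intro a ha
    rw [key a ha, map_sum, Finset.smul_sum]
    refine Finset.sum_congr rfl fun b _ => ?_
    rw [map_smul, smul_smul, ← cechFace_comp x M (Finset.erase_subset b (U.1.erase a))
      (Finset.erase_subset a U.1)]
    rfl
  rw [Finset.sum_congr rfl step, Finset.sum_sigma']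
  refine Finset.sum_involution (fun p _ => ⟨p.2, p.1⟩) ?_ ?_ ?_ ?_
  · rintro ⟨a, b⟩ hp
    simp only [Finset.mem_sigma, Finset.mem_erase] at hp
    obtain ⟨ha, hne, hb⟩ := hp
    dsimp only
    rw [cechFace_component_congr x M i f (Finset.erase_right_comm (a := b) (b := a) (s := U.1))
      _ ((Finset.erase_subset b (U.1.erase a)).trans (Finset.erase_subset a U.1)), ← add_smul]
    rcases lt_or_gt_of_ne hne with h | h
    · rw [cechSign_erase hb h]
      simp
    · rw [cechSign_erase ha h]
      simp
  · rintro ⟨a, b⟩ hp _ h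
    simp only [Finset.mem_sigma, Finset.mem_erase] at hp
    simp only [Sigma.mk.injEq, heq_eq_eq] at h
    exact hp.2.1 h.1
  · rintro ⟨a, b⟩ hp
    simp only [Finset.mem_sigma, Finset.mem_erase] at hp ⊢
    exact ⟨hp.2.2, hp.2.1.symm, hp.1⟩
  · rintro ⟨a, b⟩ _
    rfl

/-- The Čech complex of `M` with respect to `x_1, …, x_c`, as a functor of `M`. -/
def cechComplex : ModuleCat.{u} R ⥤ CochainComplex (ModuleCat.{u} R) ℤ where
  obj M :=
    { X := fun i => ModuleCat.of R (CechTerm x M i)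
      d := fun i j => ModuleCat.ofHom (cechD x M i j)
      shape := fun i j h => by
        rw [cechD_shape x M i j h]
        rfl
      d_comp_d' := fun i j k _ hjk => by
        rw [← ModuleCat.ofHom_comp, cechD_comp x M i j k hjk]
        rfl }
  map {M M'} f :=
    { f := fun i => ModuleCat.ofHom (LinearMap.pi fun S =>
        (cechPieceMap x f.hom S.1).comp (LinearMap.proj S))
      comm' := fun i j _ => by
        refine ModuleCat.hom_ext (LinearMap.ext fun g => funext fun T => ?_)
        have h1 : ∀ S : Finset (Fin c), cechComponent x M' i S
            (fun S => cechPieceMap x f.hom S.1 (g S)) =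
            cechPieceMap x f.hom S (cechComponent x M i S g) := by
          intro S
          by_cases h : (S.card : ℤ) = i
          · simp [cechComponent, h]
          · simp [cechComponent, h]
        change cechD x M' i j (fun S => cechPieceMap x f.hom S.1 (g S)) T =
          cechPieceMap x f.hom T.1 (cechD x M i j g T)
        rw [cechD_apply, cechD_apply, map_sum]
        refine Finset.sum_congr rfl fun k _ => ?_
        rw [h1, map_smul]
        congr 1
        exact (LinearMap.congr_fun
          (cechPieceMap_face x f.hom (Finset.erase_subset k T.1)) _).symm }
  map_id M := by
    refine HomologicalComplex.hom_ext _ _ fun i =>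
      ModuleCat.hom_ext (LinearMap.ext fun g => funext fun S => ?_)
    exact LinearMap.congr_fun (cechPieceMap_id x M S.1) (g S)
  map_comp {M M' M''} f f' := by
    refine HomologicalComplex.hom_ext _ _ fun i =>
      ModuleCat.hom_ext (LinearMap.ext fun g => funext fun S => ?_)
    exact LinearMap.congr_fun (cechPieceMap_comp x f.hom f'.hom S.1) (g S)

instance : (cechComplex x).PreservesZeroMorphisms where
  map_zero M M' := by
    refine HomologicalComplex.hom_ext _ _ fun i =>
      ModuleCat.hom_ext (LinearMap.ext fun g => funext fun S => ?_)
    exact LinearMap.congr_fun (cechPieceMap_zero x M M' S.1) (g S)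

/-- The Čech complex regraded homologically: its degree `q` term is `C(M)^{c - q}`, `q ≥ 0`. -/
def cechChain : ModuleCat.{u} R ⥤ ChainComplex (ModuleCat.{u} R) ℕ :=
  cechComplex x ⋙ (ComplexShape.embeddingUpIntLE (c : ℤ)).restrictionFunctor (ModuleCat.{u} R)

instance : (cechChain x).PreservesZeroMorphisms := by
  unfold cechChain
  infer_instance

/-- The first quadrant double complex with `(p, q)` term `C(F_p ⊗ X)^{c - q}`; here `p` is the
first (outer) index. -/
def cechBicomplex (F : ChainComplex (ModuleCat.{u} R) ℕ) (X : ModuleCat.{u} R) :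
    HomologicalComplex₂ (ModuleCat.{u} R) (ComplexShape.down ℕ) (ComplexShape.down ℕ) :=
  ((cechChain x).mapHomologicalComplex (ComplexShape.down ℕ)).obj
    (((MonoidalCategory.tensorRight X).mapHomologicalComplex (ComplexShape.down ℕ)).obj F)

end Cech

/-! ### Filtered complexes and their spectral sequences -/

/-- The total complex of a first quadrant double complex: in degree `n` it is
`⨁_{p + q = n} T_{p, q}`. -/
abbrev totComplex
    (T : HomologicalComplex₂ (ModuleCat.{u} R) (ComplexShape.down ℕ) (ComplexShape.down ℕ)) :
    ChainComplex (ModuleCat.{u} R) ℕ :=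
  T.total (ComplexShape.down ℕ)

/-- The first filtration of the total complex: `F_p Tot_n = ⨁_{i ≤ p} T_{i, n - i}`. -/
def firstFiltration
    (T : HomologicalComplex₂ (ModuleCat.{u} R) (ComplexShape.down ℕ) (ComplexShape.down ℕ))
    (p : ℤ) (n : ℕ) : Submodule R ((totComplex T).X n) :=
  ⨆ (i : ℕ) (j : ℕ) (h : i + j = n) (_ : (i : ℤ) ≤ p),
    LinearMap.range (T.ιTotal (ComplexShape.down ℕ) i j n h).hom

section Filtered

variable (K : ChainComplex (ModuleCat.{u} R) ℕ) (Fil : ℤ → ∀ n : ℕ, Submodule R (K.X n))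

/-- `Z^r_p = {z ∈ F_p K_n | d z ∈ F_{p - r} K_{n - 1}}`. -/
def pageCycles (r p : ℤ) (n : ℕ) : Submodule R (K.X n) :=
  Fil p n ⊓ ⨅ m : ℕ, (Fil (p - r) m).comap (K.d n m).hom

/-- `Z^{r-1}_{p-1} + d Z^{r-1}_{p+r-1}` in `K_n`, so that
`E^r_p = Z^r_p / (Z^{r-1}_{p-1} + d Z^{r-1}_{p+r-1})`. -/
def pageBoundaries (r p : ℤ) (n : ℕ) : Submodule R (K.X n) :=
  pageCycles K Fil (r - 1) (p - 1) n ⊔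
    ⨆ m : ℕ, (pageCycles K Fil (r - 1) (p + r - 1) m).map (K.d m n).hom

/-- The filtration of `H_n(K)` induced by a filtration of `K`: its `p`-th term is the set of
classes of the cycles lying in `F_p K_n`. -/
def homologyFiltration (n : ℕ) (p : ℤ) : Submodule R (K.homology n) :=
  ((Fil p n).comap (K.iCycles n).hom).map (K.homologyπ n).hom

end Filtered

variable (R) in
/-- First quadrant `E²` homological spectral sequences of `R`-modules: the pages are indexed by
`(p, q) ∈ ℕ × ℕ`, start at `r = 2`, and `d^r` has bidegree `(-r, r - 1)`. -/
abbrev FirstQuadrantSpectralSequence : Type (u + 1) :=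
  SpectralSequence (ModuleCat.{u} R)
    (fun r => ComplexShape.spectralSequenceNat (⟨-r, r - 1⟩ : ℤ × ℤ)) 2

/-- `E` is the spectral sequence of the filtered complex `(K, Fil)`: there are surjections
`Z^r_p → E^r_{p,q}` with kernel `Z^{r-1}_{p-1} + d Z^{r-1}_{p+r-1}` under which the differentials
`d^r` are induced by the differential of `K` and the isomorphisms `H(E^r) ≅ E^{r+1}` are induced
by the inclusions `Z^{r+1}_p ⊆ Z^r_p`. -/
def IsSpectralSequenceOf (E : FirstQuadrantSpectralSequence R)
    (K : ChainComplex (ModuleCat.{u} R) ℕ) (Fil : ℤ → ∀ n : ℕ, Submodule R (K.X n)) : Prop :=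
  ∃ π : ∀ (r : ℤ) (hr : 2 ≤ r) (p q : ℕ),
      pageCycles K Fil r p (p + q) →ₗ[R] (E.page r hr).X (p, q),
    (∀ (r : ℤ) (hr : 2 ≤ r) (p q : ℕ), Function.Surjective (π r hr p q)) ∧
    (∀ (r : ℤ) (hr : 2 ≤ r) (p q : ℕ) (z : pageCycles K Fil r p (p + q)),
      π r hr p q z = 0 ↔ (z : K.X (p + q)) ∈ pageBoundaries K Fil r p (p + q)) ∧
    (∀ (r : ℤ) (hr : 2 ≤ r) (p q p' q' : ℕ), (p : ℤ) - r = p' → (q : ℤ) + (r - 1) = q' →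
      ∀ (z : pageCycles K Fil r p (p + q)) (z' : pageCycles K Fil r p' (p' + q')),
        (z' : K.X (p' + q')) = (K.d (p + q) (p' + q')).hom z →
        ((E.page r hr).d (p, q) (p', q')).hom (π r hr p q z) = π r hr p' q' z') ∧
    (∀ (r : ℤ) (hr : 2 ≤ r) (p q : ℕ) (z : pageCycles K Fil r p (p + q))
      (z' : pageCycles K Fil (r + 1) p (p + q)), (z' : K.X (p + q)) = z →
      ∀ w : (E.page r hr).cycles (p, q),
        ((E.page r hr).iCycles (p, q)).hom w = π r hr p q z →
        (E.iso r (r + 1) (p, q) rfl hr).hom.hom (((E.page r hr).homologyπ (p, q)).hom w) =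
          π (r + 1) (hr.trans (Int.le_add_one le_rfl)) p q z')

/-- Convergence `E²_{p,q} ⟹_p H_{p+q}` with respect to the filtrations `φ` of the `H_n`:
`0 = φ^{-1} H_n ⊆ φ^0 H_n ⊆ ⋯ ⊆ φ^n H_n = H_n` and
`E^∞_{p,q} ≅ φ^p H_{p+q} / φ^{p-1} H_{p+q}`, where `E^∞_{p,q}` is the stable value
`E^r_{p,q}`, `r > max (p, q + 1)`. -/
structure ConvergesTo (E : FirstQuadrantSpectralSequence R) (H : ℕ → ModuleCat.{u} R)
    (φ : ∀ n : ℕ, ℤ → Submodule R (H n)) : Prop where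
  mono : ∀ n : ℕ, Monotone (φ n)
  bot : ∀ n : ℕ, φ n (-1) = ⊥
  top : ∀ n : ℕ, φ n n = ⊤
  gr : ∀ (p q : ℕ) (r : ℤ) (hr : 2 ≤ r), (p : ℤ) < r → (q : ℤ) + 1 < r →
    Nonempty ((E.page r hr).X (p, q) ≃ₗ[R]
      (φ (p + q) p ⧸ (φ (p + q) ((p : ℤ) - 1)).submoduleOf (φ (p + q) p)))

end

/-! Filter the total complex of `𝒯_{p,q} = C(F_p ⊗ X)^{c-q}` by columns. Column `p` computes the
Čech cohomology of `F_p ⊗ X`. Since `F_p` is flat and localization commutes with tensor products,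
this is `F_p ⊗ H^{c-q}(C(X))`, compatibly with the differentials of `F`, so the second page is
`Tor_p(N, H^{c-q}(C(X)))` (`TotalComplex.secondPage`, `CechBicomplex.nonempty_secondPage_equiv`).
Over a Noetherian ring Čech cohomology is local cohomology (`Cech.nonempty_localCohomology_equiv`).

The abutment is read off from the rows. Row `q` is a product of localizations of `F ⊗ X` at the
`x_S` with `|S| = c - q`. For `q < c` the set `S` is nonempty, so every element of `N` is killed by
a power of `x_S`, hence so is every homology class of `F ⊗ X` (`FlatResolution.exists_pow_smul`),
and the localized row is exact, also at its end. Only row `c` survives. It is `F ⊗ X` itself, so the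
total homology in degree `n` is `Tor_{n-c}(N, X)` (`TotalComplex.homology_of_rows_exact`).

Čech and local cohomology are compared by dimension shifting
(`IsEffaceableSequence.nonempty_equiv`): both give the `𝔞`-torsion in degree zero, vanish on
injectives in positive degrees, and have connecting maps for embeddings into injectives. For Čech
cohomology the vanishing is `Cech.exactAt_of_injective`. For `J` injective and `r` in `R` the
sequence `0 → Γ_r(J) → J → J_r → 0` is exact, `Γ_r(J)` is again injective, and the Čech complex of
`J_r` is acyclic if `r` is one of the `x_j`. Splitting off the `x_j` one by one leaves a module on
which they are all locally nilpotent, and there the Čech terms of positive degree are zero.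

The spectral sequence is built from the subquotients `Z^r / B^r` of the filtered complex.
Convergence holds because for `r > max(p, q + 1)` the differentials at `(p, q)` start or end outside
the quadrant (`FilteredComplex.isSpectralSequenceOf`, `FilteredComplex.convergesTo`). -/

noncomputable section

/-! ### Cycles and homology classes as elements of modules -/

namespace ModuleComplex

variable {R : Type u} [CommRing R] {ι : Type*} {c : ComplexShape ι}
  (K : HomologicalComplex (ModuleCat.{u} R) c)

/-- The submodule of cycles in degree `i`. -/
def cyc (i : ι) : Submodule R (K.X i) := LinearMap.ker (K.d i (c.next i)).hom

variable {K}

theorem mem_cyc {i : ι} {x : K.X i} : x ∈ cyc K i ↔ ∀ j, (K.d i j).hom x = 0 := by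
  refine ⟨fun h j => ?_, fun h => h _⟩
  by_cases hj : c.Rel i j
  · obtain rfl := c.next_eq' hj
    exact h
  · rw [K.shape _ _ hj]
    rfl

theorem mem_cyc_of_rel {i j : ι} (hij : c.Rel i j) {x : K.X i} :
    x ∈ cyc K i ↔ (K.d i j).hom x = 0 := by
  obtain rfl := c.next_eq' hij
  exact Iff.rfl

theorem d_mem_cyc {i j : ι} (x : K.X i) : (K.d i j).hom x ∈ cyc K j := by
  refine mem_cyc.2 fun k => ?_
  rw [← LinearMap.comp_apply, ← ModuleCat.hom_comp, K.d_comp_d]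
  rfl

theorem d_d_apply {i j k : ι} (x : K.X i) : (K.d j k).hom ((K.d i j).hom x) = 0 :=
  mem_cyc.1 (d_mem_cyc x) k

theorem iCycles_mem_cyc {i : ι} (w : K.cycles i) : (K.iCycles i).hom w ∈ cyc K i := by
  refine mem_cyc.2 fun j => ?_
  rw [← LinearMap.comp_apply, ← ModuleCat.hom_comp, K.iCycles_d]
  rfl

theorem iCycles_injective (i : ι) : Function.Injective (K.iCycles i).hom :=
  (ModuleCat.mono_iff_injective (K.iCycles i)).1 inferInstance

theorem homologyπ_surjective (i : ι) : Function.Surjective (K.homologyπ i).hom :=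
  (ModuleCat.epi_iff_surjective (K.homologyπ i)).1 inferInstance

variable (K) in
/-- The inclusion of the module of cycles, lifted to the cycles of the homology theory. -/
def cycLift (i : ι) : cyc K i →ₗ[R] K.cycles i :=
  (K.liftCycles (ModuleCat.ofHom (cyc K i).subtype) (c.next i) rfl (by
    refine ModuleCat.hom_ext (LinearMap.ext fun x => ?_)
    exact x.2)).hom

@[simp]
theorem iCycles_cycLift {i : ι} (z : cyc K i) : (K.iCycles i).hom (cycLift K i z) = z := by
  have := K.liftCycles_i (ModuleCat.ofHom (cyc K i).subtype) (c.next i) rfl (by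
    refine ModuleCat.hom_ext (LinearMap.ext fun x => ?_)
    exact x.2)
  exact LinearMap.congr_fun (congrArg ModuleCat.Hom.hom this) z

variable (K) in
/-- The homology class of a cycle. -/
def cls (i : ι) : cyc K i →ₗ[R] K.homology i := (K.homologyπ i).hom ∘ₗ cycLift K i

theorem homologyπ_apply {i : ι} (w : K.cycles i) :
    (K.homologyπ i).hom w = cls K i ⟨(K.iCycles i).hom w, iCycles_mem_cyc w⟩ := by
  unfold cls
  rw [LinearMap.comp_apply]
  congr 1
  apply iCycles_injective
  rw [iCycles_cycLift]

variable (K) in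
/-- The homology classes of the values of a linear map with values in the cycles. -/
def clsOf {Z : Type*} [AddCommGroup Z] [Module R Z] {i : ι} (f : Z →ₗ[R] K.X i)
    (hf : ∀ z, f z ∈ cyc K i) : Z →ₗ[R] K.homology i :=
  cls K i ∘ₗ f.codRestrict _ hf

theorem clsOf_apply {Z : Type*} [AddCommGroup Z] [Module R Z] {i : ι} (f : Z →ₗ[R] K.X i)
    (hf : ∀ z, f z ∈ cyc K i) (z : Z) : clsOf K f hf z = cls K i ⟨f z, hf z⟩ := rfl

theorem cls_surjective (i : ι) : Function.Surjective (cls K i) := by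
  intro h
  obtain ⟨w, rfl⟩ := homologyπ_surjective i h
  exact ⟨_, (homologyπ_apply w).symm⟩

theorem homologyπ_eq_zero_iff {i : ι} (w : K.cycles i) :
    (K.homologyπ i).hom w = 0 ↔
      ∃ y : K.X (c.prev i), (K.d (c.prev i) i).hom y = (K.iCycles i).hom w := by
  have h : (ShortComplex.mk (K.toCycles (c.prev i) i) (K.homologyπ i) (by simp)).Exact :=
    ShortComplex.exact_of_g_is_cokernel _ (K.homologyIsCokernel _ i rfl)
  have e : ∀ y, (K.iCycles i).hom ((K.toCycles (c.prev i) i).hom y) =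
      (K.d (c.prev i) i).hom y := fun y =>
    LinearMap.congr_fun (congrArg ModuleCat.Hom.hom (K.toCycles_i (c.prev i) i)) y
  rw [ShortComplex.moduleCat_exact_iff] at h
  constructor
  · intro hw
    obtain ⟨y, hy⟩ := h w hw
    refine ⟨y, ?_⟩
    rw [← e]
    exact congrArg _ hy
  · rintro ⟨y, hy⟩
    rw [← e] at hy
    rw [← iCycles_injective i hy, ← LinearMap.comp_apply, ← ModuleCat.hom_comp]
    simp

/-- Letting `j` range over all indices avoids choosing a predecessor of `i`; from an unrelated `j`
the differential is zero and contributes only the boundary `0`. -/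
theorem cls_eq_zero_iff {i : ι} (z : cyc K i) :
    cls K i z = 0 ↔ ∃ (j : ι) (y : K.X j), (K.d j i).hom y = z := by
  unfold cls
  rw [LinearMap.comp_apply, homologyπ_eq_zero_iff, iCycles_cycLift]
  refine ⟨fun ⟨y, hy⟩ => ⟨_, y, hy⟩, fun ⟨j, y, hy⟩ => ?_⟩
  by_cases hj : c.Rel j i
  · obtain rfl := c.prev_eq' hj
    exact ⟨y, hy⟩
  · rw [K.shape _ _ hj] at hy
    exact ⟨0, by rw [map_zero, ← hy]; rfl⟩

theorem cls_eq_zero_iff_of_rel {i j : ι} (h : c.Rel j i) (z : cyc K i) :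
    cls K i z = 0 ↔ ∃ y : K.X j, (K.d j i).hom y = z := by
  rw [cls_eq_zero_iff]
  refine ⟨fun ⟨j', y, hy⟩ => ?_, fun ⟨y, hy⟩ => ⟨j, y, hy⟩⟩
  by_cases hj : c.Rel j' i
  · obtain rfl := c.prev_eq hj h
    exact ⟨y, hy⟩
  · rw [K.shape _ _ hj] at hy
    exact ⟨0, by rw [map_zero, ← hy]; rfl⟩

theorem map_mem_cyc {L : HomologicalComplex (ModuleCat.{u} R) c} (f : K ⟶ L) {i : ι} {z : K.X i}
    (hz : z ∈ cyc K i) : (f.f i).hom z ∈ cyc L i := by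
  refine mem_cyc.2 fun j => ?_
  have h := LinearMap.congr_fun (congrArg ModuleCat.Hom.hom (f.comm i j)) z
  refine h.trans ?_
  rw [ModuleCat.hom_comp, LinearMap.comp_apply, mem_cyc.1 hz j, map_zero]

theorem comm_apply {L : HomologicalComplex (ModuleCat.{u} R) c} (f : K ⟶ L) (i j : ι) (z : K.X i) :
    (L.d i j).hom ((f.f i).hom z) = (f.f j).hom ((K.d i j).hom z) :=
  LinearMap.congr_fun (congrArg ModuleCat.Hom.hom (f.comm i j)) z

theorem homologyMap_cls {L : HomologicalComplex (ModuleCat.{u} R) c} (f : K ⟶ L) {i : ι}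
    (z : cyc K i) :
    (HomologicalComplex.homologyMap f i).hom (cls K i z) =
      cls L i ⟨(f.f i).hom z, map_mem_cyc f z.2⟩ := by
  unfold cls
  rw [LinearMap.comp_apply, LinearMap.comp_apply]
  have h1 := LinearMap.congr_fun (congrArg ModuleCat.Hom.hom
    (HomologicalComplex.homologyπ_naturality f i)) (cycLift K i z)
  refine h1.trans ?_
  change (L.homologyπ i).hom _ = _
  congr 1
  apply iCycles_injective
  rw [iCycles_cycLift]
  have h2 := LinearMap.congr_fun (congrArg ModuleCat.Hom.hom
    (HomologicalComplex.cyclesMap_i f i)) (cycLift K i z)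
  refine h2.trans ?_
  change (f.f i).hom ((K.iCycles i).hom _) = _
  rw [iCycles_cycLift]

/-- A surjection from a module `Z` whose kernel is that of a surjection `Z → A` induces an
isomorphism. -/
def equivOfSurjective {Z A B : Type*} [AddCommGroup Z] [Module R Z] [AddCommGroup A] [Module R A]
    [AddCommGroup B] [Module R B] (f : Z →ₗ[R] A) (g : Z →ₗ[R] B) (hf : Function.Surjective f)
    (hg : Function.Surjective g) (h : ∀ z, f z = 0 ↔ g z = 0) : A ≃ₗ[R] B :=
  (f.quotKerEquivOfSurjective hf).symm ≪≫ₗ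
    Submodule.quotEquivOfEq (LinearMap.ker f) (LinearMap.ker g) (Submodule.ext h) ≪≫ₗ g.quotKerEquivOfSurjective hg

@[simp]
theorem equivOfSurjective_apply {Z A B : Type*} [AddCommGroup Z] [Module R Z] [AddCommGroup A]
    [Module R A] [AddCommGroup B] [Module R B] (f : Z →ₗ[R] A) (g : Z →ₗ[R] B)
    (hf : Function.Surjective f) (hg : Function.Surjective g) (h : ∀ z, f z = 0 ↔ g z = 0)
    (z : Z) : equivOfSurjective f g hf hg h (f z) = g z := by
  have : (f.quotKerEquivOfSurjective hf).symm (f z) = Submodule.Quotient.mk z := by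
    rw [LinearEquiv.symm_apply_eq]
    rfl
  unfold equivOfSurjective
  rw [LinearEquiv.trans_apply, LinearEquiv.trans_apply, this]
  rfl

/-- Homology is computed by any surjection from the cycles that kills exactly the boundaries. -/
def homologyEquiv {i : ι} {A : Type*} [AddCommGroup A] [Module R A] (g : cyc K i →ₗ[R] A)
    (hg : Function.Surjective g)
    (h : ∀ z, g z = 0 ↔ ∃ (j : ι) (y : K.X j), (K.d j i).hom y = z) : K.homology i ≃ₗ[R] A :=
  equivOfSurjective (cls K i) g (cls_surjective i) hg fun z => by rw [cls_eq_zero_iff, h]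

theorem homologyEquiv_cls {i : ι} {A : Type*} [AddCommGroup A] [Module R A] (g : cyc K i →ₗ[R] A)
    (hg : Function.Surjective g)
    (h : ∀ z, g z = 0 ↔ ∃ (j : ι) (y : K.X j), (K.d j i).hom y = z) (z : cyc K i) :
    homologyEquiv g hg h (cls K i z) = g z :=
  equivOfSurjective_apply _ _ _ _ _ _

theorem subsingleton_homology {i : ι}
    (h : ∀ z ∈ cyc K i, ∃ (j : ι) (y : K.X j), (K.d j i).hom y = z) :
    Subsingleton (K.homology i) := by
  refine subsingleton_of_forall_eq 0 fun w => ?_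
  obtain ⟨z, rfl⟩ := cls_surjective i w
  exact (cls_eq_zero_iff z).2 (h z z.2)

end ModuleComplex

end

/-! ### The spectral sequence of a filtered complex and its convergence -/

noncomputable section

/-- A first quadrant filtration of a nonnegative chain complex: increasing, stable under the
differential, zero in negative filtration degrees and exhausted in degree `n` by its `n`-th term. -/
structure IsFirstQuadrantFiltration {R : Type u} [CommRing R]
    (K : ChainComplex (ModuleCat.{u} R) ℕ) (Fil : ℤ → ∀ n : ℕ, Submodule R (K.X n)) : Prop where
  mono : ∀ n : ℕ, Monotone fun p => Fil p n
  d_mem : ∀ (p : ℤ) (m n : ℕ) (z : K.X m), z ∈ Fil p m → (K.d m n).hom z ∈ Fil p n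
  bot : ∀ (p : ℤ) (n : ℕ), p < 0 → Fil p n = ⊥
  top : ∀ (p : ℤ) (n : ℕ), (n : ℤ) ≤ p → Fil p n = ⊤

namespace FilteredComplex

open ModuleComplex

variable {R : Type u} [CommRing R] {K : ChainComplex (ModuleCat.{u} R) ℕ}
  {Fil : ℤ → ∀ n : ℕ, Submodule R (K.X n)}

theorem mem_pageCycles {r p : ℤ} {n : ℕ} {z : K.X n} :
    z ∈ pageCycles K Fil r p n ↔
      z ∈ Fil p n ∧ ∀ m, (K.d n m).hom z ∈ Fil (p - r) m := by
  simp only [pageCycles, Submodule.mem_inf, Submodule.mem_iInf, Submodule.mem_comap]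

theorem mem_pageCycles_succ {r p : ℤ} {n : ℕ} {z : K.X (n + 1)} :
    z ∈ pageCycles K Fil r p (n + 1) ↔
      z ∈ Fil p (n + 1) ∧ (K.d (n + 1) n).hom z ∈ Fil (p - r) n := by
  rw [mem_pageCycles]
  refine and_congr_right fun _ => ⟨fun h => h n, fun h m => ?_⟩
  by_cases hm : m + 1 = n + 1
  · obtain rfl : m = n := by omega
    exact h
  · rw [K.shape _ _ hm]
    exact zero_mem _

variable (hF : IsFirstQuadrantFiltration K Fil)
include hF

omit hF in
theorem mem_pageBoundaries {r p : ℤ} {n : ℕ} {z : K.X n} :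
    z ∈ pageBoundaries K Fil r p n ↔ ∃ y ∈ pageCycles K Fil (r - 1) (p - 1) n,
      ∃ u ∈ pageCycles K Fil (r - 1) (p + r - 1) (n + 1), y + (K.d (n + 1) n).hom u = z := by
  have h : (⨆ m : ℕ, (pageCycles K Fil (r - 1) (p + r - 1) m).map (K.d m n).hom) =
      (pageCycles K Fil (r - 1) (p + r - 1) (n + 1)).map (K.d (n + 1) n).hom := by
    refine le_antisymm (iSup_le fun m => ?_)
      (le_iSup (fun m => (pageCycles K Fil (r - 1) (p + r - 1) m).map (K.d m n).hom) (n + 1))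
    by_cases hm : n + 1 = m
    · subst hm
      exact le_rfl
    · rw [K.shape _ _ hm]
      rintro _ ⟨y, -, rfl⟩
      exact zero_mem _
  rw [pageBoundaries, h, Submodule.mem_sup]
  constructor
  · rintro ⟨y, hy, _, ⟨u, hu, rfl⟩, e⟩
    exact ⟨y, hy, u, hu, e⟩
  · rintro ⟨y, hy, u, hu, e⟩
    exact ⟨y, hy, _, ⟨u, hu, rfl⟩, e⟩

/-- `Z^r_p` depends only on the two bounds `p` and `p - r`, and grows with each of them. -/
theorem pageCycles_mono {r r' p p' : ℤ} (n : ℕ) (h : p ≤ p') (h' : p - r ≤ p' - r') :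
    pageCycles K Fil r p n ≤ pageCycles K Fil r' p' n := by
  intro z hz
  rw [mem_pageCycles] at hz ⊢
  exact ⟨hF.mono n h hz.1, fun m => hF.mono m h' (hz.2 m)⟩

omit hF in
-- The second condition on a boundary is empty because `d ∘ d = 0`, so `r'` is arbitrary.
theorem d_mem_pageCycles {r p : ℤ} {m n : ℕ} {z : K.X m} (r' : ℤ)
    (hz : z ∈ pageCycles K Fil r p m) : (K.d m n).hom z ∈ pageCycles K Fil r' (p - r) n := by
  rw [mem_pageCycles] at hz ⊢
  refine ⟨hz.2 n, fun l => ?_⟩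
  rw [d_d_apply]
  exact zero_mem _

/-- The differential of `K` carries boundaries of a page to boundaries. -/
theorem d_mem_pageBoundaries {r p : ℤ} {n : ℕ} {z : K.X (n + 1)}
    (hz : z ∈ pageBoundaries K Fil r p (n + 1)) :
    (K.d (n + 1) n).hom z ∈ pageBoundaries K Fil r (p - r) n := by
  rw [mem_pageBoundaries] at hz
  obtain ⟨y, hy, u, hu, rfl⟩ := hz
  rw [mem_pageBoundaries]
  refine ⟨0, zero_mem _, y, pageCycles_mono hF _ (by linarith) (by linarith) hy, ?_⟩
  rw [map_add, d_d_apply, add_zero, zero_add]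

omit hF in
variable (K Fil) in
/-- The term `E^r_{p,q}` of the spectral sequence of a filtered complex. -/
abbrev PageTerm (r : ℤ) (a : ℕ × ℕ) : Type u :=
  pageCycles K Fil r a.1 (a.1 + a.2) ⧸
    (pageBoundaries K Fil r a.1 (a.1 + a.2)).submoduleOf (pageCycles K Fil r a.1 (a.1 + a.2))

omit hF in
variable (K Fil) in
/-- The projection `Z^r_p → E^r_{p,q}`. -/
def pageMk (r : ℤ) (a : ℕ × ℕ) :
    pageCycles K Fil r a.1 (a.1 + a.2) →ₗ[R] PageTerm K Fil r a :=
  Submodule.mkQ _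

omit hF in
theorem pageMk_surjective (r : ℤ) (a : ℕ × ℕ) : Function.Surjective (pageMk K Fil r a) :=
  Submodule.mkQ_surjective _

omit hF in
theorem pageMk_eq_zero_iff {r : ℤ} {a : ℕ × ℕ} (z : pageCycles K Fil r a.1 (a.1 + a.2)) :
    pageMk K Fil r a z = 0 ↔ (z : K.X (a.1 + a.2)) ∈ pageBoundaries K Fil r a.1 (a.1 + a.2) :=
  Submodule.Quotient.mk_eq_zero _

omit hF in
theorem rel_degree {r : ℤ} {a b : ℕ × ℕ}
    (h : (ComplexShape.spectralSequenceNat (⟨-r, r - 1⟩ : ℤ × ℤ)).Rel a b) :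
    a.1 + a.2 = b.1 + b.2 + 1 := by
  obtain ⟨h1, h2⟩ := h
  simp only at h1 h2
  omega

omit hF in
theorem d_mem_of_rel {r : ℤ} {a b : ℕ × ℕ}
    (h : (ComplexShape.spectralSequenceNat (⟨-r, r - 1⟩ : ℤ × ℤ)).Rel a b)
    (z : K.X (a.1 + a.2)) (hz : z ∈ pageCycles K Fil r a.1 (a.1 + a.2)) :
    (K.d (a.1 + a.2) (b.1 + b.2)).hom z ∈ pageCycles K Fil r b.1 (b.1 + b.2) := by
  have h1 : (a.1 : ℤ) - r = b.1 := by
    have := h.1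
    simp only at this
    omega
  rw [← h1]
  exact d_mem_pageCycles r hz

theorem d_mem_boundaries_of_rel {r : ℤ} {a b : ℕ × ℕ}
    (h : (ComplexShape.spectralSequenceNat (⟨-r, r - 1⟩ : ℤ × ℤ)).Rel a b)
    (z : K.X (a.1 + a.2)) (hz : z ∈ pageBoundaries K Fil r a.1 (a.1 + a.2)) :
    (K.d (a.1 + a.2) (b.1 + b.2)).hom z ∈ pageBoundaries K Fil r b.1 (b.1 + b.2) := by
  have h1 : (a.1 : ℤ) - r = b.1 := by
    have := h.1
    simp only at this
    omega
  rw [← h1]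
  have hdeg := rel_degree h
  clear h h1
  generalize a.1 + a.2 = n at z hz hdeg
  subst hdeg
  exact d_mem_pageBoundaries hF hz

/-- The differential `d^r` along a relation of the complex shape. -/
def pageD (r : ℤ) (a b : ℕ × ℕ)
    (h : (ComplexShape.spectralSequenceNat (⟨-r, r - 1⟩ : ℤ × ℤ)).Rel a b) :
    PageTerm K Fil r a →ₗ[R] PageTerm K Fil r b :=
  Submodule.mapQ _ _ ((K.d (a.1 + a.2) (b.1 + b.2)).hom.restrict (d_mem_of_rel h))
    fun z hz => d_mem_boundaries_of_rel hF h z hz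

theorem pageD_mk {r : ℤ} {a b : ℕ × ℕ}
    (h : (ComplexShape.spectralSequenceNat (⟨-r, r - 1⟩ : ℤ × ℤ)).Rel a b)
    (z : pageCycles K Fil r a.1 (a.1 + a.2)) :
    pageD hF r a b h (pageMk K Fil r a z) = pageMk K Fil r b ⟨_, d_mem_of_rel h z z.2⟩ :=
  rfl

open Classical in
/-- The `r`-th page of the spectral sequence of a filtered complex. -/
def page (r : ℤ) : HomologicalComplex (ModuleCat.{u} R)
    (ComplexShape.spectralSequenceNat (⟨-r, r - 1⟩ : ℤ × ℤ)) where
  X a := ModuleCat.of R (PageTerm K Fil r a)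
  d a b := if h : (ComplexShape.spectralSequenceNat (⟨-r, r - 1⟩ : ℤ × ℤ)).Rel a b then
    ModuleCat.ofHom (pageD hF r a b h) else 0
  shape a b h := dif_neg h
  d_comp_d' a b e h h' := by
    rw [dif_pos h, dif_pos h']
    refine ModuleCat.hom_ext (LinearMap.ext fun x => ?_)
    obtain ⟨z, rfl⟩ := pageMk_surjective r a x
    change pageD hF r b e h' (pageD hF r a b h (pageMk K Fil r a z)) = 0
    rw [pageD_mk, pageD_mk, pageMk_eq_zero_iff]
    dsimp only
    rw [d_d_apply]
    exact zero_mem _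

/-- The class in the `r`-th page of an element of `Z^r_p`. -/
def pageCls (r : ℤ) (a : ℕ × ℕ) :
    pageCycles K Fil r a.1 (a.1 + a.2) →ₗ[R] (page hF r).X a :=
  pageMk K Fil r a

theorem pageCls_surjective (r : ℤ) (a : ℕ × ℕ) : Function.Surjective (pageCls hF r a) :=
  pageMk_surjective _ _

theorem pageCls_eq_zero_iff {r : ℤ} {a : ℕ × ℕ} (z : pageCycles K Fil r a.1 (a.1 + a.2)) :
    pageCls hF r a z = 0 ↔ (z : K.X (a.1 + a.2)) ∈ pageBoundaries K Fil r a.1 (a.1 + a.2) :=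
  pageMk_eq_zero_iff z

theorem pageCls_eq_iff {r : ℤ} {a : ℕ × ℕ} (z z' : pageCycles K Fil r a.1 (a.1 + a.2)) :
    pageCls hF r a z = pageCls hF r a z' ↔
      (z : K.X (a.1 + a.2)) - z' ∈ pageBoundaries K Fil r a.1 (a.1 + a.2) := by
  rw [← sub_eq_zero, ← map_sub, pageCls_eq_zero_iff]
  rfl

theorem page_d_cls {r : ℤ} {a b : ℕ × ℕ}
    (h : (ComplexShape.spectralSequenceNat (⟨-r, r - 1⟩ : ℤ × ℤ)).Rel a b)
    (z : pageCycles K Fil r a.1 (a.1 + a.2)) :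
    ((page hF r).d a b).hom (pageCls hF r a z) = pageCls hF r b ⟨_, d_mem_of_rel h z z.2⟩ := by
  have : (page hF r).d a b = ModuleCat.ofHom (pageD hF r a b h) := dif_pos h
  rw [this]
  rfl

/-- The class of `z` in `E^r` is a cycle if `z ∈ Z^{r+1}`. -/
theorem pageCls_mem_cyc {r : ℤ} {a : ℕ × ℕ} (z : pageCycles K Fil r a.1 (a.1 + a.2))
    (hz : (z : K.X (a.1 + a.2)) ∈ pageCycles K Fil (r + 1) a.1 (a.1 + a.2)) :
    pageCls hF r a z ∈ cyc (page hF r) a := by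
  refine mem_cyc.2 fun b => ?_
  by_cases h : (ComplexShape.spectralSequenceNat (⟨-r, r - 1⟩ : ℤ × ℤ)).Rel a b
  · rw [page_d_cls hF h, pageCls_eq_zero_iff, mem_pageBoundaries]
    refine ⟨_, ?_, 0, zero_mem _, by rw [map_zero, add_zero]⟩
    have h1 : (b.1 : ℤ) - 1 = a.1 - (r + 1) := by
      have := h.1
      simp only at this
      omega
    rw [h1]
    exact d_mem_pageCycles _ hz
  · rw [(page hF r).shape _ _ h]
    rfl

/-- This makes `Z^{r+1}_p` surject onto the kernel of `d^r`. If `d z = y + d u` with `y ∈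
Z^{r-1}_{p-r-1}` and `u ∈ Z^{r-1}_{p-1}`, then `d (z - u) = y` lies one filtration step lower, while
`u` is itself one of the boundaries of `E^r_p`. -/
theorem exists_sub_mem_pageBoundaries {r p : ℤ} {n : ℕ} {z : K.X (n + 1)}
    (hz : z ∈ pageCycles K Fil r p (n + 1))
    (hdz : (K.d (n + 1) n).hom z ∈ pageBoundaries K Fil r (p - r) n) :
    ∃ z' ∈ pageCycles K Fil (r + 1) p (n + 1), z - z' ∈ pageBoundaries K Fil r p (n + 1) := by
  rw [mem_pageBoundaries] at hdz
  obtain ⟨y, hy, u, hu, e⟩ := hdz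
  rw [show p - r + r - 1 = p - 1 by ring] at hu
  refine ⟨z - u, ?_, ?_⟩
  · rw [mem_pageCycles_succ] at hz ⊢
    refine ⟨sub_mem hz.1 (hF.mono _ (by linarith) (mem_pageCycles.1 hu).1), ?_⟩
    rw [map_sub, ← e, add_sub_cancel_right]
    exact hF.mono _ (by linarith) (mem_pageCycles.1 hy).1
  · rw [mem_pageBoundaries]
    exact ⟨u, hu, 0, zero_mem _, by simp⟩

/-- This bounds the kernel of `Z^{r+1} → H(E^r)`. Write `z - d u = y + d v`. Then `z = y + d (u +
v)`, where `v` also lies in the larger module `Z^r_{p+r}`, and `y` gains a filtration step because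
`d y = d z`. -/
theorem mem_pageBoundaries_succ {r p : ℤ} {n : ℕ} {z : K.X n} {u : K.X (n + 1)}
    (hz : z ∈ pageCycles K Fil (r + 1) p n) (hu : u ∈ pageCycles K Fil r (p + r) (n + 1))
    (h : z - (K.d (n + 1) n).hom u ∈ pageBoundaries K Fil r p n) :
    z ∈ pageBoundaries K Fil (r + 1) p n := by
  rw [mem_pageBoundaries] at h ⊢
  obtain ⟨y, hy, v, hv, e⟩ := h
  have hv' := pageCycles_mono hF (r := r - 1) (r' := r) (p := p + r - 1) (p' := p + r)
    (n + 1) (by linarith) (by linarith) hv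
  have ez : z = y + (K.d (n + 1) n).hom (u + v) := by
    rw [map_add, add_left_comm, e]
    abel
  refine ⟨y, ?_, u + v, ?_, ez.symm⟩
  · rw [mem_pageCycles] at hy hz ⊢
    refine ⟨hy.1, fun m => ?_⟩
    have := hz.2 m
    rw [ez, map_add, d_d_apply, add_zero] at this
    exact hF.mono _ (by linarith) this
  · exact pageCycles_mono hF _ (by linarith) (by linarith) (add_mem hu hv')

/-- Converse to `mem_pageBoundaries_succ`: an element that dies in `E^{r+1}` is already, modulo the
boundaries of `E^r`, in the image of `d^r`. -/
theorem exists_of_mem_pageBoundaries_succ {r p : ℤ} {n : ℕ} {z : K.X n}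
    (hz : z ∈ pageBoundaries K Fil (r + 1) p n) :
    ∃ u ∈ pageCycles K Fil r (p + r) (n + 1),
      z - (K.d (n + 1) n).hom u ∈ pageBoundaries K Fil r p n := by
  rw [mem_pageBoundaries] at hz
  obtain ⟨y, hy, u, hu, rfl⟩ := hz
  refine ⟨u, pageCycles_mono hF _ (by linarith) (by linarith) hu, ?_⟩
  rw [add_sub_cancel_right, mem_pageBoundaries]
  exact ⟨y, pageCycles_mono hF _ (by linarith) (by linarith) hy, 0, zero_mem _, by simp⟩

/-- For `n = p + q` the hypothesis says `q + 1 < r`: the differential `d^r` ending at `(p, q)` would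
start below the quadrant. Then `F_{p+r-1}` is already everything in degree `n + 1`, so `u` counts
one filtration step lower. -/
theorem d_mem_pageBoundaries_of_lt {r p : ℤ} {n : ℕ} (h : (n : ℤ) + 1 < p + r) {u : K.X (n + 1)}
    (hu : u ∈ pageCycles K Fil r (p + r) (n + 1)) :
    (K.d (n + 1) n).hom u ∈ pageBoundaries K Fil r p n := by
  rw [mem_pageBoundaries]
  refine ⟨0, zero_mem _, u, ?_, zero_add _⟩
  rw [mem_pageCycles_succ] at hu ⊢
  refine ⟨?_, hF.mono _ (by linarith) hu.2⟩
  rw [hF.top _ _ (by push_cast; linarith)]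
  trivial

omit hF in
/-- The class in the `r`-th page of an element of `Z^{r+1}_p`. -/
theorem pageCycles_succ_le (hF : IsFirstQuadrantFiltration K Fil) (r p : ℤ) (n : ℕ) :
    pageCycles K Fil (r + 1) p n ≤ pageCycles K Fil r p n :=
  pageCycles_mono hF n le_rfl (by linarith)

theorem pageCls_inclusion_mem_cyc (r : ℤ) (a : ℕ × ℕ)
    (z : pageCycles K Fil (r + 1) a.1 (a.1 + a.2)) :
    (pageCls hF r a ∘ₗ Submodule.inclusion (pageCycles_succ_le hF r a.1 (a.1 + a.2))) z ∈
      cyc (page hF r) a := by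
  rw [LinearMap.comp_apply]
  refine pageCls_mem_cyc hF _ ?_
  rw [Submodule.coe_inclusion]
  exact z.2

/-- `Z^{r+1} → H(E^r)`. -/
def nextPageMap (r : ℤ) (a : ℕ × ℕ) :
    pageCycles K Fil (r + 1) a.1 (a.1 + a.2) →ₗ[R] (page hF r).homology a :=
  clsOf (page hF r)
    (pageCls hF r a ∘ₗ Submodule.inclusion (pageCycles_succ_le hF r a.1 (a.1 + a.2)))
    (pageCls_inclusion_mem_cyc hF r a)

theorem nextPageMap_apply {r : ℤ} {a : ℕ × ℕ} {z : K.X (a.1 + a.2)}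
    (hz : z ∈ pageCycles K Fil (r + 1) a.1 (a.1 + a.2))
    (hz' : z ∈ pageCycles K Fil r a.1 (a.1 + a.2))
    (h : pageCls hF r a ⟨z, hz'⟩ ∈ cyc (page hF r) a) :
    nextPageMap hF r a ⟨z, hz⟩ = cls (page hF r) a ⟨pageCls hF r a ⟨z, hz'⟩, h⟩ := by
  unfold nextPageMap
  rw [clsOf_apply]
  congr 2

theorem nextPageMap_surjective {r : ℤ} (hr : 2 ≤ r) (a : ℕ × ℕ) :
    Function.Surjective (nextPageMap hF r a) := by
  intro w
  obtain ⟨⟨x, hx⟩, rfl⟩ := cls_surjective a w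
  obtain ⟨z, rfl⟩ := pageCls_surjective hF r a x
  suffices h : ∃ z' ∈ pageCycles K Fil (r + 1) a.1 (a.1 + a.2),
      (z : K.X (a.1 + a.2)) - z' ∈ pageBoundaries K Fil r a.1 (a.1 + a.2) by
    obtain ⟨z', hz', h⟩ := h
    have e : pageCls hF r a z = pageCls hF r a ⟨z', pageCycles_succ_le hF _ _ _ hz'⟩ :=
      (pageCls_eq_iff hF _ _).2 h
    refine ⟨⟨z', hz'⟩, (nextPageMap_apply hF hz' (pageCycles_succ_le hF _ _ _ hz') (e ▸ hx)).trans ?_⟩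
    congr 2
    exact e.symm
  obtain ⟨z, hz⟩ := z
  -- If `p < r`, the target of `d^r` is outside the quadrant; then `F_{p-r} = 0`, so `d z = 0` and
  -- `z` needs no correction.
  by_cases hp : (a.1 : ℤ) < r
  · refine ⟨z, ?_, by simp⟩
    rw [mem_pageCycles] at hz ⊢
    refine ⟨hz.1, fun m => ?_⟩
    have := hz.2 m
    rw [hF.bot _ _ (by linarith), Submodule.mem_bot] at this
    rw [this]
    exact zero_mem _
  · obtain ⟨s, rfl⟩ : ∃ s : ℕ, r = s := ⟨r.toNat, by omega⟩
    obtain ⟨b, h⟩ : ∃ b, (ComplexShape.spectralSequenceNat (⟨-(s : ℤ), s - 1⟩ : ℤ × ℤ)).Rel a b := by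
      refine ⟨(a.1 - s, a.2 + s - 1), ?_, ?_⟩ <;> simp only <;> omega
    have h0 := mem_cyc.1 hx b
    rw [page_d_cls hF h, pageCls_eq_zero_iff] at h0
    have hdeg := rel_degree h
    have hb1 : (b.1 : ℤ) = a.1 - s := by
      have := h.1
      simp only at this
      omega
    dsimp only at h0 ⊢
    rw [hb1] at h0
    -- The two total degrees differ by one only propositionally. They are replaced by variables so
    -- that the equality can be substituted.
    clear hx h hb1
    generalize b.1 + b.2 = m at h0 hdeg
    generalize a.1 + a.2 = n at z hz h0 hdeg
    subst hdeg
    exact exists_sub_mem_pageBoundaries hF hz h0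

theorem nextPageMap_eq_zero_iff {r : ℤ} (hr : 2 ≤ r) {a : ℕ × ℕ}
    (z : pageCycles K Fil (r + 1) a.1 (a.1 + a.2)) :
    nextPageMap hF r a z = 0 ↔ pageCls hF (r + 1) a z = 0 := by
  rw [pageCls_eq_zero_iff]
  obtain ⟨z, hz⟩ := z
  have hz0 := pageCycles_succ_le hF _ _ _ hz
  rw [nextPageMap_apply hF hz hz0 (pageCls_mem_cyc hF ⟨z, hz0⟩ hz), cls_eq_zero_iff]
  dsimp only
  constructor
  · rintro ⟨b, y, hy⟩
    by_cases h : (ComplexShape.spectralSequenceNat (⟨-r, r - 1⟩ : ℤ × ℤ)).Rel b a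
    · obtain ⟨u, rfl⟩ := pageCls_surjective hF r b y
      rw [page_d_cls hF h] at hy
      have h0 : pageCls hF r a (⟨z, hz0⟩ - ⟨_, d_mem_of_rel h u u.2⟩) = 0 := by
        rw [map_sub, sub_eq_zero]
        exact hy.symm
      rw [pageCls_eq_zero_iff] at h0
      have hdeg := rel_degree h
      have hb1 : (b.1 : ℤ) = a.1 + r := by
        have := h.1
        simp only at this
        omega
      obtain ⟨u, hu, h0⟩ : ∃ u ∈ pageCycles K Fil r (a.1 + r) (b.1 + b.2),
          z - (K.d (b.1 + b.2) (a.1 + a.2)).hom u ∈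
            pageBoundaries K Fil r a.1 (a.1 + a.2) :=
        ⟨u, hb1 ▸ u.2, h0⟩
      generalize b.1 + b.2 = m at u hu h0 hdeg
      subst hdeg
      exact mem_pageBoundaries_succ hF hz hu h0
    -- Without an incoming differential the class of `z` in `E^r` is already zero, so `u = 0`
    -- serves.
    · rw [(page hF r).shape _ _ h] at hy
      have h0 : pageCls hF r a ⟨z, hz0⟩ = 0 := hy.symm
      rw [pageCls_eq_zero_iff] at h0
      exact mem_pageBoundaries_succ hF hz (zero_mem _) (by rwa [map_zero, sub_zero])
  · intro hzB
    obtain ⟨u, hu, h⟩ := exists_of_mem_pageBoundaries_succ hF hzB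
    by_cases hq : (a.2 : ℤ) + 1 < r
    · have h0 : pageCls hF r a ⟨z, hz0⟩ = 0 := by
        rw [pageCls_eq_zero_iff]
        have := add_mem h (d_mem_pageBoundaries_of_lt hF (by push_cast; linarith) hu)
        rwa [sub_add_cancel] at this
      -- No differential `d^r` reaches this position. The class in `E^r` vanishes, and the zero
      -- element in any position bounds it.
      exact ⟨a, 0, (map_zero _).trans h0.symm⟩
    · obtain ⟨s, rfl⟩ : ∃ s : ℕ, r = s := ⟨r.toNat, by omega⟩
      obtain ⟨b, hr⟩ : ∃ b,
          (ComplexShape.spectralSequenceNat (⟨-(s : ℤ), s - 1⟩ : ℤ × ℤ)).Rel b a := by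
        refine ⟨(a.1 + s, a.2 + 1 - s), ?_, ?_⟩ <;> simp only <;> omega
      have hdeg := rel_degree hr
      have hb1 : (b.1 : ℤ) = a.1 + s := by
        have := hr.1
        simp only at this
        omega
      suffices h' : ∃ u' ∈ pageCycles K Fil s b.1 (b.1 + b.2),
          z - (K.d (b.1 + b.2) (a.1 + a.2)).hom u' ∈
            pageBoundaries K Fil s a.1 (a.1 + a.2) by
        obtain ⟨u', hu', h'⟩ := h'
        refine ⟨b, pageCls hF s b ⟨u', hu'⟩, ?_⟩
        rw [page_d_cls hF hr]
        exact ((pageCls_eq_iff hF _ _).2 h').symm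
      rw [← hb1] at hu
      generalize hm : b.1 + b.2 = m at hdeg
      subst hdeg
      exact ⟨u, hu, h⟩

/-- The isomorphism `H(E^r) ≅ E^{r+1}`. -/
def pageIso (r : ℤ) (hr : 2 ≤ r) (a : ℕ × ℕ) :
    (page hF r).homology a ≃ₗ[R] (page hF (r + 1)).X a :=
  equivOfSurjective (nextPageMap hF r a) (pageCls hF (r + 1) a)
    (nextPageMap_surjective hF hr a) (pageCls_surjective hF _ _) (nextPageMap_eq_zero_iff hF hr)

/-- The spectral sequence of a filtered complex. -/
def spectralSequence : FirstQuadrantSpectralSequence R where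
  page r _ := page hF r
  iso r r' a h hr := (pageIso hF r hr a).toModuleIso ≪≫ eqToIso (by subst h; rfl)

theorem isSpectralSequenceOf : IsSpectralSequenceOf (spectralSequence hF) K Fil := by
  refine ⟨fun r _ p q => pageCls hF r (p, q), fun r _ p q => pageCls_surjective hF r (p, q),
    fun r _ p q z => pageCls_eq_zero_iff hF (a := (p, q)) z, ?_, ?_⟩
  · intro r hr p q p' q' hp hq z z' h
    have hrel : (ComplexShape.spectralSequenceNat (⟨-r, r - 1⟩ : ℤ × ℤ)).Rel (p, q) (p', q') :=
      ⟨by simpa [← sub_eq_add_neg] using hp, hq⟩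
    refine (page_d_cls hF hrel z).trans ?_
    exact congrArg (pageCls hF r (p', q')) (Subtype.ext h.symm)
  · rintro r hr p q ⟨z, hz⟩ ⟨z', hz'⟩ h w hw
    obtain rfl : z' = z := h
    have e : ((page hF r).homologyπ (p, q)).hom w = nextPageMap hF r (p, q) ⟨z', hz'⟩ := by
      refine (homologyπ_apply (K := page hF r) (i := (p, q)) w).trans ?_
      have hc : pageCls hF r (p, q) ⟨z', hz⟩ ∈ cyc (page hF r) (p, q) := by
        have := iCycles_mem_cyc (K := page hF r) (i := (p, q)) w
        rwa [show ((page hF r).iCycles (p, q)).hom w = pageCls hF r (p, q) ⟨z', hz⟩ from hw] at this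
      refine Eq.trans ?_ (nextPageMap_apply hF (a := (p, q)) hz' hz hc).symm
      exact congrArg (cls (page hF r) (p, q)) (Subtype.ext hw)
    refine (congrArg (pageIso hF r hr (p, q)) e).trans ?_
    exact equivOfSurjective_apply _ _ _ _ _ _

theorem homologyFiltration_mono (n : ℕ) : Monotone (homologyFiltration K Fil n) :=
  fun _ _ h => Submodule.map_mono (Submodule.comap_mono (hF.mono n h))

theorem homologyFiltration_bot (n : ℕ) (p : ℤ) (hp : p < 0) :
    homologyFiltration K Fil n p = ⊥ := by
  rw [homologyFiltration, hF.bot p n hp, Submodule.comap_bot,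
    LinearMap.ker_eq_bot.2 (iCycles_injective n), Submodule.map_bot]

theorem homologyFiltration_top (n : ℕ) (p : ℤ) (hp : (n : ℤ) ≤ p) :
    homologyFiltration K Fil n p = ⊤ := by
  rw [homologyFiltration, hF.top p n hp, Submodule.comap_top, Submodule.map_top,
    LinearMap.range_eq_top.2 (homologyπ_surjective n)]

omit hF in
theorem mem_homologyFiltration {n : ℕ} {p : ℤ} {w : K.homology n} :
    w ∈ homologyFiltration K Fil n p ↔
      ∃ z : cyc K n, (z : K.X n) ∈ Fil p n ∧ cls K n z = w := by
  constructor
  · rintro ⟨v, hv, rfl⟩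
    exact ⟨⟨_, iCycles_mem_cyc v⟩, hv, (homologyπ_apply v).symm⟩
  · rintro ⟨z, hz, rfl⟩
    refine ⟨cycLift K n z, ?_, rfl⟩
    simpa using hz

/-- The differential of `z` lies in `F_{p-r}`, which is zero since `p - r < 0`. -/
theorem stable_mem_cyc {r p : ℤ} (hp : p < r) {n : ℕ} {z : K.X n}
    (hz : z ∈ pageCycles K Fil r p n) : z ∈ cyc K n := by
  refine mem_cyc.2 fun j => ?_
  have := (mem_pageCycles.1 hz).2 j
  rwa [hF.bot _ _ (by linarith), Submodule.mem_bot] at this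

/-- The stable value `E^r_{p,q}` is the associated graded of the filtration on homology. -/
theorem stable_page (p q : ℕ) (r : ℤ) (hp : (p : ℤ) < r) (hq : (q : ℤ) + 1 < r) :
    Nonempty ((page hF r).X (p, q) ≃ₗ[R]
      (homologyFiltration K Fil (p + q) p ⧸ (homologyFiltration K Fil (p + q)
        ((p : ℤ) - 1)).submoduleOf (homologyFiltration K Fil (p + q) p))) := by
  let g : pageCycles K Fil r p (p + q) →ₗ[R] homologyFiltration K Fil (p + q) p :=
    LinearMap.codRestrict _ (cls K (p + q) ∘ₗ
      Submodule.inclusion (fun z hz => stable_mem_cyc hF hp hz))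
      fun z => mem_homologyFiltration.2 ⟨⟨z, _⟩, (mem_pageCycles.1 z.2).1, rfl⟩
  refine ⟨equivOfSurjective (pageCls hF r (p, q)) (Submodule.mkQ _ ∘ₗ g)
    (pageCls_surjective _ _ _) ((Submodule.mkQ_surjective _).comp ?_) ?_⟩
  · rintro ⟨w, hw⟩
    obtain ⟨z, hz, rfl⟩ := mem_homologyFiltration.1 hw
    refine ⟨⟨z, mem_pageCycles.2 ⟨hz, fun m => ?_⟩⟩, rfl⟩
    rw [mem_cyc.1 z.2]
    exact zero_mem _
  · rintro ⟨z, hz⟩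
    rw [pageCls_eq_zero_iff, LinearMap.comp_apply, Submodule.mkQ_apply,
      Submodule.Quotient.mk_eq_zero]
    change z ∈ pageBoundaries K Fil r p (p + q) ↔
      cls K (p + q) ⟨z, stable_mem_cyc hF hp hz⟩ ∈ homologyFiltration K Fil (p + q) (p - 1)
    rw [mem_pageBoundaries, mem_homologyFiltration]
    constructor
    · rintro ⟨y, hy, u, hu, e⟩
      refine ⟨⟨y, stable_mem_cyc hF (by linarith) hy⟩, (mem_pageCycles.1 hy).1, ?_⟩
      rw [← sub_eq_zero, ← map_sub, cls_eq_zero_iff]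
      refine ⟨_, -u, ?_⟩
      rw [map_neg]
      simp [← e]
    · rintro ⟨y, hy, e⟩
      rw [← sub_eq_zero, ← map_sub, cls_eq_zero_iff_of_rel (j := p + q + 1) rfl] at e
      obtain ⟨u, hu⟩ := e
      have e' : (y : K.X (p + q)) + (K.d (p + q + 1) (p + q)).hom (-u) = z := by
        rw [map_neg, hu]
        simp
      refine ⟨y, mem_pageCycles.2 ⟨hy, fun m => ?_⟩, -u, mem_pageCycles_succ.2 ⟨?_, ?_⟩, e'⟩
      · rw [mem_cyc.1 y.2]
        exact zero_mem _
      -- Here `q + 1 < r` enters: `u` has degree `p + q + 1 ≤ p + r - 1`, where `F_{p+r-1}` is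
      -- everything.
      · rw [hF.top _ _ (by push_cast; linarith)]
        trivial
      · rw [map_neg, hu]
        refine hF.mono _ (by linarith : (p : ℤ) ≤ _) (neg_mem (sub_mem ?_ ?_))
        · exact hF.mono _ (by linarith : (p : ℤ) - 1 ≤ p) hy
        · exact (mem_pageCycles.1 hz).1

/-- The spectral sequence of a filtered complex converges to its homology. -/
theorem convergesTo (H : ℕ → ModuleCat.{u} R) (e : ∀ n, K.homology n ≅ H n) :
    ConvergesTo (spectralSequence hF) H
      (fun n p => (homologyFiltration K Fil n p).map (e n).hom.hom) where
  mono n _ _ h := Submodule.map_mono (homologyFiltration_mono hF n h)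
  bot n := by rw [homologyFiltration_bot hF n _ (by norm_num), Submodule.map_bot]
  top n := by
    rw [homologyFiltration_top hF n _ le_rfl, Submodule.map_top, LinearMap.range_eq_top]
    exact (e n).toLinearEquiv.surjective
  gr p q r hr hp hq := by
    obtain ⟨f⟩ := stable_page hF p q r hp hq
    let E := (e (p + q)).toLinearEquiv
    refine ⟨f ≪≫ₗ Submodule.Quotient.equiv _ _
      (E.submoduleMap (homologyFiltration K Fil (p + q) p)) ?_⟩
    ext ⟨x, hx⟩
    rw [Submodule.mem_map]
    constructor
    · rintro ⟨y, hy, e⟩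
      refine ⟨y, hy, congrArg Subtype.val e⟩
    · rintro ⟨y, hy, rfl⟩
      exact ⟨⟨y, homologyFiltration_mono hF _ (by linarith) hy⟩, hy, rfl⟩

end FilteredComplex

end

/-! ### The first filtration of a total complex and its second page -/

noncomputable section

namespace TotalComplex

open ModuleComplex

variable {R : Type u} [CommRing R]
  (T : HomologicalComplex₂ (ModuleCat.{u} R) (ComplexShape.down ℕ) (ComplexShape.down ℕ))

/-- The inclusion of a summand of the total complex. -/
def incl (p q n : ℕ) (h : p + q = n) : (T.X p).X q →ₗ[R] (totComplex T).X n :=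
  (T.ιTotal (ComplexShape.down ℕ) p q n h).hom

/-- The projection onto a summand of the total complex. -/
def projHom (p q n : ℕ) (_h : p + q = n) : (totComplex T).X n ⟶ (T.X p).X q :=
  T.totalDesc fun i j _ => if h : i = p ∧ j = q then (T.XXIsoOfEq _ _ _ h.1 h.2).hom else 0

/-- The projection onto a summand of the total complex. -/
def proj (p q n : ℕ) (h : p + q = n) : (totComplex T).X n →ₗ[R] (T.X p).X q :=
  (projHom T p q n h).hom

theorem ι_projHom_self (p q n : ℕ) (h : p + q = n) :
    T.ιTotal (ComplexShape.down ℕ) p q n h ≫ projHom T p q n h = 𝟙 _ := by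
  unfold projHom
  rw [HomologicalComplex₂.ι_totalDesc, dif_pos ⟨rfl, rfl⟩]
  rfl

theorem ι_projHom_ne (p q n : ℕ) (h : p + q = n) (i j : ℕ) (h' : i + j = n) (hi : i ≠ p) :
    T.ιTotal (ComplexShape.down ℕ) i j n h' ≫ projHom T p q n h = 0 := by
  unfold projHom
  rw [HomologicalComplex₂.ι_totalDesc, dif_neg (fun e => hi e.1)]

@[simp]
theorem proj_incl (p q n : ℕ) (h : p + q = n) (t : (T.X p).X q) :
    proj T p q n h (incl T p q n h t) = t :=
  LinearMap.congr_fun (congrArg ModuleCat.Hom.hom (ι_projHom_self T p q n h)) t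

theorem proj_incl_ne (p q n : ℕ) (h : p + q = n) (i j : ℕ) (h' : i + j = n) (hi : i ≠ p)
    (t : (T.X i).X j) : proj T p q n h (incl T i j n h' t) = 0 :=
  LinearMap.congr_fun (congrArg ModuleCat.Hom.hom (ι_projHom_ne T p q n h i j h' hi)) t

theorem sum_incl_proj (n : ℕ) (z : (totComplex T).X n) :
    ∑ a ∈ (Finset.HasAntidiagonal.antidiagonal n).attach, incl T a.1.1 a.1.2 n (Finset.HasAntidiagonal.mem_antidiagonal.1 a.2)
      (proj T a.1.1 a.1.2 n (Finset.HasAntidiagonal.mem_antidiagonal.1 a.2) z) = z := by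
  have h : (∑ a ∈ (Finset.HasAntidiagonal.antidiagonal n).attach,
      projHom T a.1.1 a.1.2 n (Finset.HasAntidiagonal.mem_antidiagonal.1 a.2) ≫
        T.ιTotal (ComplexShape.down ℕ) a.1.1 a.1.2 n (Finset.HasAntidiagonal.mem_antidiagonal.1 a.2)) =
      𝟙 ((totComplex T).X n) := by
    refine HomologicalComplex₂.total.hom_ext _ fun i j hij => ?_
    rw [Preadditive.comp_sum, Category.comp_id]
    rw [Finset.sum_eq_single ⟨(i, j), Finset.HasAntidiagonal.mem_antidiagonal.2 hij⟩]
    · rw [← Category.assoc]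
      refine (congrArg (· ≫ _) (ι_projHom_self T i j n hij)).trans ?_
      rw [Category.id_comp]
    · intro b _ hb
      rw [← Category.assoc, ι_projHom_ne, zero_comp]
      intro e
      apply hb
      have := Finset.HasAntidiagonal.mem_antidiagonal.1 b.2
      change i + j = n at hij
      exact Subtype.ext (Prod.ext e.symm (by dsimp only; omega))
    · intro hb
      exact absurd (Finset.mem_attach _ _) hb
  have h2 := LinearMap.congr_fun (congrArg ModuleCat.Hom.hom h) z
  rw [ModuleCat.hom_sum, LinearMap.sum_apply] at h2
  exact h2

variable {T} in
theorem ext_proj {n : ℕ} {z z' : (totComplex T).X n}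
    (h : ∀ p q hpq, proj T p q n hpq z = proj T p q n hpq z') : z = z' := by
  rw [← sum_incl_proj T n z, ← sum_incl_proj T n z']
  exact Finset.sum_congr rfl fun a _ => by rw [h]

variable {T} in
-- An element is the sum of its components, so membership in the span of the columns `≤ p` can be
-- tested column by column.
theorem mem_firstFiltration {p : ℤ} {n : ℕ} {z : (totComplex T).X n} :
    z ∈ firstFiltration T p n ↔ ∀ (i j : ℕ) (hij : i + j = n), p < (i : ℤ) → proj T i j n hij z = 0 := by
  constructor
  · intro hz i j hij hp
    suffices h : firstFiltration T p n ≤ LinearMap.ker (proj T i j n hij) from h hz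
    refine iSup_le fun i' => iSup_le fun j' => iSup_le fun hij' => iSup_le fun hp' => ?_
    rintro _ ⟨t, rfl⟩
    refine proj_incl_ne T i j n hij i' j' hij' ?_ t
    rintro rfl
    exact absurd hp (not_lt.2 hp')
  · intro h
    rw [← sum_incl_proj T n z]
    refine sum_mem fun a _ => ?_
    by_cases hp : (a.1.1 : ℤ) ≤ p
    · exact Submodule.mem_iSup_of_mem a.1.1 (Submodule.mem_iSup_of_mem a.1.2
        (Submodule.mem_iSup_of_mem (Finset.HasAntidiagonal.mem_antidiagonal.1 a.2)
          (Submodule.mem_iSup_of_mem hp ⟨_, rfl⟩)))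
    · rw [h _ _ _ (not_le.1 hp), map_zero]
      exact zero_mem _

/-- The horizontal differential of the double complex. -/
def dh (p q : ℕ) : (T.X (p + 1)).X q →ₗ[R] (T.X p).X q := ((T.d (p + 1) p).f q).hom

/-- The vertical differential of the double complex. -/
def dv (p q : ℕ) : (T.X p).X (q + 1) →ₗ[R] (T.X p).X q := ((T.X p).d (q + 1) q).hom

theorem ι_d (i j n : ℕ) (h : i + j = n + 1) :
    T.ιTotal (ComplexShape.down ℕ) i j (n + 1) h ≫ (totComplex T).d (n + 1) n =
      T.d₁ (ComplexShape.down ℕ) i j n + T.d₂ (ComplexShape.down ℕ) i j n := by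
  change _ ≫ (T.D₁ _ _ _ + T.D₂ _ _ _) = _
  rw [Preadditive.comp_add, HomologicalComplex₂.ι_D₁, HomologicalComplex₂.ι_D₂]

/-- Checked on each summand `T_{i,j}`: only `(p + 1, q)` and `(p, q + 1)` reach `(p, q)`, the first
with sign `1` and the second with sign `(-1)^p`. The cases `i = 0` and `j = 0` are those in which a
differential is missing. -/
theorem projHom_d (p q n : ℕ) (h : p + q = n) :
    (totComplex T).d (n + 1) n ≫ projHom T p q n h =
      projHom T (p + 1) q (n + 1) (by omega) ≫ (T.d (p + 1) p).f q +
        (-1 : ℤˣ) ^ p • (projHom T p (q + 1) (n + 1) (by omega) ≫ (T.X p).d (q + 1) q) := by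
  refine HomologicalComplex₂.total.hom_ext _ fun i j hij => ?_
  change i + j = n + 1 at hij
  rw [← Category.assoc, ι_d, Preadditive.add_comp, Preadditive.comp_add, Linear.comp_units_smul,
    ← Category.assoc, ← Category.assoc]
  have h1 : T.d₁ (ComplexShape.down ℕ) i j n ≫ projHom T p q n h =
      (T.ιTotal (ComplexShape.down ℕ) i j (n + 1) hij ≫
        projHom T (p + 1) q (n + 1) (by omega)) ≫ (T.d (p + 1) p).f q := by
    obtain _ | i := i
    · rw [T.d₁_eq_zero _ _ _ _ (by simp), zero_comp, ι_projHom_ne _ _ _ _ _ _ _ _ (by omega),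
        zero_comp]
    · rw [T.d₁_eq (ComplexShape.down ℕ) (i₁ := i + 1) (i₁' := i) rfl j n
        (show i + j = n by omega)]
      rw [show ComplexShape.ε₁ (ComplexShape.down ℕ) (ComplexShape.down ℕ) (ComplexShape.down ℕ)
        (i + 1, j) = 1 from rfl, one_smul, Category.assoc]
      by_cases e : i = p
      · subst e
        obtain rfl : j = q := by omega
        rw [ι_projHom_self, ι_projHom_self, Category.comp_id, Category.id_comp]
      · rw [ι_projHom_ne _ _ _ _ _ _ _ _ e, ι_projHom_ne _ _ _ _ _ _ _ _ (by omega), comp_zero,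
          zero_comp]
  have h2 : T.d₂ (ComplexShape.down ℕ) i j n ≫ projHom T p q n h =
      (-1 : ℤˣ) ^ p • ((T.ιTotal (ComplexShape.down ℕ) i j (n + 1) hij ≫
        projHom T p (q + 1) (n + 1) (by omega)) ≫ (T.X p).d (q + 1) q) := by
    obtain _ | j := j
    · rw [T.d₂_eq_zero _ _ _ _ (by simp), zero_comp, ι_projHom_ne _ _ _ _ _ _ _ _ (by omega),
        zero_comp, smul_zero]
    · rw [T.d₂_eq (ComplexShape.down ℕ) i (i₂ := j + 1) (i₂' := j) rfl n
        (show i + j = n by omega)]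
      rw [show ComplexShape.ε₂ (ComplexShape.down ℕ) (ComplexShape.down ℕ) (ComplexShape.down ℕ)
        (i, j + 1) = (-1 : ℤˣ) ^ i from rfl, Linear.units_smul_comp, Category.assoc]
      by_cases e : i = p
      · subst e
        obtain rfl : j = q := by omega
        rw [ι_projHom_self, ι_projHom_self, Category.comp_id, Category.id_comp]
      · rw [ι_projHom_ne _ _ _ _ _ _ _ _ e, ι_projHom_ne _ _ _ _ _ _ _ _ e, comp_zero,
          zero_comp, smul_zero, smul_zero]
  rw [h1, h2, Category.assoc]

/-- The differential of the total complex, componentwise. -/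
theorem proj_d (p q n : ℕ) (h : p + q = n) (z : (totComplex T).X (n + 1)) :
    proj T p q n h (((totComplex T).d (n + 1) n).hom z) =
      dh T p q (proj T (p + 1) q (n + 1) (by omega) z) +
        (-1 : ℤ) ^ p • dv T p q (proj T p (q + 1) (n + 1) (by omega) z) := by
  have := LinearMap.congr_fun (congrArg ModuleCat.Hom.hom (projHom_d T p q n h)) z
  refine this.trans ?_
  rw [ModuleCat.hom_add, LinearMap.add_apply]
  congr 1

theorem proj_d' {p q m n : ℕ} (h : p + q = m) (hn : m + 1 = n) (z : (totComplex T).X n) :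
    proj T p q m h (((totComplex T).d n m).hom z) =
      dh T p q (proj T (p + 1) q n (by omega) z) +
        (-1 : ℤ) ^ p • dv T p q (proj T p (q + 1) n (by omega) z) := by
  subst hn
  exact proj_d T p q m h z

theorem isFirstQuadrantFiltration :
    IsFirstQuadrantFiltration (totComplex T) (firstFiltration T) where
  mono n p p' h z hz := by
    rw [mem_firstFiltration] at hz ⊢
    exact fun i j hij hi => hz i j hij (lt_of_le_of_lt h hi)
  d_mem p m n z hz := by
    by_cases hm : n + 1 = m
    · subst hm
      rw [mem_firstFiltration] at hz ⊢
      intro i j hij hi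
      rw [proj_d, hz _ _ _ (by push_cast; omega), hz _ _ _ hi, map_zero, map_zero, smul_zero,
        add_zero]
    · rw [(totComplex T).shape _ _ hm]
      exact zero_mem _
  bot p n hp := by
    rw [eq_bot_iff]
    intro z hz
    rw [mem_firstFiltration] at hz
    rw [Submodule.mem_bot]
    refine ext_proj fun i j hij => ?_
    rw [hz i j hij (by omega), map_zero]
  top p n hp := by
    rw [eq_top_iff]
    intro z _
    rw [mem_firstFiltration]
    intro i j hij hi
    omega

theorem zsmul_negOne_pow_zsmul {M : Type*} [AddCommGroup M] (p : ℕ) (x : M) :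
    (-1 : ℤ) ^ p • (-1 : ℤ) ^ p • x = x := by
  rw [smul_smul, ← mul_pow]
  simp

/-- Vertical cycles of the double complex. -/
def vcyc (p q : ℕ) : Submodule R ((T.X p).X q) := cyc (T.X p) q

variable {T} in
theorem mem_vcyc_succ {p q : ℕ} {t : (T.X p).X (q + 1)} :
    t ∈ vcyc T p (q + 1) ↔ dv T p q t = 0 :=
  mem_cyc_of_rel (K := T.X p) (j := q) rfl

variable {T} in
theorem mem_vcyc_zero {p : ℕ} (t : (T.X p).X 0) : t ∈ vcyc T p 0 := by
  refine mem_cyc.2 fun j => ?_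
  rw [(T.X p).shape _ _ (by simp)]
  rfl

variable {T} in
theorem dh_mem_vcyc {p q : ℕ} {t : (T.X (p + 1)).X q} (ht : t ∈ vcyc T (p + 1) q) :
    dh T p q t ∈ vcyc T p q :=
  map_mem_cyc (T.d (p + 1) p) ht

variable {T} in
theorem d_mem_firstFiltration {n : ℕ} {z : (totComplex T).X n} {p : ℤ}
    (h : ∀ (i j : ℕ) (hij : i + j + 1 = n), p < (i : ℤ) →
      dh T i j (proj T (i + 1) j n (by omega) z) +
        (-1 : ℤ) ^ i • dv T i j (proj T i (j + 1) n (by omega) z) = 0) (m : ℕ) :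
    ((totComplex T).d n m).hom z ∈ firstFiltration T p m := by
  by_cases hm : m + 1 = n
  · refine mem_firstFiltration.2 fun i j hij hi => ?_
    rw [proj_d' T hij hm]
    exact h i j (by omega) hi
  · rw [(totComplex T).shape _ _ hm]
    exact zero_mem _

variable {T} in
/-- The component `z_{p,q}` of an element of `Z^1_p` is a vertical cycle. -/
theorem proj_mem_vcyc {p q n : ℕ} (h : p + q = n) {z : (totComplex T).X n}
    (hz : z ∈ pageCycles (totComplex T) (firstFiltration T) 1 p n) :
    proj T p q n h z ∈ vcyc T p q := by
  obtain _ | q := q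
  · exact mem_vcyc_zero _
  · rw [mem_vcyc_succ]
    obtain ⟨h1, h2⟩ := FilteredComplex.mem_pageCycles.1 hz
    have h3 := mem_firstFiltration.1 (h2 (p + q)) p q rfl (by linarith)
    have h4 := mem_firstFiltration.1 h1 (p + 1) q (by omega) (by push_cast; linarith)
    rw [proj_d' T rfl h, h4, map_zero, zero_add] at h3
    rw [← zsmul_negOne_pow_zsmul p (dv T p q _), h3, smul_zero]

variable {T} in
-- As `d z` lies in filtration `p - 1`, its component in column `p` vanishes; this expresses the
-- horizontal image of `z_{p+1,q}` as a vertical boundary. So the class of `z_{p+1,q}` is a cycle of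
-- the first page.
theorem exists_dh_proj {p q n : ℕ} (h : p + 1 + q = n) {z : (totComplex T).X n}
    (hz : z ∈ pageCycles (totComplex T) (firstFiltration T) 2 (p + 1 : ℕ) n) :
    ∃ v, dv T p q v = dh T p q (proj T (p + 1) q n h z) := by
  have h2 := mem_firstFiltration.1 ((FilteredComplex.mem_pageCycles.1 hz).2 (p + q)) p q rfl
    (by push_cast; linarith)
  rw [proj_d' T rfl (by omega), add_eq_zero_iff_eq_neg] at h2
  exact ⟨-((-1 : ℤ) ^ p • proj T p (q + 1) n (by omega) z), by rw [h2, map_neg, map_zsmul]⟩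

variable {T} in
theorem exists_mem_pageCycles_zero {q n : ℕ} (h : 0 + q = n) {t : (T.X 0).X q}
    (ht : t ∈ vcyc T 0 q) :
    ∃ z ∈ pageCycles (totComplex T) (firstFiltration T) 2 (0 : ℕ) n, proj T 0 q n h z = t := by
  refine ⟨incl T 0 q n h t, FilteredComplex.mem_pageCycles.2
    ⟨mem_firstFiltration.2 fun i j hij hi => proj_incl_ne _ _ _ _ _ _ _ _ ?_ _,
      d_mem_firstFiltration fun i j hij _ => ?_⟩, proj_incl _ _ _ _ _ _⟩
  · rintro rfl
    exact lt_irrefl _ hi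
  · rw [proj_incl_ne _ _ _ _ _ _ _ _ (by omega), map_zero, zero_add]
    obtain _ | i := i
    · obtain rfl : q = j + 1 := by omega
      rw [proj_incl, mem_vcyc_succ.1 ht, smul_zero]
    · rw [proj_incl_ne _ _ _ _ _ _ _ _ (by omega), map_zero, smul_zero]

variable {T} in
-- The zigzag `t - (-1)^p v`: the correction cancels the horizontal image of `t` in column `p`, and
-- `t` being a vertical cycle takes care of column `p + 1`. Hence the differential drops the
-- filtration by two.
theorem exists_mem_pageCycles_succ {p q n : ℕ} (h : p + 1 + q = n) {t : (T.X (p + 1)).X q}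
    (ht : t ∈ vcyc T (p + 1) q) {v : (T.X p).X (q + 1)} (hv : dv T p q v = dh T p q t) :
    ∃ z ∈ pageCycles (totComplex T) (firstFiltration T) 2 (p + 1 : ℕ) n,
      proj T (p + 1) q n h z = t := by
  have h' : p + (q + 1) = n := by omega
  refine ⟨incl T (p + 1) q n h t - incl T p (q + 1) n h' ((-1 : ℤ) ^ p • v),
    FilteredComplex.mem_pageCycles.2 ⟨mem_firstFiltration.2 fun i j hij hi => ?_,
      d_mem_firstFiltration fun i j hij hi => ?_⟩, ?_⟩
  · push_cast at hi
    rw [map_sub, proj_incl_ne _ _ _ _ _ _ _ _ (by omega),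
      proj_incl_ne _ _ _ _ _ _ _ _ (by omega), sub_zero]
  · push_cast at hi
    obtain rfl | rfl | hi' : i = p ∨ i = p + 1 ∨ p + 1 < i := by omega
    · obtain rfl : j = q := by omega
      simp (disch := omega) only [map_sub, proj_incl, proj_incl_ne]
      rw [map_zero, map_zero, sub_zero, zero_sub, map_zsmul,
        smul_neg, zsmul_negOne_pow_zsmul, hv, add_neg_cancel]
    · obtain rfl : q = j + 1 := by omega
      simp (disch := omega) only [map_sub, proj_incl, proj_incl_ne]
      rw [mem_vcyc_succ.1 ht]
      simp only [map_zero, sub_zero, smul_zero, add_zero]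
    · simp (disch := omega) only [map_sub, proj_incl_ne, map_zero, sub_zero, smul_zero, add_zero]
  · rw [map_sub, proj_incl, proj_incl_ne _ _ _ _ _ _ _ _ (by omega), sub_zero]

variable {T} in
-- Only the component of `z` in column `p` matters. An element `u` of `Z^1_{p+1}` leads with a
-- vertical cycle `s` in column `p + 1`, and the column `p` component of `d u` is `d_h s` plus a
-- vertical boundary. Conversely, with `u = s + (-1)^p v`, the difference `z - d u` lies in
-- filtration `p - 1` and has the same differential as `z`.
theorem mem_pageBoundaries_two {p q n : ℕ} (h : p + q = n) {z : (totComplex T).X n}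
    (hz : z ∈ pageCycles (totComplex T) (firstFiltration T) 2 p n) :
    z ∈ pageBoundaries (totComplex T) (firstFiltration T) 2 p n ↔
      ∃ s ∈ vcyc T (p + 1) q, ∃ v, dh T p q s + dv T p q v = proj T p q n h z := by
  rw [FilteredComplex.mem_pageBoundaries]
  constructor
  · rintro ⟨y, hy, u, hu, rfl⟩
    rw [show (2 : ℤ) - 1 = 1 by norm_num,
      show (p : ℤ) + 2 - 1 = ((p + 1 : ℕ) : ℤ) by push_cast; ring] at hu
    refine ⟨_, proj_mem_vcyc (by omega) hu, (-1 : ℤ) ^ p • proj T p (q + 1) (n + 1) (by omega) u,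
      ?_⟩
    rw [map_add, mem_firstFiltration.1 (FilteredComplex.mem_pageCycles.1 hy).1 p q h (by linarith),
      zero_add, proj_d, map_zsmul]
  · rintro ⟨s, hs, v, e⟩
    have h1 : p + 1 + q = n + 1 := by omega
    have h2 : p + (q + 1) = n + 1 := by omega
    set u := incl T (p + 1) q (n + 1) h1 s + incl T p (q + 1) (n + 1) h2 ((-1 : ℤ) ^ p • v)
      with hu
    have hd : ∀ (i j : ℕ) (hij : i + j = n), p < i →
        proj T i j n hij (((totComplex T).d (n + 1) n).hom u) = 0 := by
      intro i j hij hi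
      rw [proj_d, hu]
      obtain rfl | hi' : i = p + 1 ∨ p + 1 < i := by omega
      · obtain rfl : q = j + 1 := by omega
        simp (disch := omega) only [map_add, proj_incl, proj_incl_ne]
        rw [mem_vcyc_succ.1 hs]
        simp only [map_zero, add_zero, smul_zero]
      · simp (disch := omega) only [map_add, proj_incl_ne, map_zero, smul_zero, add_zero]
    have hp : proj T p q n h (((totComplex T).d (n + 1) n).hom u) = proj T p q n h z := by
      rw [proj_d, hu]
      simp (disch := omega) only [map_add, proj_incl, proj_incl_ne]
      rw [map_zero, map_zero, add_zero, zero_add, map_zsmul, zsmul_negOne_pow_zsmul, e]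
    obtain ⟨hz1, hz2⟩ := FilteredComplex.mem_pageCycles.1 hz
    refine ⟨z - ((totComplex T).d (n + 1) n).hom u, FilteredComplex.mem_pageCycles.2
      ⟨mem_firstFiltration.2 fun i j hij hi => ?_, fun m => ?_⟩, u,
      FilteredComplex.mem_pageCycles_succ.2
      ⟨mem_firstFiltration.2 fun i j hij hi => ?_, mem_firstFiltration.2 fun i j hij hi => ?_⟩,
      by abel⟩
    · rw [map_sub]
      obtain rfl | hi' : i = p ∨ p < i := by omega
      · obtain rfl : j = q := by omega
        rw [hp, sub_self]
      · rw [hd _ _ _ hi', mem_firstFiltration.1 hz1 i j hij (by exact_mod_cast hi'), sub_zero]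
    · rw [map_sub, d_d_apply, sub_zero, show (p : ℤ) - 1 - (2 - 1) = p - 2 by ring]
      exact hz2 m
    · rw [hu, map_add, proj_incl_ne _ _ _ _ _ _ _ _ (by omega),
        proj_incl_ne _ _ _ _ _ _ _ _ (by omega), add_zero]
    · exact hd i j hij (by omega)

/-- The second page of the spectral sequence of the first filtration: if `G` is a chain complex
with surjections from the vertical cycles onto its terms, killing exactly the vertical boundaries
and compatible with the horizontal differential, then `E²_{p,q}` is the homology of `G`. -/
theorem secondPage (q : ℕ) (G : ChainComplex (ModuleCat.{u} R) ℕ)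
    (l : ∀ p, vcyc T p q →ₗ[R] G.X p) (hl : ∀ p, Function.Surjective (l p))
    (hl0 : ∀ p t, l p t = 0 ↔ ∃ v, dv T p q v = t)
    (hld : ∀ p t, (G.d (p + 1) p).hom (l (p + 1) t) =
      l p ⟨dh T p q t, dh_mem_vcyc t.2⟩) (p : ℕ) :
    Nonempty ((FilteredComplex.page (isFirstQuadrantFiltration T) 2).X (p, q) ≃ₗ[R]
      G.homology p) := by
  have hZ : ∀ z : pageCycles (totComplex T) (firstFiltration T) 2 p (p + q),
      (proj T p q (p + q) rfl).domRestrict _ z ∈ vcyc T p q := fun z => by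
    rw [LinearMap.domRestrict_apply]
    exact proj_mem_vcyc rfl (FilteredComplex.pageCycles_mono (isFirstQuadrantFiltration T) _ le_rfl
      (by norm_num) z.2)
  obtain ⟨f, hf⟩ : ∃ f : pageCycles (totComplex T) (firstFiltration T) 2 p (p + q) →ₗ[R] G.X p,
      ∀ z h, f z = l p ⟨proj T p q (p + q) rfl z, h⟩ :=
    ⟨l p ∘ₗ ((proj T p q (p + q) rfl).domRestrict _).codRestrict _ hZ, fun z h => rfl⟩
  have hfc : ∀ z, f z ∈ cyc G p := by
    rintro ⟨z, hz⟩
    rw [hf ⟨z, hz⟩ (hZ ⟨z, hz⟩)]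
    -- In column `0` there is no horizontal differential, and every element is a cycle of `G`.
    obtain _ | p := p
    · refine mem_cyc.2 fun j => ?_
      rw [G.shape _ _ (by simp)]
      rfl
    · rw [mem_cyc_of_rel (j := p) rfl, hld, hl0]
      exact exists_dh_proj rfl hz
  refine ⟨equivOfSurjective (FilteredComplex.pageCls (isFirstQuadrantFiltration T) 2 (p, q))
    (clsOf G f hfc) (FilteredComplex.pageCls_surjective _ _ _) ?_ ?_⟩
  · intro w
    obtain ⟨⟨x, hx⟩, rfl⟩ := cls_surjective p w
    obtain ⟨⟨t, ht⟩, rfl⟩ := hl p x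
    suffices h : ∃ z ∈ pageCycles (totComplex T) (firstFiltration T) 2 p (p + q),
        proj T p q (p + q) rfl z = t by
      obtain ⟨z, hz, rfl⟩ := h
      refine ⟨⟨z, hz⟩, ?_⟩
      rw [clsOf_apply]
      congr 2
      exact hf ⟨z, hz⟩ ht
    obtain _ | p := p
    · exact exists_mem_pageCycles_zero _ ht
    · rw [mem_cyc_of_rel (j := p) rfl, hld, hl0] at hx
      obtain ⟨v, hv⟩ := hx
      exact exists_mem_pageCycles_succ _ ht hv
  · rintro ⟨z, hz⟩
    rw [FilteredComplex.pageCls_eq_zero_iff, clsOf_apply, cls_eq_zero_iff_of_rel (j := p + 1) rfl]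
    refine (mem_pageBoundaries_two rfl hz).trans ?_
    dsimp only
    rw [hf ⟨z, hz⟩ (hZ ⟨z, hz⟩)]
    constructor
    · rintro ⟨s, hs, v, e⟩
      refine ⟨l (p + 1) ⟨s, hs⟩, ?_⟩
      rw [hld, ← sub_eq_zero, ← map_sub, hl0]
      refine ⟨-v, ?_⟩
      rw [map_neg, neg_eq_iff_eq_neg, AddSubgroupClass.coe_sub, neg_sub]
      exact eq_sub_of_add_eq' e
    · rintro ⟨g, hg⟩
      obtain ⟨⟨s, hs⟩, rfl⟩ := hl (p + 1) g
      rw [hld, eq_comm, ← sub_eq_zero, ← map_sub, hl0] at hg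
      obtain ⟨v, hv⟩ := hg
      refine ⟨s, hs, v, ?_⟩
      rw [hv, AddSubgroupClass.coe_sub]
      exact add_sub_cancel _ _

end TotalComplex

end

/-! ### Total complexes with exact rows below a given one -/

noncomputable section

namespace TotalComplex

open ModuleComplex

variable {R : Type u} [CommRing R]
  (T : HomologicalComplex₂ (ModuleCat.{u} R) (ComplexShape.down ℕ) (ComplexShape.down ℕ))

/-- Horizontal cycles of the double complex. -/
def hcyc : ∀ p q : ℕ, Submodule R ((T.X p).X q)
  | 0, _ => ⊤
  | p + 1, q => LinearMap.ker (dh T p q)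

variable {T} in
-- In `d w = 0` the component one column to the left of `(p, q)` involves only `d_h w_{p,q}` and the
-- vertical image of an entry of row `q + 1`, which is zero.
theorem proj_mem_hcyc {p q n : ℕ} (h : p + q = n) {w : (totComplex T).X n}
    (hw : w ∈ cyc (totComplex T) n)
    (h0 : ∀ (i : ℕ) (hi : i + (q + 1) = n), proj T i (q + 1) n hi w = 0) :
    proj T p q n h w ∈ hcyc T p q := by
  obtain _ | p := p
  · exact Submodule.mem_top
  · have h1 := proj_d' T (p := p) (q := q) (m := p + q) rfl (by omega) w
    rw [mem_cyc.1 hw, map_zero, h0, map_zero, smul_zero, add_zero] at h1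
    exact h1.symm

variable {T} in
/-- If the rows below the `k`-th one are exact, then so is the part of the total complex that
they span. -/
theorem exists_d_eq_of_rows_exact (k : ℕ)
    (hrow : ∀ q, q < k → ∀ p, ∀ t ∈ hcyc T p q, ∃ s, dh T p q s = t) {n : ℕ}
    {w : (totComplex T).X n} (hw : w ∈ cyc (totComplex T) n)
    (h0 : ∀ (p q : ℕ) (h : p + q = n), k ≤ q → proj T p q n h w = 0) :
    ∃ g : (totComplex T).X (n + 1), ((totComplex T).d (n + 1) n).hom g = w ∧
      ∀ (p q : ℕ) (h : p + q = n + 1), k ≤ q → proj T p q (n + 1) h g = 0 := by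
  induction k generalizing w with
  | zero =>
    have : w = 0 := ext_proj fun p q h => by rw [h0 p q h (Nat.zero_le _), map_zero]
    exact ⟨0, by rw [this, map_zero], fun p q h _ => map_zero _⟩
  | succ k ih =>
    have hrow' : ∀ q, q < k → ∀ p, ∀ t ∈ hcyc T p q, ∃ s, dh T p q s = t :=
      fun q hq => hrow q (by omega)
    by_cases hn : k ≤ n
    -- The component of `w` in row `k` is its highest one, hence a horizontal cycle and equal to
    -- `d_h s`. Subtracting `d s` removes it and otherwise changes only row `k - 1`.
    · obtain ⟨s, hs⟩ := hrow k (by omega) (n - k) _ (proj_mem_hcyc (by omega : n - k + k = n) hw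
        fun i hi => h0 _ _ hi le_rfl)
      have hs' : n - k + 1 + k = n + 1 := by omega
      obtain ⟨g, hg, hg0⟩ := ih (w := w - ((totComplex T).d (n + 1) n).hom
          (incl T (n - k + 1) k (n + 1) hs' s)) hrow'
        (sub_mem hw (d_mem_cyc _)) (fun p q h hq => by
          rw [map_sub, proj_d]
          obtain rfl | hq' : q = k ∨ k + 1 ≤ q := by omega
          · obtain rfl : p = n - q := by omega
            simp (disch := omega) only [proj_incl, proj_incl_ne]
            rw [hs, map_zero, smul_zero, add_zero, sub_self]
          · simp (disch := omega) only [proj_incl_ne]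
            rw [h0 _ _ _ hq', map_zero, map_zero, smul_zero, add_zero, sub_zero])
      refine ⟨incl T (n - k + 1) k (n + 1) hs' s + g, by rw [map_add, hg, add_sub_cancel],
        fun p q h hq => ?_⟩
      rw [map_add, hg0 _ _ _ (by omega), add_zero, proj_incl_ne _ _ _ _ _ _ _ _ (by omega)]
    · obtain ⟨g, hg, hg0⟩ := ih hrow' hw fun p q h hq => by omega
      exact ⟨g, hg, fun p q h hq => hg0 p q h (by omega)⟩

variable {T} in
/-- If the double complex is concentrated in rows `≤ c` and the rows below the `c`-th one are
exact, then the total complex is exact below degree `c`. -/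
theorem subsingleton_homology_of_rows_exact (c : ℕ)
    (hrow : ∀ q, q < c → ∀ p, ∀ t ∈ hcyc T p q, ∃ s, dh T p q s = t) {n : ℕ} (hn : n < c) :
    Subsingleton ((totComplex T).homology n) :=
  subsingleton_homology fun _ hz =>
    (exists_d_eq_of_rows_exact c hrow hz fun p q h hq => by omega).imp' (fun _ => _)
      fun g hg => ⟨g, hg.1⟩

variable {T} in
-- The total differential of a horizontal cycle `u` in row `c` lives in rows below `c`, where it
-- equals `d g` for some `g` also supported below row `c`. Then `u - g` is the cycle wanted.
theorem exists_mem_cyc_proj (c : ℕ)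
    (hrow : ∀ q, q < c → ∀ p, ∀ t ∈ hcyc T p q, ∃ s, dh T p q s = t) {m n : ℕ} (h : m + c = n)
    {u : (T.X m).X c} (hu : u ∈ hcyc T m c) :
    ∃ z ∈ cyc (totComplex T) n, proj T m c n h z = u := by
  obtain _ | n := n
  · refine ⟨incl T m c 0 h u, mem_cyc.2 fun j => ?_, proj_incl _ _ _ _ _ _⟩
    rw [(totComplex T).shape _ _ (by simp)]
    rfl
  · obtain ⟨g, hg, hg0⟩ := exists_d_eq_of_rows_exact c hrow (n := n)
      (d_mem_cyc (incl T m c (n + 1) h u)) fun p q hpq hq => by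
        rw [proj_d]
        obtain rfl | hq' : q = c ∨ c < q := by omega
        · obtain rfl : m = p + 1 := by omega
          simp (disch := omega) only [proj_incl, proj_incl_ne]
          rw [map_zero, smul_zero, add_zero]
          exact hu
        · simp (disch := omega) only [proj_incl_ne]
          rw [map_zero, map_zero, smul_zero, add_zero]
    refine ⟨incl T m c (n + 1) h u - g, (mem_cyc_of_rel (j := n) rfl).2 ?_, ?_⟩
    · rw [map_sub, hg, sub_self]
    · rw [map_sub, proj_incl, hg0 _ _ _ le_rfl, sub_zero]

/-- If the double complex is concentrated in rows `≤ c` and the rows below the `c`-th one are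
exact, then the homology of the total complex is that of the `c`-th row, shifted by `c`. -/
theorem homology_of_rows_exact (c : ℕ)
    (hrow : ∀ q, q < c → ∀ p, ∀ t ∈ hcyc T p q, ∃ s, dh T p q s = t)
    (htop : ∀ p q, c < q → ∀ t : (T.X p).X q, t = 0)
    (G : ChainComplex (ModuleCat.{u} R) ℕ) (l : ∀ p, (T.X p).X c ≃ₗ[R] G.X p)
    (hl : ∀ p t, (G.d (p + 1) p).hom (l (p + 1) t) = l p (dh T p c t)) {m n : ℕ}
    (h : m + c = n) :
    Nonempty ((totComplex T).homology n ≃ₗ[R] G.homology m) := by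
  have hc : ∀ p t, l p t ∈ cyc G p ↔ t ∈ hcyc T p c := by
    intro p t
    obtain _ | p := p
    · refine ⟨fun _ => Submodule.mem_top, fun _ => mem_cyc.2 fun j => ?_⟩
      rw [G.shape _ _ (by simp)]
      rfl
    · rw [mem_cyc_of_rel (j := p) rfl, hl, LinearEquiv.map_eq_zero_iff]
      rfl
  obtain ⟨f, hf⟩ : ∃ f : cyc (totComplex T) n →ₗ[R] G.X m,
      ∀ z hz, f ⟨z, hz⟩ = l m (proj T m c n h z) :=
    ⟨(l m).toLinearMap ∘ₗ (proj T m c n h).domRestrict _, fun z hz => rfl⟩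
  have hfc : ∀ z, f z ∈ cyc G m := by
    rintro ⟨z, hz⟩
    rw [hf, hc]
    exact proj_mem_hcyc h hz fun i hi => htop _ _ (Nat.lt_succ_self c) _
  refine ⟨homologyEquiv (clsOf G f hfc) ?_ ?_⟩
  · intro w
    obtain ⟨⟨x, hx⟩, rfl⟩ := cls_surjective m w
    obtain ⟨u, rfl⟩ := (l m).surjective x
    obtain ⟨z, hz, rfl⟩ := exists_mem_cyc_proj c hrow h ((hc m u).1 hx)
    refine ⟨⟨z, hz⟩, ?_⟩
    rw [clsOf_apply]
    congr 2
    exact hf z hz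
  · rintro ⟨z, hz⟩
    rw [clsOf_apply, cls_eq_zero_iff_of_rel (j := m + 1) rfl]
    dsimp only
    rw [hf]
    constructor
    · rintro ⟨y, hy⟩
      obtain ⟨v, rfl⟩ := (l (m + 1)).surjective y
      rw [hl, EmbeddingLike.apply_eq_iff_eq] at hy
      have hv : m + 1 + c = n + 1 := by omega
      -- Once `d v` is subtracted, nothing of `z` is left in row `c`, so the exact rows below bound
      -- the rest.
      obtain ⟨g, hg, -⟩ := exists_d_eq_of_rows_exact c hrow
        (w := z - ((totComplex T).d (n + 1) n).hom (incl T (m + 1) c (n + 1) hv v))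
        (sub_mem hz (d_mem_cyc _)) fun p q hpq hq => by
          obtain rfl | hq' : q = c ∨ c < q := by omega
          · obtain rfl : p = m := by omega
            rw [map_sub, proj_d, proj_incl, proj_incl_ne _ _ _ _ _ _ _ _ (by omega), hy, map_zero,
              smul_zero, add_zero, sub_self]
          · exact htop _ _ hq' _
      exact ⟨n + 1, incl T (m + 1) c (n + 1) hv v + g, by rw [map_add, hg, add_sub_cancel]⟩
    · rintro ⟨j, y, hy⟩
      by_cases hj : n + 1 = j
      · subst hj
        refine ⟨l (m + 1) (proj T (m + 1) c (n + 1) (by omega) y), ?_⟩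
        rw [hl, ← hy, proj_d, htop _ _ (Nat.lt_succ_self c) (proj T m (c + 1) _ _ _), map_zero,
          smul_zero, add_zero]
      · rw [(totComplex T).shape _ _ hj] at hy
        refine ⟨0, ?_⟩
        have hz0 : z = 0 := hy.symm
        rw [hz0, map_zero, map_zero, map_zero]

end TotalComplex

end

/-! ### Acyclicity criteria for the Čech complex -/

noncomputable section

namespace Cech

variable {R : Type u} [CommRing R] {c : ℕ} (x : Fin c → R)

section Basic

variable (M : Type u) [AddCommGroup M] [Module R M]

theorem component_of_card {i : ℤ} {S : Finset (Fin c)} (h : (S.card : ℤ) = i)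
    (f : CechTerm x M i) : cechComponent x M i S f = f ⟨S, h⟩ := by
  rw [cechComponent, dif_pos h]
  rfl

theorem component_congr {i : ℤ} (f : CechTerm x M i) {S S' U : Finset (Fin c)} (e : S = S')
    (h : S ⊆ U) (h' : S' ⊆ U) :
    cechFace x M h (cechComponent x M i S f) = cechFace x M h' (cechComponent x M i S' f) :=
  cechFace_component_congr x M i f e h h'

theorem sign_mul_self (T : Finset (Fin c)) (k : Fin c) :
    cechSign R T k * cechSign R T k = 1 := by
  unfold cechSign
  rw [← mul_pow]
  simp

/-- The sign identity that makes "insert `j`" a contracting homotopy. It is the anticommutation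
`cechSign_erase` for the set `insert j T`, rearranged using that signs square to one. -/
theorem sign_insert {T : Finset (Fin c)} {j k : Fin c} (hj : j ∉ T) (hk : k ∈ T) :
    cechSign R T k * cechSign R (insert j (T.erase k)) j =
      -(cechSign R (insert j T) j * cechSign R (insert j T) k) := by
  have hne : k ≠ j := fun h => hj (h ▸ hk)
  have e1 : (insert j T).erase k = insert j (T.erase k) := Finset.erase_insert_of_ne hne.symm
  have e2 : (insert j T).erase j = T := Finset.erase_insert hj
  have h : cechSign R (insert j T) k * cechSign R (insert j (T.erase k)) j =
      -(cechSign R (insert j T) j * cechSign R T k) := by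
    rcases lt_or_gt_of_ne hne with h | h
    · have := cechSign_erase (R := R) (Finset.mem_insert_of_mem (b := j) hk) h
      rwa [e1, e2] at this
    · have := cechSign_erase (R := R) (Finset.mem_insert_self j T) h
      rw [e1, e2] at this
      rw [this, neg_neg]
  have h1 := sign_mul_self (R := R) (insert j (T.erase k)) j
  have h2 := sign_mul_self (R := R) (insert j T) j
  linear_combination (-cechSign R (insert j T) j * cechSign R (insert j T) k) * h1
    - cechSign R T k * cechSign R (insert j (T.erase k)) j * h2
    + cechSign R (insert j T) j * cechSign R (insert j (T.erase k)) j * h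

theorem face_mk {S T : Finset (Fin c)} (h : S ⊆ T) (m : M) :
    cechFace x M h (LocalizedModule.mkLinearMap (cechPowers x S) M m) =
      LocalizedModule.mkLinearMap (cechPowers x T) M m :=
  LinearMap.congr_fun (cechFace_comp_mk x M h) m

theorem face_face {S T U : Finset (Fin c)} (h : S ⊆ T) (h' : T ⊆ U) (m : CechPiece x M S) :
    cechFace x M h' (cechFace x M h m) = cechFace x M (h.trans h') m :=
  LinearMap.congr_fun (cechFace_comp x M h h') m

theorem mk_eq_zero_iff (S : Finset (Fin c)) (m : M) :
    LocalizedModule.mkLinearMap (cechPowers x S) M m = 0 ↔ ∃ k : ℕ, (∏ j ∈ S, x j) ^ k • m = 0 := by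
  rw [IsLocalizedModule.eq_zero_iff (cechPowers x S)]
  constructor
  · rintro ⟨⟨_, k, rfl⟩, h⟩
    exact ⟨k, h⟩
  · rintro ⟨k, h⟩
    exact ⟨⟨_, k, rfl⟩, h⟩

theorem exists_pow_smul_eq_mk (S : Finset (Fin c)) (y : CechPiece x M S) :
    ∃ (k : ℕ) (m : M), (∏ j ∈ S, x j) ^ k • y = LocalizedModule.mkLinearMap (cechPowers x S) M m := by
  obtain ⟨⟨m, ⟨_, k, rfl⟩⟩, h⟩ :=
    IsLocalizedModule.surj (cechPowers x S) (LocalizedModule.mkLinearMap (cechPowers x S) M) y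
  exact ⟨k, m, h⟩

theorem pow_smul_bijective (S : Finset (Fin c)) (k : ℕ) :
    Function.Bijective (fun y : CechPiece x M S => (∏ j ∈ S, x j) ^ k • y) :=
  (Module.End.isUnit_iff _).1 (IsLocalizedModule.map_units
    (LocalizedModule.mkLinearMap (cechPowers x S) M) (⟨_, k, rfl⟩ : cechPowers x S))

variable {M}

/-- Inverting `x j` in addition changes nothing when it already acts bijectively. -/
theorem face_bijective {j : Fin c} (hj : Function.Bijective (fun m : M => x j • m))
    {S : Finset (Fin c)} (hS : j ∉ S) :
    Function.Bijective (cechFace x M (Finset.subset_insert j S)) := by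
  have hk : ∀ k : ℕ, Function.Bijective (fun m : M => x j ^ k • m) := by
    intro k
    induction k with
    | zero =>
      simp only [pow_zero, one_smul]
      exact Function.bijective_id
    | succ k ih =>
      simp only [pow_succ, mul_smul]
      exact ih.comp hj
  constructor
  · refine (injective_iff_map_eq_zero _).2 fun y hy => ?_
    obtain ⟨a, m, h⟩ := exists_pow_smul_eq_mk x M S y
    have h1 := congrArg (cechFace x M (Finset.subset_insert j S)) h
    rw [map_smul, hy, smul_zero, face_mk, eq_comm, mk_eq_zero_iff] at h1
    obtain ⟨k, h1⟩ := h1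
    rw [Finset.prod_insert hS, mul_pow, mul_smul] at h1
    have h2 : (∏ j ∈ S, x j) ^ k • m = 0 := (hk k).1 (h1.trans (smul_zero _).symm)
    rw [(mk_eq_zero_iff x M S m).2 ⟨k, h2⟩] at h
    exact (pow_smul_bijective x M S a).1 (h.trans (smul_zero _).symm)
  · intro y
    obtain ⟨k, m, h⟩ := exists_pow_smul_eq_mk x M _ y
    obtain ⟨m', rfl⟩ := (hk k).2 m
    obtain ⟨y', hy'⟩ := (pow_smul_bijective x M S k).2 (LocalizedModule.mkLinearMap _ M m')
    refine ⟨y', (pow_smul_bijective x M _ k).1 ?_⟩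
    dsimp only at hy' ⊢
    rw [h, ← map_smul, Finset.prod_insert hS, mul_pow, mul_smul, hy', map_smul, face_mk, map_smul]

variable (M) in
/-- Exactness of the Čech complex of `M` in degree `i`. -/
def ExactAt (i : ℤ) : Prop :=
  ∀ z : CechTerm x M i, cechD x M i (i + 1) z = 0 →
    ∃ w : CechTerm x M (i - 1), cechD x M (i - 1) i w = z

/-- The Čech complex is acyclic if one of the elements acts bijectively. -/
theorem exactAt_of_bijective {j : Fin c} (hj : Function.Bijective (fun m : M => x j • m)) (i : ℤ) :
    ExactAt x M i := by
  intro z hz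
  -- The contracting homotopy applied to `z`: the component at `S` is, up to sign, `z` at `S ∪ {j}`
  -- carried back along the bijective face map, and zero if `j ∈ S`.
  set w : CechTerm x M (i - 1) := fun S => if h : j ∈ S.1 then 0 else
    cechSign R (insert j S.1) j • (LinearEquiv.ofBijective _ (face_bijective x hj h)).symm
      (cechComponent x M i (insert j S.1) z) with hw
  have hw0 : ∀ S : Finset (Fin c), (S.card : ℤ) = i - 1 → j ∈ S →
      cechComponent x M (i - 1) S w = 0 := by
    intro S hS hjS
    rw [component_of_card x M hS, hw]
    exact dif_pos hjS
  have hw1 : ∀ S : Finset (Fin c), (S.card : ℤ) = i - 1 → j ∉ S →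
      cechFace x M (Finset.subset_insert j S) (cechComponent x M (i - 1) S w) =
        cechSign R (insert j S) j • cechComponent x M i (insert j S) z := by
    intro S hS hjS
    rw [component_of_card x M hS, hw]
    dsimp only
    rw [dif_neg hjS, map_smul]
    congr 1
    exact LinearEquiv.apply_symm_apply (LinearEquiv.ofBijective _ (face_bijective x hj hjS)) _
  refine ⟨w, funext fun T => ?_⟩
  obtain ⟨T, hT⟩ := T
  rw [cechD_apply]
  dsimp only
  have hcard : ∀ k ∈ T, ((T.erase k).card : ℤ) = i - 1 := by
    intro k hk
    have := Finset.card_erase_add_one hk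
    omega
  by_cases hjT : j ∈ T
  -- For `j ∈ T` only the removal of `j` contributes, since all other faces still contain `j`.
  · rw [Finset.sum_eq_single_of_mem j hjT fun k hk hkj => by
      rw [hw0 _ (hcard k hk) (Finset.mem_erase.2 ⟨hkj.symm, hjT⟩), map_zero, smul_zero]]
    obtain ⟨S, hS, rfl⟩ : ∃ S, j ∉ S ∧ T = insert j S :=
      ⟨T.erase j, Finset.notMem_erase j T, (Finset.insert_erase hjT).symm⟩
    have hc := hcard j hjT
    rw [Finset.erase_insert hS] at hc
    rw [component_congr x M w (Finset.erase_insert hS) _ (Finset.subset_insert j S), hw1 S hc hS,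
      smul_smul, sign_mul_self, one_smul, component_of_card x M hT]
  -- For `j ∉ T` the two sides are compared in the piece at `T ∪ {j}`, where the cocycle condition
  -- expresses `z` at `T` through the components containing `j`.
  · apply (face_bijective x hj hjT).1
    have hcT : ((insert j T).card : ℤ) = i + 1 := by
      rw [Finset.card_insert_of_notMem hjT]
      push_cast
      omega
    have h1 := congrFun hz ⟨insert j T, hcT⟩
    rw [cechD_apply, Finset.sum_insert hjT] at h1
    rw [component_congr x M z (Finset.erase_insert hjT) _ (Finset.subset_insert j T),
      component_of_card x M hT] at h1
    have h2 : cechFace x M (Finset.subset_insert j T) (z ⟨T, hT⟩) =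
        - (cechSign R (insert j T) j • ∑ k ∈ T, cechSign R (insert j T) k •
          cechFace x M (Finset.erase_subset k (insert j T))
            (cechComponent x M i ((insert j T).erase k) z)) := by
      rw [Pi.zero_apply, add_eq_zero_iff_eq_neg] at h1
      dsimp only at h1
      rw [← smul_neg, ← h1, smul_smul, sign_mul_self, one_smul]
    rw [h2, map_sum, Finset.smul_sum, ← Finset.sum_neg_distrib]
    refine Finset.sum_congr rfl fun k hk => ?_
    have hjk : j ∉ T.erase k := fun h => hjT (Finset.mem_of_mem_erase h)
    have hss : insert j (T.erase k) ⊆ insert j T :=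
      Finset.insert_subset_insert j (Finset.erase_subset k T)
    have hne : k ≠ j := fun h => hjT (h ▸ hk)
    rw [map_smul, face_face, ← face_face x M (Finset.subset_insert j (T.erase k)) hss,
      hw1 _ (hcard k hk) hjk, map_smul, smul_smul, sign_insert hjT hk, neg_smul, smul_smul,
      component_congr x M z (Finset.erase_insert_of_ne hne.symm) _ hss]

theorem piece_subsingleton {S : Finset (Fin c)} {j : Fin c} (hj : j ∈ S)
    (h : ∀ m : M, ∃ k : ℕ, x j ^ k • m = 0) : Subsingleton (CechPiece x M S) := by
  refine subsingleton_of_forall_eq 0 fun y => ?_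
  obtain ⟨a, m, hy⟩ := exists_pow_smul_eq_mk x M S y
  obtain ⟨k, hk⟩ := h m
  rw [(mk_eq_zero_iff x M S m).2 ⟨k, by
    rw [← Finset.mul_prod_erase S x hj, mul_comm, mul_pow, mul_smul, hk, smul_zero]⟩] at hy
  exact (pow_smul_bijective x M S a).1 (hy.trans (smul_zero _).symm)

/-- If all the elements act locally nilpotently, then the Čech complex vanishes in positive
degrees. -/
theorem exactAt_of_nilpotent (h : ∀ (j : Fin c) (m : M), ∃ k : ℕ, x j ^ k • m = 0) {i : ℤ}
    (hi : 0 < i) : ExactAt x M i := by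
  refine fun z _ => ⟨0, funext fun T => ?_⟩
  have : T.1.Nonempty := by
    rw [← Finset.card_pos]
    have := T.2
    omega
  obtain ⟨j, hj⟩ := this
  have := piece_subsingleton x hj (h j)
  exact Subsingleton.elim _ _

end Basic

section Exactness

variable {M M' M'' : Type u} [AddCommGroup M] [Module R M] [AddCommGroup M'] [Module R M']
  [AddCommGroup M''] [Module R M'']

/-- The map induced by a linear map on the terms of the Čech complexes. -/
def termMap (f : M →ₗ[R] M') (i : ℤ) : CechTerm x M i →ₗ[R] CechTerm x M' i :=
  LinearMap.pi fun S => (cechPieceMap x f S.1).comp (LinearMap.proj S)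

theorem cechD_termMap (f : M →ₗ[R] M') (i j : ℤ) (z : CechTerm x M i) :
    cechD x M' i j (termMap x f i z) = termMap x f j (cechD x M i j z) :=
  ModuleComplex.comm_apply ((cechComplex x).map (ModuleCat.ofHom f)) i j z

theorem termMap_injective {f : M →ₗ[R] M'} (hf : Function.Injective f) (i : ℤ) :
    Function.Injective (termMap x f i) := fun _ _ h => funext fun S =>
  IsLocalizedModule.map_injective (cechPowers x S.1) _ _ f hf (congrFun h S)

theorem termMap_surjective {f : M →ₗ[R] M'} (hf : Function.Surjective f) (i : ℤ) :
    Function.Surjective (termMap x f i) := fun y => by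
  choose z hz using fun S : {S : Finset (Fin c) // (S.card : ℤ) = i} =>
    IsLocalizedModule.map_surjective (cechPowers x S.1)
      (LocalizedModule.mkLinearMap (cechPowers x S.1) M)
      (LocalizedModule.mkLinearMap (cechPowers x S.1) M') f hf (y S)
  exact ⟨z, funext hz⟩

theorem termMap_exact {f : M →ₗ[R] M'} {g : M' →ₗ[R] M''} (h : Function.Exact f g) (i : ℤ) :
    Function.Exact (termMap x f i) (termMap x g i) := by
  have hS := fun S : Finset (Fin c) => IsLocalizedModule.map_exact (cechPowers x S)
      (LocalizedModule.mkLinearMap (cechPowers x S) M)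
      (LocalizedModule.mkLinearMap (cechPowers x S) M')
      (LocalizedModule.mkLinearMap (cechPowers x S) M'') f g h
  intro y
  constructor
  · intro hy
    choose z hz using fun S : {S : Finset (Fin c) // (S.card : ℤ) = i} =>
      (hS S.1 (y S)).1 (congrFun hy S)
    exact ⟨z, funext hz⟩
  · rintro ⟨z, rfl⟩
    exact funext fun S => (hS S.1 _).2 ⟨z S, rfl⟩

/-- The middle of the long exact cohomology sequence, chased by hand: localization keeps `0 → M → M'
→ M'' → 0` exact in every Čech degree. -/
theorem exactAt_of_exact {f : M →ₗ[R] M'} {g : M' →ₗ[R] M''} (hf : Function.Injective f)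
    (hg : Function.Surjective g) (h : Function.Exact f g) {i : ℤ} (h1 : ExactAt x M i)
    (h2 : ExactAt x M'' i) : ExactAt x M' i := by
  intro z hz
  obtain ⟨w2, hw2⟩ := h2 (termMap x g i z) (by rw [cechD_termMap, hz, map_zero])
  obtain ⟨w, rfl⟩ := termMap_surjective x hg _ w2
  rw [cechD_termMap] at hw2
  obtain ⟨z1, hz1⟩ := (termMap_exact x h i (z - cechD x M' (i - 1) i w)).1
    (by rw [map_sub, hw2, sub_self])
  obtain ⟨w1, rfl⟩ := h1 z1 (termMap_injective x hf _ (by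
    rw [← cechD_termMap, hz1, map_sub, hz, ← LinearMap.comp_apply, cechD_comp x M' _ _ _ rfl,
      LinearMap.zero_apply, sub_zero, map_zero]))
  refine ⟨termMap x f _ w1 + w, ?_⟩
  rw [map_add, cechD_termMap, hz1, sub_add_cancel]

end Exactness

end Cech

end

/-! ### Injective modules over Noetherian rings are Čech-acyclic -/

noncomputable section

namespace Cech

variable {R : Type u} [CommRing R]

/-- The submodule of elements annihilated by some power of `r`. -/
def powTorsion (r : R) (M : Type u) [AddCommGroup M] [Module R M] : Submodule R M :=
  Submodule.torsion' R M (Submonoid.powers r)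

theorem mem_powTorsion {r : R} {M : Type u} [AddCommGroup M] [Module R M] {m : M} :
    m ∈ powTorsion r M ↔ ∃ k : ℕ, r ^ k • m = 0 := by
  unfold powTorsion
  rw [Submodule.mem_torsion'_iff]
  constructor
  · rintro ⟨⟨_, k, rfl⟩, h⟩
    exact ⟨k, h⟩
  · rintro ⟨k, h⟩
    exact ⟨⟨_, k, rfl⟩, h⟩

variable {J : Type u} [AddCommGroup J] [Module R J]

/-- The kernels of `r^n g` form an ascending chain in a Noetherian module. Every element of `I` lies
in one of them, so the stable kernel is all of `I`. -/
theorem exists_pow_smul_eq_zero {r : R} {I : Type u} [AddCommGroup I] [Module R I]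
    [IsNoetherian R I] (g : I →ₗ[R] powTorsion r J) :
    ∃ n : ℕ, ∀ t, r ^ n • (g t : J) = 0 := by
  let f : ℕ →o Submodule R I :=
    ⟨fun n => LinearMap.ker (r ^ n • ((powTorsion r J).subtype ∘ₗ g)), fun a b hab t ht => by
      obtain ⟨e, rfl⟩ := Nat.exists_eq_add_of_le' hab
      rw [LinearMap.mem_ker, LinearMap.smul_apply] at ht ⊢
      rw [pow_add, mul_smul, ht, smul_zero]⟩
  have hf : ∀ n t, t ∈ f n ↔ r ^ n • (g t : J) = 0 := fun n t => Iff.rfl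
  obtain ⟨n, hn⟩ := monotone_stabilizes_iff_noetherian.2 ‹IsNoetherian R I› f
  refine ⟨n, fun t => ?_⟩
  obtain ⟨k, hk⟩ := mem_powTorsion.1 (g t).2
  rcases le_total n k with h | h
  · rw [← hf, hn k h, hf, hk]
  · exact (hf _ _).1 (f.monotone h ((hf _ _).2 hk))

/-- Over a Noetherian ring, the `r`-power torsion of an injective module is injective. -/
theorem injective_powTorsion [IsNoetherianRing R] (r : R) (hJ : Module.Injective R J) :
    Module.Injective R (powTorsion r J) := by
  refine Module.Baer.injective fun I g => ?_
  obtain ⟨n, hn⟩ := exists_pow_smul_eq_zero g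
  -- Artin–Rees: `(r^{n+k}) ∩ I ⊆ r^n I`, and `g` kills the right-hand side.
  obtain ⟨k, hk⟩ := (Ideal.span {r}).exists_pow_inf_eq_pow_smul (M := R) I
  let A : Submodule R R := Ideal.span {r ^ (n + k)}
  have hA : ∀ t : I, (t : R) ∈ A → (g t : J) = 0 := by
    intro t ht
    have h1 : (t : R) ∈ Ideal.span {r} ^ (n + k) • (⊤ : Submodule R R) ⊓ I := by
      refine ⟨?_, t.2⟩
      rw [Ideal.span_singleton_pow]
      rw [smul_eq_mul, Ideal.mul_top]
      exact ht
    rw [hk _ (Nat.le_add_left _ _), Nat.add_sub_cancel, Ideal.span_singleton_pow,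
      Submodule.ideal_span_singleton_smul] at h1
    obtain ⟨s, ⟨-, hs⟩, h2⟩ := h1
    have h3 : t = r ^ n • (⟨s, hs⟩ : I) := Subtype.ext h2.symm
    rw [h3, map_smul]
    exact hn _
  -- So `g` factors through `I / (I ∩ A)`, which embeds in `R / A`. An extension to `R / A → J`
  -- automatically takes values killed by `r^{n+k}`, that is, in the torsion submodule.
  let p : Submodule R I := A.comap I.subtype
  let φ : (I ⧸ p) →ₗ[R] R ⧸ A := p.mapQ A I.subtype le_rfl
  have hφ : Function.Injective φ := by
    rw [← LinearMap.ker_eq_bot, Submodule.ker_mapQ, Submodule.mkQ_map_self]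
  obtain ⟨h, hh⟩ := hJ.out φ hφ (p.liftQ ((powTorsion r J).subtype ∘ₗ g) fun t ht => hA t ht)
  refine ⟨(h ∘ₗ A.mkQ).codRestrict _ fun s => mem_powTorsion.2 ⟨n + k, ?_⟩, fun s hs => ?_⟩
  · rw [← map_smul, LinearMap.comp_apply, Submodule.mkQ_apply,
      (Submodule.Quotient.mk_eq_zero A).2, map_zero]
    exact Ideal.mul_mem_right _ _ (Ideal.mem_span_singleton_self _)
  · exact Subtype.ext (hh (p.mkQ ⟨s, hs⟩))

/-- Over a Noetherian ring, an injective module surjects onto its localizations at powers. -/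
theorem mkLinearMap_surjective [IsNoetherianRing R] (r : R) (hJ : Module.Injective R J) :
    Function.Surjective (LocalizedModule.mkLinearMap (Submonoid.powers r) J) := by
  intro y
  obtain ⟨⟨m, ⟨_, k, rfl⟩⟩, hy⟩ := IsLocalizedModule.surj (Submonoid.powers r)
    (LocalizedModule.mkLinearMap (Submonoid.powers r) J) y
  -- The annihilators of the powers of `r` stabilize at `r^n`. Hence `r^{n+k} ↦ r^n m` is a
  -- well-defined map on the ideal `(r^{n+k})`; extended to `R → J` it sends `1` to an element
  -- representing `m / r^k`.
  obtain ⟨n, hn⟩ := monotone_stabilizes_iff_noetherian.2 ‹_›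
    (⟨fun n => LinearMap.ker (LinearMap.toSpanSingleton R R (r ^ n)), fun a b hab t ht => by
      obtain ⟨e, rfl⟩ := Nat.exists_eq_add_of_le hab
      rw [LinearMap.mem_ker, LinearMap.toSpanSingleton_apply, smul_eq_mul] at ht ⊢
      rw [pow_add, ← mul_assoc, ht, zero_mul]⟩ : ℕ →o Submodule R R)
  let a : R →ₗ[R] R := LinearMap.toSpanSingleton R R (r ^ (n + k))
  have ha : ∀ t : R, t * r ^ (n + k) = 0 → t * r ^ n = 0 := fun t ht =>
    (SetLike.ext_iff.1 (hn (n + k) (Nat.le_add_right _ _)) t).2 ht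
  let φ : (R ⧸ LinearMap.ker a) →ₗ[R] R := (LinearMap.ker a).liftQ a le_rfl
  obtain ⟨h, hh⟩ := hJ.out φ (LinearMap.ker_eq_bot.1 (Submodule.ker_liftQ_eq_bot _ _ _ le_rfl))
    ((LinearMap.ker a).liftQ (LinearMap.toSpanSingleton R J (r ^ n • m)) fun t ht => by
      rw [LinearMap.mem_ker, LinearMap.toSpanSingleton_apply, smul_smul, ha t ht, zero_smul])
  have h1 : r ^ (n + k) • h 1 = r ^ n • m := by
    have h2 := hh ((LinearMap.ker a).mkQ 1)
    rw [← map_smul, smul_eq_mul, mul_one]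
    calc h (r ^ (n + k)) = h (φ ((LinearMap.ker a).mkQ 1)) := by
          congr 1
          exact (one_mul _).symm
      _ = _ := h2.trans (one_smul _ _)
  have hinj : ∀ e : ℕ, Function.Injective
      (fun y : LocalizedModule (Submonoid.powers r) J => r ^ e • y) := fun e =>
    ((Module.End.isUnit_iff _).1 (IsLocalizedModule.map_units
      (LocalizedModule.mkLinearMap (Submonoid.powers r) J)
      (⟨_, e, rfl⟩ : Submonoid.powers r))).1
  refine ⟨h 1, hinj (n + k) ?_⟩
  dsimp only
  rw [← map_smul, h1, pow_add, mul_smul, map_smul]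
  congr 1
  exact hy.symm

variable {c : ℕ} (x : Fin c → R)

/-- Over a Noetherian ring, the Čech cohomology of an injective module vanishes in positive
degrees. -/
theorem exactAt_of_injective [IsNoetherianRing R] (hJ : Module.Injective R J) {i : ℤ} (hi : 0 < i) :
    ExactAt x J i := by
  -- Induction on the set `B` of indices whose elements are not assumed to act locally nilpotently,
  -- with `J` varying because the step replaces it by a torsion submodule.
  suffices h : ∀ (B : Finset (Fin c)) (J : Type u) [AddCommGroup J] [Module R J],
      Module.Injective R J → (∀ j ∉ B, ∀ m : J, ∃ k : ℕ, x j ^ k • m = 0) → ExactAt x J i from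
    h Finset.univ J hJ fun j hj => absurd (Finset.mem_univ j) hj
  intro B
  induction B using Finset.induction_on with
  | empty =>
    intro J _ _ _ hB
    exact exactAt_of_nilpotent x (fun j => hB j (Finset.notMem_empty j)) hi
  | insert j B _ ih =>
    intro J _ _ hJ hB
    refine exactAt_of_exact x (f := (powTorsion (x j) J).subtype)
      (g := LocalizedModule.mkLinearMap (Submonoid.powers (x j)) J) Subtype.val_injective
      (mkLinearMap_surjective _ hJ) (fun m => ?_)
      (ih _ (injective_powTorsion (x j) hJ) fun l hl m => ?_)
      (exactAt_of_bijective x (j := j) ((Module.End.isUnit_iff _).1 (IsLocalizedModule.map_units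
        (LocalizedModule.mkLinearMap (Submonoid.powers (x j)) J)
        (⟨_, Submonoid.mem_powers _⟩ : Submonoid.powers (x j)))) i)
    · rw [IsLocalizedModule.eq_zero_iff (Submonoid.powers (x j))]
      exact Subtype.range_val ▸ Iff.rfl
    · by_cases hlj : l = j
      · subst hlj
        obtain ⟨k, hk⟩ := mem_powTorsion.1 m.2
        exact ⟨k, Subtype.ext hk⟩
      · obtain ⟨k, hk⟩ := hB l (by simp [hlj, hl]) m
        exact ⟨k, Subtype.ext hk⟩

section DegreeZero

variable {M M' : Type u} [AddCommGroup M] [Module R M] [AddCommGroup M'] [Module R M']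

variable (M) in
/-- The localization maps, as a map from a module to the terms of its Čech complex. -/
def toTerm (i : ℤ) : M →ₗ[R] CechTerm x M i :=
  LinearMap.pi fun S => LocalizedModule.mkLinearMap (cechPowers x S.1) M

variable (M) in
/-- The isomorphism of a module with the degree zero term of its Čech complex. -/
abbrev toTermZero : M →ₗ[R] CechTerm x M 0 := toTerm x M 0

variable (M) in
theorem toTermZero_bijective : Function.Bijective (toTermZero x M) := by
  have hS : ∀ S : {S : Finset (Fin c) // (S.card : ℤ) = 0}, S = ⟨∅, rfl⟩ := by
    rintro ⟨S, hS⟩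
    have : S = ∅ := Finset.card_eq_zero.1 (by exact_mod_cast hS)
    subst this
    rfl
  have he : ∏ j ∈ (∅ : Finset (Fin c)), x j = 1 := Finset.prod_empty
  constructor
  · refine (injective_iff_map_eq_zero _).2 fun m hm => ?_
    have := congrFun hm ⟨∅, rfl⟩
    obtain ⟨k, hk⟩ := (mk_eq_zero_iff x M ∅ m).1 this
    rwa [he, one_pow, one_smul] at hk
  · intro z
    obtain ⟨k, m, hm⟩ := exists_pow_smul_eq_mk x M ∅ (z ⟨∅, rfl⟩)
    rw [he, one_pow, one_smul] at hm
    refine ⟨m, funext fun S => ?_⟩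
    obtain rfl := hS S
    exact hm.symm

theorem termMap_toTerm (f : M →ₗ[R] M') (i : ℤ) (m : M) :
    termMap x f i (toTerm x M i m) = toTerm x M' i (f m) :=
  funext fun S => LinearMap.congr_fun (cechPieceMap_comp_mk x f S.1) m

/-- The degree one components are the images of `m` in the `M_{x_j}`, up to sign, and `m / 1`
vanishes there exactly when a power of `x j` kills `m`. -/
theorem cechD_toTermZero_eq_zero_iff (m : M) :
    cechD x M 0 1 (toTermZero x M m) = 0 ↔ ∀ j, ∃ k : ℕ, x j ^ k • m = 0 := by
  have key : ∀ (j : Fin c) (h : (({j} : Finset (Fin c)).card : ℤ) = 1),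
      cechD x M 0 1 (toTermZero x M m) ⟨{j}, h⟩ = cechSign R {j} j •
        LocalizedModule.mkLinearMap (cechPowers x {j}) M m := by
    intro j h
    rw [cechD_apply]
    dsimp only
    rw [Finset.sum_singleton, component_of_card x M (by simp)]
    congr 1
    exact face_mk x M _ m
  constructor
  · intro h j
    have h1 := congrFun h ⟨{j}, by simp⟩
    rw [key, Pi.zero_apply] at h1
    have h2 := congrArg (cechSign R {j} j • ·) h1
    dsimp only at h2
    rw [smul_smul, sign_mul_self, one_smul, smul_zero] at h2
    obtain ⟨k, hk⟩ := (mk_eq_zero_iff x M {j} m).1 h2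
    exact ⟨k, by rwa [Finset.prod_singleton] at hk⟩
  · intro h
    refine funext fun T => ?_
    obtain ⟨T, hT⟩ := T
    obtain ⟨j, rfl⟩ := Finset.card_eq_one.1 (by exact_mod_cast hT)
    obtain ⟨k, hk⟩ := h j
    rw [key, (mk_eq_zero_iff x M {j} m).2 ⟨k, by rwa [Finset.prod_singleton]⟩, smul_zero]
    rfl

end DegreeZero

end Cech

end

/-! ### Long exact sequences of left derived functors, in the functor variable -/

noncomputable section

namespace LeftDerived

section

variable {C D : Type*} [Category* C] [Category* D] [Abelian C] [Abelian D]

/-- A sequence of additive functors that is short exact on projective objects. -/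
structure IsShortExactOnProjectives {F G H : C ⥤ D} (α : F ⟶ G) (β : G ⟶ H) : Prop where
  zero : α ≫ β = 0
  shortExact : ∀ (P : C) [Projective P],
    (ShortComplex.mk (α.app P) (β.app P) (by rw [← NatTrans.comp_app, zero]; rfl)).ShortExact

variable {F G H : C ⥤ D} [F.Additive] [G.Additive] [H.Additive] {α : F ⟶ G} {β : G ⟶ H}

/-- The short complex of complexes obtained by evaluating on a projective resolution. -/
abbrev complexes (h : IsShortExactOnProjectives α β) (K : ChainComplex C ℕ) :
    ShortComplex (ChainComplex D ℕ) :=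
  ShortComplex.mk ((NatTrans.mapHomologicalComplex α _).app K)
    ((NatTrans.mapHomologicalComplex β _).app K) (by
      ext i
      exact congrArg (fun f => f.app (K.X i)) h.zero)

theorem complexes_shortExact (h : IsShortExactOnProjectives α β) {A : C}
    (P : ProjectiveResolution A) : (complexes h P.complex).ShortExact :=
  HomologicalComplex.shortExact_of_degreewise_shortExact _ fun i => h.shortExact (P.complex.X i)

/-- The map of short complexes induced by a morphism of complexes. -/
abbrev complexesMap (h : IsShortExactOnProjectives α β) {K L : ChainComplex C ℕ} (φ : K ⟶ L) :
    complexes h K ⟶ complexes h L where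
  τ₁ := (F.mapHomologicalComplex _).map φ
  τ₂ := (G.mapHomologicalComplex _).map φ
  τ₃ := (H.mapHomologicalComplex _).map φ
  comm₁₂ := ((NatTrans.mapHomologicalComplex α _).naturality φ)
  comm₂₃ := ((NatTrans.mapHomologicalComplex β _).naturality φ)

end

theorem down_rel (n : ℕ) : (ComplexShape.down ℕ).Rel (n + 1) n := rfl

variable {C D : Type*} [Category* C] [Category* D] [Abelian C] [HasProjectiveResolutions C]
  [Abelian D]

variable {F G H : C ⥤ D} [F.Additive] [G.Additive] [H.Additive] {α : F ⟶ G} {β : G ⟶ H}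

variable (F) in
/-- Left derived functors are computed by the chosen projective resolution. -/
def iso (n : ℕ) (A : C) : (F.leftDerived n).obj A ≅
    ((F.mapHomologicalComplex (ComplexShape.down ℕ)).obj
      (projectiveResolution A).complex).homology n :=
  (projectiveResolution A).isoLeftDerivedObj F n

theorem map_iso_hom (n : ℕ) {A B : C} (f : A ⟶ B) :
    (F.leftDerived n).map f ≫ (iso F n B).hom = (iso F n A).hom ≫
      HomologicalComplex.homologyMap ((F.mapHomologicalComplex (ComplexShape.down ℕ)).map
        (ProjectiveResolution.lift f (projectiveResolution A) (projectiveResolution B))) n :=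
  ProjectiveResolution.isoLeftDerivedObj_hom_naturality f _ _ _
    (ProjectiveResolution.lift_commutes_zero f _ _) F n

theorem app_iso_hom (n : ℕ) (α : F ⟶ G) (A : C) :
    (NatTrans.leftDerived α n).app A ≫ (iso G n A).hom = (iso F n A).hom ≫
      HomologicalComplex.homologyMap ((NatTrans.mapHomologicalComplex α _).app
        (projectiveResolution A).complex) n := by
  have h := ProjectiveResolution.leftDerived_app_eq α (projectiveResolution A) n
  rw [← Iso.eq_comp_inv, Category.assoc]
  exact h

/-- The connecting morphism of left derived functors. -/
def δ (h : IsShortExactOnProjectives α β) (n : ℕ) (A : C) :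
    (H.leftDerived (n + 1)).obj A ⟶ (F.leftDerived n).obj A :=
  (iso H (n + 1) A).hom ≫
    (complexes_shortExact h (projectiveResolution A)).δ (n + 1) n (down_rel n) ≫
    (iso F n A).inv

theorem δ_naturality (h : IsShortExactOnProjectives α β) (n : ℕ) {A B : C} (f : A ⟶ B) :
    (H.leftDerived (n + 1)).map f ≫ δ h n B = δ h n A ≫ (F.leftDerived n).map f := by
  have h1 := HomologicalComplex.HomologySequence.δ_naturality
    (complexesMap h (ProjectiveResolution.lift f (projectiveResolution A)
      (projectiveResolution B))) (complexes_shortExact h (projectiveResolution A))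
      (complexes_shortExact h (projectiveResolution B)) (n + 1) n (down_rel n)
  rw [← cancel_mono (iso F n B).hom, Category.assoc, Category.assoc, map_iso_hom]
  unfold δ
  rw [Category.assoc, Category.assoc, Iso.inv_hom_id, Category.comp_id, ← Category.assoc,
    map_iso_hom, Category.assoc, Category.assoc, Category.assoc, Iso.inv_hom_id_assoc]
  exact congrArg (_ ≫ ·) h1.symm

theorem δ_comp (h : IsShortExactOnProjectives α β) (n : ℕ) (A : C) :
    δ h n A ≫ (NatTrans.leftDerived α n).app A = 0 := by
  have h1 := (complexes_shortExact h (projectiveResolution A)).δ_comp (n + 1) n (down_rel n)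
  rw [← cancel_mono (iso G n A).hom, Category.assoc, app_iso_hom]
  unfold δ
  rw [Category.assoc, Category.assoc, Iso.inv_hom_id_assoc, zero_comp]
  exact (congrArg (_ ≫ ·) h1).trans comp_zero

theorem δ_exact (h : IsShortExactOnProjectives α β) (n : ℕ) (A : C) :
    (ShortComplex.mk _ _ (δ_comp h n A)).Exact := by
  refine (ShortComplex.exact_iff_of_iso ?_).2
    ((complexes_shortExact h (projectiveResolution A)).homology_exact₁ (n + 1) n (down_rel n))
  refine ShortComplex.isoMk (iso H (n + 1) A) (iso F n A) (iso G n A) ?_ (app_iso_hom n α A).symm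
  dsimp only [δ]
  rw [Category.assoc, Category.assoc, Iso.inv_hom_id, Category.comp_id]

theorem mono_δ (h : IsShortExactOnProjectives α β) (n : ℕ) (A : C)
    (hG : IsZero ((G.leftDerived (n + 1)).obj A)) : Mono (δ h n A) := by
  have : Mono ((complexes_shortExact h (projectiveResolution A)).δ (n + 1) n (down_rel n)) :=
    ShortComplex.ShortExact.mono_δ _ _ _ _ (hG.of_iso (iso G (n + 1) A).symm)
  unfold δ
  exact mono_comp _ _

/-- An exact functor keeps a projective resolution exact in positive degrees. -/
theorem isZero_of_preservesHomology (G : C ⥤ D) [G.Additive] [G.PreservesHomology] (n : ℕ)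
    (A : C) : IsZero ((G.leftDerived (n + 1)).obj A) := by
  refine IsZero.of_iso ?_ (iso G (n + 1) A)
  have h := ((projectiveResolution A).complex_exactAt_succ n)
  rw [HomologicalComplex.exactAt_iff] at h
  exact (HomologicalComplex.exactAt_iff_isZero_homology _ _).1
    ((HomologicalComplex.exactAt_iff _ _).2 (h.map G))

/-- Naturality in the functor rather than in the object: `Ext` depends on its second argument
through transformations of the functors being derived. -/
theorem leftDerived_zero_naturality (α : F ⟶ G) (A : C) :
    (NatTrans.leftDerived α 0).app A ≫ G.fromLeftDerivedZero.app A =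
      F.fromLeftDerivedZero.app A ≫ α.app A := by
  have hF := (projectiveResolution A).fromLeftDerivedZero_eq F
  have hG := (projectiveResolution A).fromLeftDerivedZero_eq G
  have h1 : HomologicalComplex.opcyclesMap ((NatTrans.mapHomologicalComplex α _).app
        (projectiveResolution A).complex) 0 ≫ (projectiveResolution A).fromLeftDerivedZero' G =
      (projectiveResolution A).fromLeftDerivedZero' F ≫ α.app A := by
    rw [← cancel_epi (HomologicalComplex.pOpcycles _ _), HomologicalComplex.p_opcyclesMap_assoc,
      ProjectiveResolution.pOpcycles_comp_fromLeftDerivedZero',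
      ProjectiveResolution.pOpcycles_comp_fromLeftDerivedZero'_assoc]
    exact (α.naturality _).symm
  have h2 := HomologicalComplex.homologyι_naturality ((NatTrans.mapHomologicalComplex α _).app
        (projectiveResolution A).complex) 0
  have h3 := app_iso_hom 0 α A
  rw [hF, hG]
  calc _ = ((NatTrans.leftDerived α 0).app A ≫ (iso G 0 A).hom) ≫
        HomologicalComplex.homologyι _ 0 ≫ (projectiveResolution A).fromLeftDerivedZero' G := by
        rw [Category.assoc]
        rfl
    _ = (iso F 0 A).hom ≫ (HomologicalComplex.homologyMap ((NatTrans.mapHomologicalComplex α _).app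
        (projectiveResolution A).complex) 0 ≫ HomologicalComplex.homologyι _ 0) ≫
          (projectiveResolution A).fromLeftDerivedZero' G := by
        rw [h3, Category.assoc, Category.assoc]
    _ = (iso F 0 A).hom ≫ (HomologicalComplex.homologyι _ 0 ≫
        (projectiveResolution A).fromLeftDerivedZero' F) ≫ α.app A := by
        rw [h2, Category.assoc, Category.assoc, h1]
    _ = _ := by
        rw [← Category.assoc]
        rfl

end LeftDerived

end

/-! ### `Ext` as a derived functor into the opposite category, and its connecting maps -/

noncomputable section

namespace LocalCohomology

open LeftDerived Opposite

variable {R : Type u} [CommRing R]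

/-- The contravariant functor `Hom(-, X)` as a functor to the opposite category. -/
abbrev homOp (X : ModuleCat.{u} R) : ModuleCat.{u} R ⥤ (ModuleCat.{u} R)ᵒᵖ :=
  ((linearYoneda R (ModuleCat.{u} R)).obj X).rightOp

/-- The natural transformation induced by a morphism of modules. -/
abbrev homOpMap {X Y : ModuleCat.{u} R} (f : X ⟶ Y) : homOp Y ⟶ homOp X :=
  NatTrans.rightOp ((linearYoneda R (ModuleCat.{u} R)).map f)

instance (X : ModuleCat.{u} R) : PreservesFiniteColimits (homOp X) := by
  have : PreservesLimits ((linearYoneda R (ModuleCat.{u} R)).obj X ⋙ forget (ModuleCat.{u} R)) :=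
    inferInstanceAs (PreservesLimits (yoneda.obj X))
  have : PreservesLimits ((linearYoneda R (ModuleCat.{u} R)).obj X) :=
    preservesLimits_of_reflects_of_preserves _ (forget (ModuleCat.{u} R))
  exact preservesFiniteColimits_rightOp _

theorem preservesHomology_homOp (J : ModuleCat.{u} R) [Injective J] :
    (homOp J).PreservesHomology := by
  have : (homOp J).PreservesMonomorphisms := ⟨fun {A B} f hf => by
    have : Epi (((linearYoneda R (ModuleCat.{u} R)).obj J).map f.op) := by
      rw [ModuleCat.epi_iff_surjective]
      exact fun g => ⟨Injective.factorThru g f, Injective.comp_factorThru g f⟩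
    exact inferInstanceAs (Mono (((linearYoneda R (ModuleCat.{u} R)).obj J).map f.op).op)⟩
  exact Functor.preservesHomology_of_preservesMonos_and_cokernels _

/-- For projective `P` the functor `Hom(P, -)` is exact. Passing to the opposite category reverses
the sequence, so the map induced by `S.g` comes first. -/
theorem isShortExactOnProjectives {S : ShortComplex (ModuleCat.{u} R)} (hS : S.ShortExact) :
    IsShortExactOnProjectives (homOpMap S.g) (homOpMap S.f) where
  zero := by
    rw [← NatTrans.rightOp_comp, ← Functor.map_comp, S.zero]
    ext A
    exact Quiver.Hom.unop_inj (ModuleCat.hom_ext (LinearMap.ext fun h =>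
      comp_zero (X := A) (f := show A ⟶ S.X₁ from h)))
  shortExact P _ := by
    have := hS.mono_f
    have := hS.epi_g
    have h : (ShortComplex.mk (((linearYoneda R (ModuleCat.{u} R)).map S.f).app (op P))
        (((linearYoneda R (ModuleCat.{u} R)).map S.g).app (op P))
        (ModuleCat.hom_ext (LinearMap.ext fun h => by
          have e : ∀ h : P ⟶ S.X₁, (h ≫ S.f) ≫ S.g = 0 := fun h => by
            rw [Category.assoc, S.zero, comp_zero]
          exact e h))).ShortExact :=
      { exact := by
          rw [ShortComplex.moduleCat_exact_iff]
          intro h hh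
          exact ⟨hS.fIsKernel.lift (KernelFork.ofι h hh), hS.fIsKernel.fac _ .zero⟩
        mono_f := by
          rw [ModuleCat.mono_iff_injective]
          exact fun a b hab => (cancel_mono S.f).1 hab
        epi_g := by
          rw [ModuleCat.epi_iff_surjective]
          exact fun h => ⟨Projective.factorThru h S.g, Projective.factorThru_comp h S.g⟩ }
    exact h.op

/-- The connecting morphism for `Ext`. -/
def extδ {S : ShortComplex (ModuleCat.{u} R)} (hS : S.ShortExact) (n : ℕ) (A : ModuleCat.{u} R) :
    ((Ext R (ModuleCat.{u} R) n).obj (op A)).obj S.X₃ ⟶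
      ((Ext R (ModuleCat.{u} R) (n + 1)).obj (op A)).obj S.X₁ :=
  (δ (isShortExactOnProjectives hS) n A).unop

theorem extδ_naturality {S : ShortComplex (ModuleCat.{u} R)} (hS : S.ShortExact) (n : ℕ)
    {A B : ModuleCat.{u} R} (f : A ⟶ B) :
    extδ hS n B ≫ ((Ext R (ModuleCat.{u} R) (n + 1)).map f.op).app S.X₁ =
      ((Ext R (ModuleCat.{u} R) n).map f.op).app S.X₃ ≫ extδ hS n A :=
  congrArg Quiver.Hom.unop (δ_naturality (isShortExactOnProjectives hS) n f)

theorem extδ_exact {S : ShortComplex (ModuleCat.{u} R)} (hS : S.ShortExact) (n : ℕ)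
    (A : ModuleCat.{u} R) (e : ((Ext R (ModuleCat.{u} R) n).obj (op A)).obj S.X₃) :
    (extδ hS n A).hom e = 0 ↔
      ∃ e', (((Ext R (ModuleCat.{u} R) n).obj (op A)).map S.g).hom e' = e := by
  have h := (δ_exact (isShortExactOnProjectives hS) n A).unop
  refine ⟨(ShortComplex.moduleCat_exact_iff _).1 h e, ?_⟩
  rintro ⟨e', rfl⟩
  exact LinearMap.congr_fun (congrArg ModuleCat.Hom.hom
    (congrArg Quiver.Hom.unop (δ_comp (isShortExactOnProjectives hS) n A))) e'

theorem isZero_ext_of_injective (J : ModuleCat.{u} R) [Injective J] (n : ℕ)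
    (A : ModuleCat.{u} R) : IsZero (((Ext R (ModuleCat.{u} R) (n + 1)).obj (op A)).obj J) := by
  have := preservesHomology_homOp J
  exact (isZero_of_preservesHomology (homOp J) n A).unop

/-- The next term of the long exact sequence is `Ext^{n+1}(A, S.X₂)`, which vanishes. In the
opposite category this says that the connecting morphism is mono. -/
theorem extδ_surjective {S : ShortComplex (ModuleCat.{u} R)} (hS : S.ShortExact) [Injective S.X₂]
    (n : ℕ) (A : ModuleCat.{u} R) : Function.Surjective (extδ hS n A).hom := by
  have := preservesHomology_homOp S.X₂
  have := mono_δ (isShortExactOnProjectives hS) n A (isZero_of_preservesHomology (homOp S.X₂) n A)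
  rw [← ModuleCat.epi_iff_surjective]
  exact inferInstanceAs (Epi (δ (isShortExactOnProjectives hS) n A).unop)

/-- `Ext` in degree zero is `Hom`. -/
def extZero (A X : ModuleCat.{u} R) :
    ((Ext R (ModuleCat.{u} R) 0).obj (op A)).obj X ≅
      ((linearYoneda R (ModuleCat.{u} R)).obj X).obj (op A) :=
  ((homOp X).leftDerivedZeroIsoSelf.app A).unop.symm

theorem extZero_naturality_left {A B : ModuleCat.{u} R} (f : A ⟶ B) (X : ModuleCat.{u} R) :
    ((Ext R (ModuleCat.{u} R) 0).map f.op).app X ≫ (extZero A X).hom =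
      (extZero B X).hom ≫ ((linearYoneda R (ModuleCat.{u} R)).obj X).map f.op := by
  rw [← Iso.inv_comp_eq, ← Category.assoc, ← Iso.eq_comp_inv]
  exact congrArg Quiver.Hom.unop ((homOp X).fromLeftDerivedZero.naturality f)

theorem extZero_naturality_right (A : ModuleCat.{u} R) {X Y : ModuleCat.{u} R} (f : X ⟶ Y) :
    ((Ext R (ModuleCat.{u} R) 0).obj (op A)).map f ≫ (extZero A Y).hom =
      (extZero A X).hom ≫ ((linearYoneda R (ModuleCat.{u} R)).map f).app (op A) := by
  rw [← Iso.inv_comp_eq, ← Category.assoc, ← Iso.eq_comp_inv]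
  exact congrArg Quiver.Hom.unop (leftDerived_zero_naturality (homOpMap f) A)

end LocalCohomology

end

/-! ### Local cohomology as a filtered colimit of `Ext` modules -/

noncomputable section

namespace LocalCohomology

open LeftDerived Opposite

variable {R : Type u} [CommRing R] (𝔞 : Ideal R)

/-- The module `R / 𝔞 ^ t`. -/
abbrev powQuot (t : ℕᵒᵖᵒᵖ) : ModuleCat.{u} R :=
  (localCohomology.ringModIdeals (localCohomology.idealPowersDiagram 𝔞)).obj t.unop

/-- The projection `R / 𝔞 ^ t' → R / 𝔞 ^ t`. -/
abbrev powQuotMap {t t' : ℕᵒᵖᵒᵖ} (f : t ⟶ t') : powQuot 𝔞 t' ⟶ powQuot 𝔞 t :=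
  (localCohomology.ringModIdeals (localCohomology.idealPowersDiagram 𝔞)).map f.unop

/-- `Ext^n(R / 𝔞 ^ t, X)`. -/
abbrev powExt (n : ℕ) (t : ℕᵒᵖᵒᵖ) (X : ModuleCat.{u} R) : ModuleCat.{u} R :=
  ((Ext R (ModuleCat.{u} R) n).obj (op (powQuot 𝔞 t))).obj X

/-- The transition maps of the direct system `Ext^n(R / 𝔞 ^ t, X)`. -/
abbrev powExtMap (n : ℕ) {t t' : ℕᵒᵖᵒᵖ} (f : t ⟶ t') (X : ModuleCat.{u} R) :
    powExt 𝔞 n t X ⟶ powExt 𝔞 n t' X :=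
  ((Ext R (ModuleCat.{u} R) n).map (powQuotMap 𝔞 f).op).app X

/-- Local cohomology as a cocone. -/
def cocone (n : ℕ) (X : ModuleCat.{u} R) :
    Cocone (localCohomology.diagram.{u, 0} (localCohomology.idealPowersDiagram 𝔞) n ⋙
      (evaluation _ _).obj X) :=
  ((evaluation _ _).obj X).mapCocone
    (colimit.cocone (localCohomology.diagram.{u, 0} (localCohomology.idealPowersDiagram 𝔞) n))

/-- Local cohomology is the colimit of the `Ext^n(R / 𝔞 ^ t, X)`. -/
def isColimit (n : ℕ) (X : ModuleCat.{u} R) : IsColimit (cocone 𝔞 n X) :=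
  isColimitOfPreserves ((evaluation _ _).obj X) (colimit.isColimit _)

/-- The map from `Ext^n(R / 𝔞 ^ t, X)` to local cohomology. -/
def ι (n : ℕ) (t : ℕᵒᵖᵒᵖ) (X : ModuleCat.{u} R) :
    powExt 𝔞 n t X ⟶ (localCohomology 𝔞 n).obj X :=
  (cocone 𝔞 n X).ι.app t

theorem map_ι (n : ℕ) {t t' : ℕᵒᵖᵒᵖ} (f : t ⟶ t') (X : ModuleCat.{u} R)
    (e : powExt 𝔞 n t X) : (ι 𝔞 n t' X).hom ((powExtMap 𝔞 n f X).hom e) = (ι 𝔞 n t X).hom e :=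
  LinearMap.congr_fun (congrArg ModuleCat.Hom.hom ((cocone 𝔞 n X).w f)) e

theorem ι_naturality (n : ℕ) (t : ℕᵒᵖᵒᵖ) {X Y : ModuleCat.{u} R} (g : X ⟶ Y)
    (e : powExt 𝔞 n t X) :
    (ι 𝔞 n t Y).hom ((((Ext R (ModuleCat.{u} R) n).obj (op (powQuot 𝔞 t))).map g).hom e) =
      ((localCohomology 𝔞 n).map g).hom ((ι 𝔞 n t X).hom e) :=
  LinearMap.congr_fun (congrArg ModuleCat.Hom.hom
    ((colimit.ι (localCohomology.diagram.{u, 0} (localCohomology.idealPowersDiagram 𝔞) n)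
      t).naturality g)) e

instance : PreservesColimitsOfShape ℕᵒᵖᵒᵖ (forget (ModuleCat.{u} R)) := by
  have : PreservesFilteredColimitsOfSize.{0, 0} (forget (ModuleCat.{u} R)) :=
    preservesFilteredColimitsOfSize_shrink.{0, u, 0, u} _
  infer_instance

variable {𝔞} in
theorem exists_rep {n : ℕ} {X : ModuleCat.{u} R} (y : (localCohomology 𝔞 n).obj X) :
    ∃ (t : ℕᵒᵖᵒᵖ) (e : powExt 𝔞 n t X), (ι 𝔞 n t X).hom e = y :=
  Concrete.isColimit_exists_rep _ (isColimit 𝔞 n X) y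

variable {𝔞} in
theorem exists_map_eq_zero {n : ℕ} {X : ModuleCat.{u} R} {t : ℕᵒᵖᵒᵖ} {e : powExt 𝔞 n t X}
    (h : (ι 𝔞 n t X).hom e = 0) :
    ∃ (t' : ℕᵒᵖᵒᵖ) (f : t ⟶ t'), (powExtMap 𝔞 n f X).hom e = 0 := by
  obtain ⟨t', f, f', hf⟩ := (Concrete.isColimit_rep_eq_iff_exists _ (isColimit 𝔞 n X) e
    (0 : powExt 𝔞 n t X)).1 (h.trans (map_zero (ι 𝔞 n t X).hom).symm)
  exact ⟨t', f, hf.trans (map_zero (powExtMap 𝔞 n f' X).hom)⟩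

theorem exists_desc (n : ℕ) {X : ModuleCat.{u} R} {M : Type u} [AddCommGroup M] [Module R M]
    (φ : ∀ t, powExt 𝔞 n t X →ₗ[R] M)
    (hφ : ∀ (t t' : ℕᵒᵖᵒᵖ) (f : t ⟶ t') e, φ t' ((powExtMap 𝔞 n f X).hom e) = φ t e) :
    ∃ ψ : (localCohomology 𝔞 n).obj X →ₗ[R] M, ∀ t e, ψ ((ι 𝔞 n t X).hom e) = φ t e := by
  let s : Cocone (localCohomology.diagram.{u, 0} (localCohomology.idealPowersDiagram 𝔞) n ⋙
      (evaluation _ _).obj X) :=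
    { pt := ModuleCat.of R M
      ι := { app := fun t => ModuleCat.ofHom (φ t)
             naturality := fun t t' f => ModuleCat.hom_ext (LinearMap.ext fun e => hφ t t' f e) } }
  exact ⟨((isColimit 𝔞 n X).desc s).hom, fun t e =>
    LinearMap.congr_fun (congrArg ModuleCat.Hom.hom ((isColimit 𝔞 n X).fac s t)) e⟩

/-- The connecting map for local cohomology. -/
theorem exists_connecting {S : ShortComplex (ModuleCat.{u} R)} (hS : S.ShortExact)
    [Injective S.X₂] (n : ℕ) :
    ∃ d : (localCohomology 𝔞 n).obj S.X₃ →ₗ[R] (localCohomology 𝔞 (n + 1)).obj S.X₁,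
      Function.Surjective d ∧
      ∀ y, d y = 0 ↔ ∃ y', ((localCohomology 𝔞 n).map S.g).hom y' = y := by
  have hnat : ∀ {t t' : ℕᵒᵖᵒᵖ} (f : t ⟶ t') (e : powExt 𝔞 n t S.X₃),
      (extδ hS n (powQuot 𝔞 t')).hom ((powExtMap 𝔞 n f S.X₃).hom e) =
        (powExtMap 𝔞 (n + 1) f S.X₁).hom ((extδ hS n (powQuot 𝔞 t)).hom e) := fun f e =>
    (LinearMap.congr_fun (congrArg ModuleCat.Hom.hom
      (extδ_naturality hS n (powQuotMap 𝔞 f))) e).symm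
  obtain ⟨d, hd⟩ := exists_desc 𝔞 n (X := S.X₃)
    (fun t => (ι 𝔞 (n + 1) t S.X₁).hom ∘ₗ (extδ hS n (powQuot 𝔞 t)).hom) fun t t' f e => by
      rw [LinearMap.comp_apply, hnat, map_ι]
      rfl
  refine ⟨d, fun y => ?_, fun y => ⟨fun h => ?_, ?_⟩⟩
  · obtain ⟨t, e, rfl⟩ := exists_rep y
    obtain ⟨e', rfl⟩ := extδ_surjective hS n (powQuot 𝔞 t) e
    exact ⟨_, hd t e'⟩
  · obtain ⟨t, e, rfl⟩ := exists_rep y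
    rw [hd, LinearMap.comp_apply] at h
    -- Vanishing in the colimit only means vanishing at a later stage `t'`; exactness of the `Ext`
    -- sequence is applied there.
    obtain ⟨t', f, hf⟩ := exists_map_eq_zero h
    rw [← hnat, extδ_exact] at hf
    obtain ⟨e', he'⟩ := hf
    exact ⟨(ι 𝔞 n t' S.X₂).hom e', by rw [← ι_naturality, he', map_ι]⟩
  · rintro ⟨y', rfl⟩
    obtain ⟨t, e, rfl⟩ := exists_rep y'
    rw [← ι_naturality, hd, LinearMap.comp_apply, (extδ_exact hS n _ _).2 ⟨e, rfl⟩, map_zero]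

theorem subsingleton_of_injective (J : ModuleCat.{u} R) [Injective J] (n : ℕ) :
    Subsingleton ((localCohomology 𝔞 (n + 1)).obj J) := by
  refine subsingleton_of_forall_eq 0 fun y => ?_
  obtain ⟨t, e, rfl⟩ := exists_rep y
  have := ModuleCat.subsingleton_of_isZero (isZero_ext_of_injective J n (powQuot 𝔞 t))
  rw [Subsingleton.elim e 0, map_zero]

/-- Evaluation at the class of `1` in degree zero. -/
def evalOne (t : ℕᵒᵖᵒᵖ) (X : ModuleCat.{u} R) : powExt 𝔞 0 t X →ₗ[R] X where
  toFun e := ModuleCat.Hom.hom (show powQuot 𝔞 t ⟶ X from (extZero (powQuot 𝔞 t) X).hom.hom e)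
    (Ideal.Quotient.mk _ 1)
  map_add' e e' := by
    rw [map_add]
    rfl
  map_smul' r e := by
    rw [map_smul]
    rfl

theorem evalOne_map {t t' : ℕᵒᵖᵒᵖ} (f : t ⟶ t') (X : ModuleCat.{u} R) (e : powExt 𝔞 0 t X) :
    evalOne 𝔞 t' X ((powExtMap 𝔞 0 f X).hom e) = evalOne 𝔞 t X e := by
  have h := LinearMap.congr_fun (congrArg ModuleCat.Hom.hom
    (extZero_naturality_left (powQuotMap 𝔞 f) X)) e
  exact congrArg (fun g : powQuot 𝔞 t' ⟶ X => g.hom (Ideal.Quotient.mk _ 1)) h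

theorem evalOne_naturality (t : ℕᵒᵖᵒᵖ) {X Y : ModuleCat.{u} R} (g : X ⟶ Y)
    (e : powExt 𝔞 0 t X) :
    evalOne 𝔞 t Y ((((Ext R (ModuleCat.{u} R) 0).obj (op (powQuot 𝔞 t))).map g).hom e) =
      g.hom (evalOne 𝔞 t X e) := by
  have h := LinearMap.congr_fun (congrArg ModuleCat.Hom.hom
    (extZero_naturality_right (powQuot 𝔞 t) g)) e
  exact congrArg (fun g : powQuot 𝔞 t ⟶ Y => g.hom (Ideal.Quotient.mk _ 1)) h

theorem evalOne_injective (t : ℕᵒᵖᵒᵖ) (X : ModuleCat.{u} R) :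
    Function.Injective (evalOne 𝔞 t X) := by
  refine (injective_iff_map_eq_zero _).2 fun e he => ?_
  have h : ∀ g : powQuot 𝔞 t ⟶ X, g.hom (Ideal.Quotient.mk _ 1) = 0 → g = 0 := by
    intro g hg
    refine ModuleCat.hom_ext (LinearMap.ext fun y => ?_)
    obtain ⟨r, rfl⟩ := Ideal.Quotient.mk_surjective y
    have : (Ideal.Quotient.mk (𝔞 ^ t.unop.unop) r : R ⧸ 𝔞 ^ t.unop.unop) =
      r • Ideal.Quotient.mk (𝔞 ^ t.unop.unop) 1 := by
      rw [← mul_one r, map_mul]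
      simp [Algebra.smul_def]
    refine (congrArg g.hom this).trans ?_
    refine (map_smul g.hom r _).trans ?_
    exact (congrArg (r • ·) hg).trans (smul_zero r)
  have h1 : (extZero (powQuot 𝔞 t) X).hom.hom e = 0 := h _ he
  exact (ModuleCat.mono_iff_injective (extZero (powQuot 𝔞 t) X).hom).1 inferInstance
    (h1.trans (map_zero _).symm)

/-- A map from the cyclic module `R / 𝔞^t` to `X` is the same as an element of `X` killed by `𝔞^t`.
-/
theorem mem_range_evalOne (t : ℕᵒᵖᵒᵖ) (X : ModuleCat.{u} R) (m : X) :
    (∃ e, evalOne 𝔞 t X e = m) ↔ ∀ a ∈ 𝔞 ^ t.unop.unop, a • m = 0 := by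
  constructor
  · rintro ⟨e, rfl⟩ a ha
    have h : a • (Ideal.Quotient.mk (𝔞 ^ t.unop.unop) 1 : R ⧸ 𝔞 ^ t.unop.unop) = 0 := by
      rw [Algebra.smul_def, Ideal.Quotient.algebraMap_eq, map_one, mul_one,
        Ideal.Quotient.eq_zero_iff_mem]
      exact ha
    have h2 : ∀ g : powQuot 𝔞 t ⟶ X, a • g.hom (Ideal.Quotient.mk _ 1) = 0 := fun g =>
      (map_smul g.hom a _).symm.trans ((congrArg g.hom h).trans (map_zero g.hom))
    exact h2 _
  · intro h
    let g : powQuot 𝔞 t ⟶ X := ModuleCat.ofHom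
      (Submodule.liftQ (𝔞 ^ t.unop.unop) (LinearMap.toSpanSingleton R X m) fun a ha => h a ha)
    obtain ⟨e, he⟩ := (ModuleCat.epi_iff_surjective (extZero (powQuot 𝔞 t) X).hom).1
      inferInstance g
    refine ⟨e, (congrArg (fun g : powQuot 𝔞 t ⟶ X => g.hom (Ideal.Quotient.mk _ 1)) he).trans ?_⟩
    exact one_smul R m

/-- Local cohomology in degree zero is the torsion submodule. -/
theorem exists_zero_iso :
    ∃ ε : ∀ X : ModuleCat.{u} R, (localCohomology 𝔞 0).obj X →ₗ[R] X,
      (∀ X, Function.Injective (ε X)) ∧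
      (∀ {X Y : ModuleCat.{u} R} (g : X ⟶ Y) y,
        ε Y (((localCohomology 𝔞 0).map g).hom y) = g.hom (ε X y)) ∧
      ∀ X m, (∃ y, ε X y = m) ↔ ∃ k : ℕ, ∀ a ∈ 𝔞 ^ k, a • m = 0 := by
  choose ε hε using fun X : ModuleCat.{u} R => exists_desc 𝔞 0 (X := X)
    (fun t => evalOne 𝔞 t X) fun t t' f e => evalOne_map 𝔞 f X e
  refine ⟨ε, fun X => (injective_iff_map_eq_zero _).2 fun y hy => ?_, fun {X Y} g y => ?_,
    fun X m => ⟨?_, ?_⟩⟩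
  · obtain ⟨t, e, rfl⟩ := exists_rep y
    rw [hε] at hy
    rw [(injective_iff_map_eq_zero _).1 (evalOne_injective 𝔞 t X) e hy, map_zero]
  · obtain ⟨t, e, rfl⟩ := exists_rep y
    rw [← ι_naturality, hε, hε, evalOne_naturality]
  · rintro ⟨y, rfl⟩
    obtain ⟨t, e, rfl⟩ := exists_rep y
    rw [hε]
    exact ⟨_, (mem_range_evalOne 𝔞 t X _).1 ⟨e, rfl⟩⟩
  · rintro ⟨k, hk⟩
    obtain ⟨e, rfl⟩ := (mem_range_evalOne 𝔞 (op (op k)) X m).2 hk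
    exact ⟨_, hε X _ e⟩

end LocalCohomology

end

/-! ### Čech cohomology is local cohomology, by dimension shifting -/

noncomputable section

open ModuleComplex

variable {R : Type u} [CommRing R]

/-- A sequence of functors, the zeroth of which is the subfunctor `P` of the identity, which
vanishes on injective modules in positive degrees and for which there are connecting maps for
embeddings into injective modules. -/
structure IsEffaceableSequence (T : ℕ → ModuleCat.{u} R ⥤ ModuleCat.{u} R)
    (P : ∀ X : ModuleCat.{u} R, X → Prop) : Prop where
  connecting : ∀ {S : ShortComplex (ModuleCat.{u} R)} (_ : S.ShortExact) [Injective S.X₂] (n : ℕ),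
    ∃ d : (T n).obj S.X₃ →ₗ[R] (T (n + 1)).obj S.X₁, Function.Surjective d ∧
      ∀ y, d y = 0 ↔ ∃ y', ((T n).map S.g).hom y' = y
  subsingleton : ∀ (J : ModuleCat.{u} R) [Injective J] (n : ℕ),
    Subsingleton ((T (n + 1)).obj J)
  zero : ∃ ε : ∀ X : ModuleCat.{u} R, (T 0).obj X →ₗ[R] X,
    (∀ X, Function.Injective (ε X)) ∧
    (∀ {X Y : ModuleCat.{u} R} (g : X ⟶ Y) y, ε Y (((T 0).map g).hom y) = g.hom (ε X y)) ∧
    ∀ X m, (∃ y, ε X y = m) ↔ P X m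

namespace IsEffaceableSequence

variable {T T' : ℕ → ModuleCat.{u} R ⥤ ModuleCat.{u} R} {P : ∀ X : ModuleCat.{u} R, X → Prop}

/-- Both functors embed in the identity with the same image `P`. Naturality is retained because it
is needed for the comparison in degree one. -/
theorem exists_zero_equiv (h : IsEffaceableSequence T P) (h' : IsEffaceableSequence T' P) :
    ∃ κ : ∀ X : ModuleCat.{u} R, (T 0).obj X ≃ₗ[R] (T' 0).obj X,
      ∀ {X Y : ModuleCat.{u} R} (g : X ⟶ Y) y,
        κ Y (((T 0).map g).hom y) = ((T' 0).map g).hom (κ X y) := by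
  obtain ⟨ε, hε, hn, hr⟩ := h.zero
  obtain ⟨ε', hε', hn', hr'⟩ := h'.zero
  have hrange : ∀ X, LinearMap.range (ε X) = LinearMap.range (ε' X) := fun X =>
    Submodule.ext fun m => (hr X m).trans (hr' X m).symm
  have hκ : ∀ X, ∃ κ : (T 0).obj X ≃ₗ[R] (T' 0).obj X, ∀ y, ε' X (κ y) = ε X y := fun X =>
    ⟨LinearEquiv.ofInjective _ (hε X) ≪≫ₗ LinearEquiv.ofEq _ _ (hrange X) ≪≫ₗ
      (LinearEquiv.ofInjective _ (hε' X)).symm, fun y =>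
      congrArg Subtype.val (LinearEquiv.apply_symm_apply (LinearEquiv.ofInjective _ (hε' X))
        (LinearEquiv.ofEq _ _ (hrange X) (LinearEquiv.ofInjective _ (hε X) y)))⟩
  choose κ hκ using hκ
  exact ⟨κ, fun {X Y} g y => hε' Y (by rw [hκ, hn, hn', hκ])⟩

/-- Two effaceable sequences with the same zeroth functor have isomorphic values. -/
theorem nonempty_equiv (h : IsEffaceableSequence T P) (h' : IsEffaceableSequence T' P) (n : ℕ)
    (X : ModuleCat.{u} R) : Nonempty ((T n).obj X ≃ₗ[R] (T' n).obj X) := by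
  obtain ⟨κ, hκ⟩ := exists_zero_equiv h h'
  cases n with
  | zero => exact ⟨κ X⟩
  | succ n =>
    -- In degree one the kernel of the connecting map is the image of a degree zero map, and the
    -- natural isomorphism of zeroth functors matches the two images. In higher degrees the middle
    -- term vanishes, the connecting maps are bijective, and no naturality is required.
    induction n generalizing X with
    | zero =>
      let S := ShortComplex.mk (Injective.ι X) (cokernel.π _) (cokernel.condition _)
      have hS : S.ShortExact := { exact := ShortComplex.exact_cokernel _ }
      have : Injective S.X₂ := inferInstanceAs (Injective (Injective.under X))
      obtain ⟨d, hd, hd0⟩ := h.connecting hS 0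
      obtain ⟨d', hd', hd0'⟩ := h'.connecting hS 0
      refine ⟨equivOfSurjective d (d' ∘ₗ (κ S.X₃).toLinearMap) hd
        (hd'.comp (κ S.X₃).surjective) fun y => ?_⟩
      rw [hd0, LinearMap.comp_apply, LinearEquiv.coe_coe, hd0']
      constructor
      · rintro ⟨y', rfl⟩
        exact ⟨_, (hκ S.g y').symm⟩
      · rintro ⟨y', hy'⟩
        obtain ⟨y', rfl⟩ := (κ S.X₂).surjective y'
        rw [← hκ, EmbeddingLike.apply_eq_iff_eq] at hy'
        exact ⟨_, hy'⟩
    | succ n ih =>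
      let S := ShortComplex.mk (Injective.ι X) (cokernel.π _) (cokernel.condition _)
      have hS : S.ShortExact := { exact := ShortComplex.exact_cokernel _ }
      have : Injective S.X₂ := inferInstanceAs (Injective (Injective.under X))
      obtain ⟨d, hd, hd0⟩ := h.connecting hS (n + 1)
      obtain ⟨d', hd', hd0'⟩ := h'.connecting hS (n + 1)
      obtain ⟨e⟩ := ih S.X₃
      have h1 := h.subsingleton S.X₂ n
      have h2 := h'.subsingleton S.X₂ n
      refine ⟨equivOfSurjective d (d' ∘ₗ e.toLinearMap) hd (hd'.comp e.surjective) fun y => ?_⟩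
      rw [hd0, LinearMap.comp_apply, LinearEquiv.coe_coe, hd0']
      have h3 : (∃ y', ((T (n + 1)).map S.g).hom y' = y) ↔ y = 0 :=
        ⟨fun ⟨y', hy'⟩ => by rw [← hy', Subsingleton.elim y' 0, map_zero],
          fun hy => ⟨0, by rw [hy, map_zero]⟩⟩
      have h4 : (∃ y', ((T' (n + 1)).map S.g).hom y' = e y) ↔ e y = 0 :=
        ⟨fun ⟨y', hy'⟩ => by rw [← hy', Subsingleton.elim y' 0, map_zero],
          fun hy => ⟨0, by rw [hy, map_zero]⟩⟩
      rw [h3, h4, LinearEquiv.map_eq_zero_iff]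

end IsEffaceableSequence

theorem localCohomology_isEffaceableSequence (𝔞 : Ideal R) :
    IsEffaceableSequence (localCohomology 𝔞) fun _ m => ∃ k : ℕ, ∀ a ∈ 𝔞 ^ k, a • m = 0 where
  connecting hS _ n := LocalCohomology.exists_connecting 𝔞 hS n
  subsingleton J _ n := LocalCohomology.subsingleton_of_injective 𝔞 J n
  zero := LocalCohomology.exists_zero_iso 𝔞

namespace Cech

variable {c : ℕ} (x : Fin c → R)

/-- Čech cohomology. -/
abbrev cohomology (n : ℕ) : ModuleCat.{u} R ⥤ ModuleCat.{u} R :=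
  cechComplex x ⋙ HomologicalComplex.homologyFunctor _ _ (n : ℤ)

theorem shortExact {S : ShortComplex (ModuleCat.{u} R)} (hS : S.ShortExact) :
    (S.map (cechComplex x)).ShortExact := by
  have hf := hS.moduleCat_injective_f
  have hg := hS.moduleCat_surjective_g
  refine HomologicalComplex.shortExact_of_degreewise_shortExact _ fun i => ?_
  have := (ModuleCat.mono_iff_injective (((S.map (cechComplex x)).map
    (HomologicalComplex.eval _ _ i)).f)).2 (termMap_injective x hf i)
  have := (ModuleCat.epi_iff_surjective (((S.map (cechComplex x)).map
    (HomologicalComplex.eval _ _ i)).g)).2 (termMap_surjective x hg i)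
  refine { exact := ?_ }
  rw [ShortComplex.moduleCat_exact_iff]
  intro z hz
  exact (termMap_exact x ((ShortComplex.ShortExact.moduleCat_exact_iff_function_exact S).1
    hS.exact) i z).1 hz

theorem mem_cyc_iff {M : ModuleCat.{u} R} {i : ℤ} {z : CechTerm x M i} :
    z ∈ cyc ((cechComplex x).obj M) i ↔ cechD x M i (i + 1) z = 0 :=
  mem_cyc_of_rel (K := (cechComplex x).obj M) (j := i + 1) rfl

theorem subsingleton_homology_of_exactAt {M : ModuleCat.{u} R} {i : ℤ} (h : ExactAt x M i) :
    Subsingleton (((cechComplex x).obj M).homology i) :=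
  subsingleton_homology fun z hz => by
    obtain ⟨w, hw⟩ := h z ((mem_cyc_iff x).1 hz)
    exact ⟨_, w, hw⟩

theorem subsingleton_cohomology_of_injective [IsNoetherianRing R] (J : ModuleCat.{u} R)
    [Injective J] (n : ℕ) : Subsingleton ((cohomology x (n + 1)).obj J) :=
  subsingleton_homology_of_exactAt x (exactAt_of_injective x
    (Module.injective_module_of_injective_object R J) (by push_cast; omega))

theorem exists_connecting [IsNoetherianRing R] {S : ShortComplex (ModuleCat.{u} R)}
    (hS : S.ShortExact) [Injective S.X₂] (n : ℕ) :
    ∃ d : (cohomology x n).obj S.X₃ →ₗ[R] (cohomology x (n + 1)).obj S.X₁,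
      Function.Surjective d ∧ ∀ y, d y = 0 ↔ ∃ y', ((cohomology x n).map S.g).hom y' = y := by
  have hrel : (ComplexShape.up ℤ).Rel (n : ℤ) ((n + 1 : ℕ) : ℤ) := by simp
  have h0 := subsingleton_cohomology_of_injective x S.X₂ n
  have : Epi ((shortExact x hS).δ _ _ hrel) :=
    (shortExact x hS).epi_δ _ _ hrel (@ModuleCat.isZero_of_subsingleton _ _ _ h0)
  refine ⟨((shortExact x hS).δ _ _ hrel).hom, (ModuleCat.epi_iff_surjective _).1 this,
    fun y => ⟨(ShortComplex.moduleCat_exact_iff _).1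
      ((shortExact x hS).homology_exact₃ _ _ hrel) y, ?_⟩⟩
  rintro ⟨y', rfl⟩
  exact LinearMap.congr_fun (congrArg ModuleCat.Hom.hom ((shortExact x hS).comp_δ _ _ hrel)) y'

theorem exists_zero_iso :
    ∃ ε : ∀ X : ModuleCat.{u} R, (cohomology x 0).obj X →ₗ[R] X,
      (∀ X, Function.Injective (ε X)) ∧
      (∀ {X Y : ModuleCat.{u} R} (g : X ⟶ Y) y,
        ε Y (((cohomology x 0).map g).hom y) = g.hom (ε X y)) ∧
      ∀ X m, (∃ y, ε X y = m) ↔ ∀ j, ∃ k : ℕ, x j ^ k • m = 0 := by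
  have hε : ∀ X : ModuleCat.{u} R, ∃ ε : (cohomology x 0).obj X →ₗ[R] X,
      ∀ (z : CechTerm x X 0) (hz : z ∈ cyc ((cechComplex x).obj X) 0),
        toTermZero x X (ε (cls ((cechComplex x).obj X) 0 ⟨z, hz⟩)) = z := by
    intro X
    let e := LinearEquiv.ofBijective _ (toTermZero_bijective x X)
    have h : ∀ z : cyc ((cechComplex x).obj X) 0, (LinearMap.id : _ →ₗ[R] _) z = 0 ↔
        ∃ j y, (((cechComplex x).obj X).d j 0).hom y = z := by
      refine fun z => ⟨fun h => ⟨1, 0, ?_⟩, ?_⟩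
      · rw [map_zero, show z = 0 from h]
        rfl
      · rintro ⟨j, y, hy⟩
        refine Subtype.ext (hy.symm.trans ?_)
        -- The Čech complex is zero in degree `-1`, so degree zero cohomology consists of cocycles
        -- only.
        by_cases hj : j + 1 = 0
        · have : y = 0 := funext fun S => absurd S.2 (by omega)
          rw [this, map_zero]
          rfl
        · rw [((cechComplex x).obj X).shape _ _ hj]
          rfl
    exact ⟨(e.symm.toLinearMap ∘ₗ (cyc ((cechComplex x).obj X) 0).subtype) ∘ₗ
      (homologyEquiv (K := (cechComplex x).obj X) (i := 0) LinearMap.id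
        Function.surjective_id h).toLinearMap,
      fun z hz => (LinearEquiv.apply_symm_apply e _).trans
        (congrArg Subtype.val (homologyEquiv_cls (K := (cechComplex x).obj X) LinearMap.id
          Function.surjective_id h ⟨z, hz⟩))⟩
  choose ε hε using hε
  refine ⟨ε, fun X => (injective_iff_map_eq_zero _).2 fun y hy => ?_, fun {X Y} g y => ?_,
    fun X m => ⟨?_, fun h => ?_⟩⟩
  · obtain ⟨⟨z, hz⟩, rfl⟩ := cls_surjective (K := (cechComplex x).obj X) 0 y
    have h1 := hε X z hz
    have h2 : ε X (cls ((cechComplex x).obj X) 0 ⟨z, hz⟩) = 0 := hy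
    rw [h2, map_zero] at h1
    rw [show (⟨z, hz⟩ : cyc ((cechComplex x).obj X) 0) = 0 from Subtype.ext h1.symm]
    exact map_zero _
  · obtain ⟨⟨z, hz⟩, rfl⟩ := cls_surjective (K := (cechComplex x).obj X) 0 y
    apply (toTermZero_bijective x Y).1
    have h1 := homologyMap_cls ((cechComplex x).map g) ⟨z, hz⟩
    refine (congrArg (fun y => toTermZero x Y (ε Y y)) h1).trans ((hε Y _ _).trans ?_)
    refine Eq.trans ?_ (termMap_toTerm x g.hom 0 _)
    exact congrArg (termMap x g.hom 0) (hε X z hz).symm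
  · rintro ⟨y, rfl⟩
    obtain ⟨⟨z, hz⟩, rfl⟩ := cls_surjective (K := (cechComplex x).obj X) 0 y
    refine (cechD_toTermZero_eq_zero_iff x _).1 ?_
    exact (congrArg (cechD x X 0 1) (hε X z hz)).trans ((mem_cyc_iff x).1 hz)
  · rw [← cechD_toTermZero_eq_zero_iff] at h
    exact ⟨cls ((cechComplex x).obj X) 0 ⟨toTermZero x X m, (mem_cyc_iff x).2 h⟩,
      (toTermZero_bijective x X).1 (hε X _ _)⟩

/-- Both conditions say that the ideal in question lies in the radical of the annihilator of `m`,
which depends only on its radical. Finite generation of `𝔞` then yields a single exponent. -/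
theorem exists_pow_smul_iff [IsNoetherianRing R] {𝔞 : Ideal R}
    (hx : (Ideal.span (Set.range x)).radical = 𝔞.radical) {M : Type u} [AddCommGroup M]
    [Module R M] (m : M) :
    (∀ j, ∃ k : ℕ, x j ^ k • m = 0) ↔ ∃ k : ℕ, ∀ a ∈ 𝔞 ^ k, a • m = 0 := by
  have h1 : (∀ j, ∃ k : ℕ, x j ^ k • m = 0) ↔
      Ideal.span (Set.range x) ≤ (show Ideal R from LinearMap.ker (LinearMap.toSpanSingleton R M m)).radical := by
    rw [Ideal.span_le, Set.range_subset_iff]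
    exact Iff.rfl
  rw [h1, ← Ideal.radical_le_radical_iff, hx, Ideal.radical_le_radical_iff]
  constructor
  · intro h
    obtain ⟨k, hk⟩ := Ideal.exists_pow_le_of_le_radical_of_fg h (IsNoetherian.noetherian 𝔞)
    exact ⟨k, fun a ha => hk ha⟩
  · rintro ⟨k, hk⟩ a ha
    exact ⟨k, hk _ (Ideal.pow_mem_pow ha k)⟩

theorem isEffaceableSequence [IsNoetherianRing R] {𝔞 : Ideal R}
    (hx : (Ideal.span (Set.range x)).radical = 𝔞.radical) :
    IsEffaceableSequence (cohomology x) fun _ m => ∃ k : ℕ, ∀ a ∈ 𝔞 ^ k, a • m = 0 where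
  connecting hS _ n := exists_connecting x hS n
  subsingleton J _ n := subsingleton_cohomology_of_injective x J n
  zero := by
    obtain ⟨ε, h1, h2, h3⟩ := exists_zero_iso x
    exact ⟨ε, h1, h2, fun X m => (h3 X m).trans (exists_pow_smul_iff x hx m)⟩

/-- Over a Noetherian ring, Čech cohomology is local cohomology. -/
theorem nonempty_localCohomology_equiv [IsNoetherianRing R] {𝔞 : Ideal R}
    (hx : (Ideal.span (Set.range x)).radical = 𝔞.radical) (n : ℕ) (X : ModuleCat.{u} R) :
    Nonempty ((localCohomology 𝔞 n).obj X ≃ₗ[R] ((cechComplex x).obj X).homology (n : ℤ)) :=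
  (localCohomology_isEffaceableSequence 𝔞).nonempty_equiv (isEffaceableSequence x hx) n X

end Cech

end

/-! ### The Čech complex and tensor products with flat modules -/

noncomputable section

namespace Cech

open ModuleComplex TensorProduct

variable {R : Type u} [CommRing R] {c : ℕ} (x : Fin c → R)

section Tensor

variable (N N' X : Type u) [AddCommGroup N] [Module R N] [AddCommGroup N'] [Module R N']
  [AddCommGroup X] [Module R X]

/-- `termMap` as a linear map. -/
def termMapHom (M M' : Type u) [AddCommGroup M] [Module R M] [AddCommGroup M'] [Module R M']
    (i : ℤ) : (M →ₗ[R] M') →ₗ[R] CechTerm x M i →ₗ[R] CechTerm x M' i where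
  toFun f := termMap x f i
  map_add' f g := LinearMap.ext fun z => funext fun S =>
    LinearMap.congr_fun (map_add (IsLocalizedModule.map (cechPowers x S.1) _ _) f g) (z S)
  map_smul' r f := LinearMap.ext fun z => funext fun S =>
    LinearMap.congr_fun (map_smul (IsLocalizedModule.map (cechPowers x S.1)
      (LocalizedModule.mkLinearMap (cechPowers x S.1) M)
      (LocalizedModule.mkLinearMap (cechPowers x S.1) M')) r f) (z S)

theorem termMap_comp {M M' M'' : Type u} [AddCommGroup M] [Module R M] [AddCommGroup M']
    [Module R M'] [AddCommGroup M''] [Module R M''] (f : M →ₗ[R] M') (g : M' →ₗ[R] M'') (i : ℤ)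
    (z : CechTerm x M i) : termMap x (g ∘ₗ f) i z = termMap x g i (termMap x f i z) :=
  funext fun S => LinearMap.congr_fun (cechPieceMap_comp x f g S.1) (z S)

/-- The comparison map `N ⊗ C(X)^i → C(N ⊗ X)^i`. -/
def tensorTerm (i : ℤ) : N ⊗[R] CechTerm x X i →ₗ[R] CechTerm x (N ⊗[R] X) i :=
  TensorProduct.lift (termMapHom x X (N ⊗[R] X) i ∘ₗ TensorProduct.mk R N X)

theorem tensorTerm_tmul (i : ℤ) (n : N) (z : CechTerm x X i) :
    tensorTerm x N X i (n ⊗ₜ z) = termMap x (TensorProduct.mk R N X n) i z := rfl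

theorem cechD_tensorTerm (i j : ℤ) (t : N ⊗[R] CechTerm x X i) :
    cechD x (N ⊗[R] X) i j (tensorTerm x N X i t) =
      tensorTerm x N X j ((cechD x X i j).lTensor N t) := by
  induction t with
  | zero => simp only [map_zero]
  | add a b ha hb => simp only [map_add, ha, hb]
  | tmul n z => rw [tensorTerm_tmul, cechD_termMap, LinearMap.lTensor_tmul, tensorTerm_tmul]

variable {N N'} in
theorem tensorTerm_naturality (φ : N →ₗ[R] N') (i : ℤ) (t : N ⊗[R] CechTerm x X i) :
    termMap x (φ.rTensor X) i (tensorTerm x N X i t) =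
      tensorTerm x N' X i (φ.rTensor (CechTerm x X i) t) := by
  induction t with
  | zero => simp only [map_zero]
  | add a b ha hb => simp only [map_add, ha, hb]
  | tmul n z =>
    rw [tensorTerm_tmul, LinearMap.rTensor_tmul, tensorTerm_tmul, ← termMap_comp]
    congr 1

/-- The comparison map `N ⊗ X_S → (N ⊗ X)_S`. -/
def tensorPiece (S : Finset (Fin c)) : N ⊗[R] CechPiece x X S →ₗ[R] CechPiece x (N ⊗[R] X) S :=
  TensorProduct.lift (IsLocalizedModule.map (cechPowers x S)
    (LocalizedModule.mkLinearMap (cechPowers x S) X)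
    (LocalizedModule.mkLinearMap (cechPowers x S) (N ⊗[R] X)) ∘ₗ TensorProduct.mk R N X)

/-- Uniqueness of localizations: `X_S ⊗ N` is a localization of `X ⊗ N`, and the comparison map is
compatible with the two localization maps. The factors are swapped so that the localized one stands
first. -/
theorem tensorPiece_bijective (S : Finset (Fin c)) :
    Function.Bijective (tensorPiece x N X S) := by
  let f : X ⊗[R] N →ₗ[R] CechPiece x X S ⊗[R] N :=
    AlgebraTensorModule.rTensor R N (LocalizedModule.mkLinearMap (cechPowers x S) X)
  let g : CechPiece x X S ⊗[R] N →ₗ[R] CechPiece x (N ⊗[R] X) S :=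
    tensorPiece x N X S ∘ₗ (TensorProduct.comm R _ _).toLinearMap
  have hg : g ∘ₗ f = LocalizedModule.mkLinearMap (cechPowers x S) (N ⊗[R] X) ∘ₗ
      (TensorProduct.comm R X N).toLinearMap := by
    refine TensorProduct.ext' fun a n => ?_
    exact LinearMap.congr_fun (cechPieceMap_comp_mk x (TensorProduct.mk R N X n) S) a
  have : IsLocalizedModule (cechPowers x S) (g ∘ₗ f) := by
    rw [hg]
    infer_instance
  have h1 : Function.Bijective g := by
    rw [← IsLocalizedModule.linearEquiv_of_isLocalizedModule_comp (cechPowers x S) f g]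
    exact LinearEquiv.bijective _
  exact (Function.Bijective.of_comp_iff _ (TensorProduct.comm R _ _).bijective).1 h1

theorem tensorTerm_bijective (i : ℤ) : Function.Bijective (tensorTerm x N X i) := by
  classical
  let e := TensorProduct.piRight R R N
    fun S : {S : Finset (Fin c) // (S.card : ℤ) = i} => CechPiece x X S.1
  let e' := LinearEquiv.piCongrRight fun S : {S : Finset (Fin c) // (S.card : ℤ) = i} =>
    LinearEquiv.ofBijective _ (tensorPiece_bijective x N X S.1)
  have h : tensorTerm x N X i = (e ≪≫ₗ e').toLinearMap :=
    TensorProduct.ext' fun n z => rfl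
  rw [h]
  exact (e ≪≫ₗ e').bijective

end Tensor

/-- Tensoring with a flat module commutes with homology. -/
theorem exists_homology_of_flat (N : Type u) [AddCommGroup N] [Module R N] [Module.Flat R N]
    {A B C H : Type u} [AddCommGroup A] [Module R A] [AddCommGroup B] [Module R B]
    [AddCommGroup C] [Module R C] [AddCommGroup H] [Module R H] (d₁ : A →ₗ[R] B)
    (d₂ : B →ₗ[R] C) (Z : Submodule R B) (hZ : ∀ z, z ∈ Z ↔ d₂ z = 0) (π : Z →ₗ[R] H)
    (hπ : Function.Surjective π) (hπ0 : ∀ z, π z = 0 ↔ ∃ a, d₁ a = z)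
    (hd : ∀ a, d₁ a ∈ Z) :
    ∃ l : LinearMap.ker (d₂.lTensor N) →ₗ[R] N ⊗[R] H, Function.Surjective l ∧
      (∀ t, l t = 0 ↔ ∃ v, d₁.lTensor N v = t) ∧
      (∀ u h, l ⟨Z.subtype.lTensor N u, h⟩ = π.lTensor N u) ∧
      ∀ t ∈ LinearMap.ker (d₂.lTensor N), ∃ u, Z.subtype.lTensor N u = t := by
  have hinj : Function.Injective (Z.subtype.lTensor N) :=
    Module.Flat.lTensor_preserves_injective_linearMap _ Z.injective_subtype
  have hex : Function.Exact (Z.subtype.lTensor N) (d₂.lTensor N) :=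
    Module.Flat.lTensor_exact N fun b => by
      rw [← hZ]
      exact ⟨fun h => ⟨⟨b, h⟩, rfl⟩, fun ⟨z, hz⟩ => hz ▸ z.2⟩
  have hex' : Function.Exact ((d₁.codRestrict Z hd).lTensor N) (π.lTensor N) :=
    lTensor_exact N (fun z => by
      rw [hπ0]
      exact ⟨fun ⟨a, ha⟩ => ⟨a, Subtype.ext ha⟩, fun ⟨a, ha⟩ => ⟨a, congrArg Subtype.val ha⟩⟩) hπ
  have hcomp : ∀ v, Z.subtype.lTensor N ((d₁.codRestrict Z hd).lTensor N v) = d₁.lTensor N v :=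
    fun v => by
      rw [← LinearMap.lTensor_comp_apply]
      rfl
  -- Flatness identifies `N ⊗ Z` with the cycles of the tensored complex; right exactness then
  -- identifies the quotient by boundaries with `N ⊗ H`.
  let e : (N ⊗[R] Z) ≃ₗ[R] LinearMap.ker (d₂.lTensor N) :=
    LinearEquiv.ofInjective _ hinj ≪≫ₗ LinearEquiv.ofEq _ _ hex.linearMap_ker_eq.symm
  have he : ∀ u h, e.symm ⟨Z.subtype.lTensor N u, h⟩ = u := fun u h => by
    rw [LinearEquiv.symm_apply_eq]
    rfl
  have hl : ∀ t : LinearMap.ker (d₂.lTensor N), Z.subtype.lTensor N (e.symm t) = t := fun t =>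
    congrArg Subtype.val (e.apply_symm_apply t)
  refine ⟨π.lTensor N ∘ₗ e.symm.toLinearMap,
    (LinearMap.lTensor_surjective N hπ).comp e.symm.surjective, fun t => ?_, fun u h => ?_,
    fun t ht => (hex t).1 ht⟩
  · rw [LinearMap.comp_apply, LinearEquiv.coe_coe, hex' (e.symm t)]
    constructor
    · rintro ⟨v, hv⟩
      exact ⟨v, by rw [← hcomp, hv, hl]⟩
    · rintro ⟨v, hv⟩
      exact ⟨v, hinj (by rw [hcomp, hv, hl])⟩
  · rw [LinearMap.comp_apply, LinearEquiv.coe_coe, he]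

/-- Čech cocycles. -/
abbrev cocycles (M : Type u) [AddCommGroup M] [Module R M] (i : ℤ) : Submodule R (CechTerm x M i) :=
  LinearMap.ker (cechD x M i (i + 1))

/-- The class of a Čech cocycle. -/
def cocycleCls (X : ModuleCat.{u} R) (i : ℤ) :
    cocycles x X i →ₗ[R] ((cechComplex x).obj X).homology i :=
  clsOf ((cechComplex x).obj X) (cocycles x X i).subtype fun z => (mem_cyc_iff x).2 z.2

theorem cocycleCls_surjective (X : ModuleCat.{u} R) (i : ℤ) :
    Function.Surjective (cocycleCls x X i) := by
  intro w
  obtain ⟨⟨z, hz⟩, rfl⟩ := cls_surjective (K := (cechComplex x).obj X) i w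
  exact ⟨⟨z, (mem_cyc_iff x).1 hz⟩, rfl⟩

theorem cocycleCls_eq_zero_iff (X : ModuleCat.{u} R) (i : ℤ) (z : cocycles x X i) :
    cocycleCls x X i z = 0 ↔ ∃ a, cechD x X (i - 1) i a = z :=
  cls_eq_zero_iff_of_rel (K := (cechComplex x).obj X) (j := i - 1)
    (show i - 1 + 1 = i by omega) ⟨z.1, (mem_cyc_iff x).2 z.2⟩

/-- The Čech cohomology of `N ⊗ X`, `N` flat: a map from cocycles to `N ⊗ H^i(C(X))`. -/
theorem exists_cocycle_map (N : Type u) [AddCommGroup N] [Module R N] [Module.Flat R N]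
    (X : ModuleCat.{u} R) (i : ℤ) :
    ∃ l : cocycles x (N ⊗[R] X) i →ₗ[R] N ⊗[R] ((cechComplex x).obj X).homology i,
      Function.Surjective l ∧
      (∀ t, l t = 0 ↔ ∃ v, cechD x (N ⊗[R] X) (i - 1) i v = t) ∧
      (∀ u h, l ⟨tensorTerm x N X i ((cocycles x X i).subtype.lTensor N u), h⟩ =
        (cocycleCls x X i).lTensor N u) ∧
      ∀ t ∈ cocycles x (N ⊗[R] X) i,
        ∃ u, tensorTerm x N X i ((cocycles x X i).subtype.lTensor N u) = t := by
  obtain ⟨l, hl, hl0, hlu, hu⟩ := exists_homology_of_flat N (cechD x X (i - 1) i)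
    (cechD x X i (i + 1)) (cocycles x X i) (fun z => Iff.rfl)
    (cocycleCls x X i) (cocycleCls_surjective x X i) (cocycleCls_eq_zero_iff x X i)
    (fun a => LinearMap.congr_fun (cechD_comp x X (i - 1) i (i + 1) rfl) a)
  let e := LinearEquiv.ofBijective _ (tensorTerm_bijective x N X i)
  have he : ∀ t, tensorTerm x N X i (e.symm t) = t := e.apply_symm_apply
  have hs : ∀ t, e.symm (tensorTerm x N X i t) = t := e.symm_apply_apply
  have hker : ∀ t, t ∈ cocycles x (N ⊗[R] X) i ↔
      e.symm t ∈ LinearMap.ker ((cechD x X i (i + 1)).lTensor N) := by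
    intro t
    obtain ⟨t, rfl⟩ := e.surjective t
    rw [LinearEquiv.symm_apply_apply, LinearMap.mem_ker, LinearMap.mem_ker]
    change cechD x (N ⊗[R] X) i (i + 1) (tensorTerm x N X i t) = 0 ↔ _
    rw [cechD_tensorTerm]
    exact (injective_iff_map_eq_zero' _).1 (tensorTerm_bijective x N X (i + 1)).1 _
  refine ⟨l ∘ₗ e.symm.toLinearMap.restrict (fun t ht => (hker t).1 ht), fun w => ?_,
    fun t => ?_, fun u h => ?_, fun t ht => ?_⟩
  · obtain ⟨⟨t, ht⟩, rfl⟩ := hl w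
    refine ⟨⟨e t, (hker _).2 (by rwa [LinearEquiv.symm_apply_apply])⟩, congrArg l ?_⟩
    exact Subtype.ext (e.symm_apply_apply t)
  · refine (hl0 _).trans ⟨?_, ?_⟩
    · rintro ⟨v, hv⟩
      refine ⟨tensorTerm x N X (i - 1) v, ?_⟩
      rw [cechD_tensorTerm, hv]
      exact he t
    · rintro ⟨v, hv⟩
      obtain ⟨v, rfl⟩ := (tensorTerm_bijective x N X (i - 1)).2 v
      refine ⟨v, (tensorTerm_bijective x N X i).1 ?_⟩
      rw [← cechD_tensorTerm, hv]
      exact (he t).symm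
  · have h' : (cocycles x X i).subtype.lTensor N u ∈
        LinearMap.ker ((cechD x X i (i + 1)).lTensor N) := by
      have := (hker _).1 h
      rwa [hs] at this
    rw [← hlu u h']
    exact congrArg l (Subtype.ext (hs _))
  · obtain ⟨u, hu⟩ := hu _ ((hker t).1 ht)
    exact ⟨u, by rw [hu, he]⟩

end Cech

/-! ### Torsion in the homology of a tensored flat resolution -/

namespace FlatResolution

open TensorProduct

variable {R : Type u} [CommRing R] {F : ℕ → Type u} [∀ p, AddCommGroup (F p)]
  [∀ p, Module R (F p)] (d : ∀ p, F (p + 1) →ₗ[R] F p)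

/-- The cycles of the complex `F ⊗ X`. -/
def tensorCycles (X : Type u) [AddCommGroup X] [Module R X] : ∀ p, Submodule R (F p ⊗[R] X)
  | 0 => ⊤
  | p + 1 => LinearMap.ker ((d p).rTensor X)

theorem rTensor_lTensor {R M M' A B : Type u} [CommRing R] [AddCommGroup M] [Module R M]
    [AddCommGroup M'] [Module R M'] [AddCommGroup A] [Module R A] [AddCommGroup B] [Module R B]
    (g : M →ₗ[R] M') (f : A →ₗ[R] B) (t : M ⊗[R] A) :
    g.rTensor B (f.lTensor M t) = f.lTensor M' (g.rTensor A t) := by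
  rw [← LinearMap.comp_apply, ← LinearMap.comp_apply, LinearMap.rTensor_comp_lTensor,
    LinearMap.lTensor_comp_rTensor]

theorem exists_pow_smul_eq_zero {a : R} {N : Type u} [AddCommGroup N] [Module R N]
    (ha : ∀ n : N, ∃ k : ℕ, a ^ k • n = 0) (X : Type u) [AddCommGroup X] [Module R X]
    (t : N ⊗[R] X) : ∃ k : ℕ, a ^ k • t = 0 := by
  induction t with
  | zero => exact ⟨0, smul_zero _⟩
  | tmul n z =>
    obtain ⟨k, hk⟩ := ha n
    exact ⟨k, by rw [TensorProduct.smul_tmul', hk, TensorProduct.zero_tmul]⟩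
  | add s t hs ht =>
    obtain ⟨k, hk⟩ := hs
    obtain ⟨l, hl⟩ := ht
    refine ⟨k + l, ?_⟩
    rw [smul_add, pow_add, mul_smul, mul_smul, hl, smul_zero, add_zero, smul_comm, hk, smul_zero]

variable [∀ p, Module.Flat R (F p)]

variable {d} in
-- Dimension shifting in `X`. Let `Y` be the kernel of the flat cover `P → X` and lift `y` to `y'`
-- in `F ⊗ P`. Its differential is a cycle `z` of `F ⊗ Y`, and `a^k z` is the boundary of some `w`.
-- So `a^k y' - w` is a cycle of `F ⊗ P`, hence a boundary as `P` is flat, and it maps to `a^k y`.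
theorem exists_pow_smul_succ (hd : ∀ p, Function.Exact (d (p + 1)) (d p)) (a : R) (p : ℕ)
    (ih : ∀ (Y : Type u) [AddCommGroup Y] [Module R Y], ∀ z ∈ tensorCycles d Y p,
      ∃ (k : ℕ) (w : F (p + 1) ⊗[R] Y), (d p).rTensor Y w = a ^ k • z)
    {X P : Type u} [AddCommGroup X] [Module R X] [AddCommGroup P] [Module R P] [Module.Flat R P]
    {g : P →ₗ[R] X} (hg : Function.Surjective g) (y : F (p + 1) ⊗[R] X)
    (hy : (d p).rTensor X y = 0) :
    ∃ (k : ℕ) (w : F (p + 2) ⊗[R] X), (d (p + 1)).rTensor X w = a ^ k • y := by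
  have hgY : Function.Exact (LinearMap.ker g).subtype g := fun z => by
    rw [Submodule.coe_subtype, Subtype.range_val]
    exact Iff.rfl
  have hex : ∀ q, Function.Exact ((LinearMap.ker g).subtype.lTensor (F q)) (g.lTensor (F q)) :=
    fun q => lTensor_exact (F q) hgY hg
  have hinj : ∀ q, Function.Injective ((LinearMap.ker g).subtype.lTensor (F q)) := fun q =>
    Module.Flat.lTensor_preserves_injective_linearMap _ (LinearMap.ker g).injective_subtype
  obtain ⟨y', rfl⟩ := LinearMap.lTensor_surjective (F (p + 1)) hg y
  rw [rTensor_lTensor] at hy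
  obtain ⟨z, hz⟩ := (hex p _).1 hy
  have hzc : z ∈ tensorCycles d (LinearMap.ker g) p := by
    obtain _ | p := p
    · exact Submodule.mem_top
    · refine LinearMap.mem_ker.2 (hinj p ?_)
      rw [← rTensor_lTensor, hz, map_zero, ← LinearMap.rTensor_comp_apply,
        (hd p).linearMap_comp_eq_zero, LinearMap.rTensor_zero, LinearMap.zero_apply]
  obtain ⟨k, w, hw⟩ := ih _ z hzc
  obtain ⟨v, hv⟩ := (Module.Flat.rTensor_exact P (hd p)
    (a ^ k • y' - (LinearMap.ker g).subtype.lTensor _ w)).1 (by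
      rw [map_sub, map_smul, rTensor_lTensor, hw, map_smul, hz, sub_self])
  refine ⟨k, g.lTensor _ v, ?_⟩
  rw [rTensor_lTensor, hv, map_sub, map_smul, (hex (p + 1)).apply_apply_eq_zero, sub_zero]

/-- If every element of `N` is killed by a power of `a`, then so is every element of the
homology of `F ⊗ X`, `F` a flat resolution of `N`. -/
theorem exists_pow_smul (hd : ∀ p, Function.Exact (d (p + 1)) (d p))
    {N : Type u} [AddCommGroup N] [Module R N] {π : F 0 →ₗ[R] N} (hπ : Function.Surjective π)
    (hdπ : Function.Exact (d 0) π) (a : R) (ha : ∀ n : N, ∃ k : ℕ, a ^ k • n = 0) (p : ℕ)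
    (X : Type u) [AddCommGroup X] [Module R X] (y : F p ⊗[R] X) (hy : y ∈ tensorCycles d X p) :
    ∃ (k : ℕ) (w : F (p + 1) ⊗[R] X), (d p).rTensor X w = a ^ k • y := by
  induction p generalizing X with
  | zero =>
    -- In degree zero, right exactness turns the vanishing of `a^k y` in `N ⊗ X` into a boundary.
    obtain ⟨k, hk⟩ := exists_pow_smul_eq_zero ha X (π.rTensor X y)
    rw [← map_smul] at hk
    obtain ⟨w, hw⟩ := (rTensor_exact X hdπ hπ _).1 hk
    exact ⟨k, w, hw⟩
  | succ p ih =>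
    -- The flat cover is the free module on the elements of `X`.
    exact exists_pow_smul_succ hd a p (fun Y _ _ => ih Y)
      (Finsupp.linearCombination_id_surjective R X) y hy

end FlatResolution

end

/-! ### The second page of the Čech double complex -/

noncomputable section

namespace CechBicomplex

open TensorProduct Cech

variable {R : Type u} [CommRing R] {c : ℕ} (x : Fin c → R)
  (F : ChainComplex (ModuleCat.{u} R) ℕ) (X : ModuleCat.{u} R)

/-- The differentials of `F`. -/
abbrev diff (p : ℕ) : F.X (p + 1) →ₗ[R] F.X p := (F.d (p + 1) p).hom

theorem dh_eq (p q : ℕ) (t : CechTerm x (F.X (p + 1) ⊗[R] X) ((c : ℤ) - q)) :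
    TotalComplex.dh (cechBicomplex x F X) p q t =
      termMap x ((diff F p).rTensor X) ((c : ℤ) - q) t := rfl

theorem dv_eq (p q : ℕ) (t : CechTerm x (F.X p ⊗[R] X) ((c : ℤ) - (q + 1 : ℕ))) :
    TotalComplex.dv (cechBicomplex x F X) p q t =
      cechD x (F.X p ⊗[R] X) ((c : ℤ) - (q + 1 : ℕ)) ((c : ℤ) - q) t := by
  with_unfolding_all rfl

theorem cechTerm_subsingleton (M : Type u) [AddCommGroup M] [Module R M] {i : ℤ}
    (hi : i < 0 ∨ (c : ℤ) < i) : Subsingleton (CechTerm x M i) := by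
  have : IsEmpty {S : Finset (Fin c) // (S.card : ℤ) = i} := by
    refine ⟨fun ⟨S, hS⟩ => ?_⟩
    have := Finset.card_le_univ S
    rw [Fintype.card_fin] at this
    omega
  infer_instance

theorem cechD_congr {M : Type u} [AddCommGroup M] [Module R M] {i j j' : ℤ} (h : j = j')
    (t : CechTerm x M i) : cechD x M i j t = 0 ↔ cechD x M i j' t = 0 := by
  subst h
  rfl

theorem exists_cechD_congr {M : Type u} [AddCommGroup M] [Module R M] {i i' j : ℤ} (h : i = i')
    (t : CechTerm x M j) : (∃ v, cechD x M i j v = t) ↔ ∃ v, cechD x M i' j v = t := by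
  subst h
  rfl

theorem mem_vcyc_iff (p q : ℕ) (t : CechTerm x (F.X p ⊗[R] X) ((c : ℤ) - q)) :
    t ∈ TotalComplex.vcyc (cechBicomplex x F X) p q ↔
      t ∈ cocycles x (F.X p ⊗[R] X) ((c : ℤ) - q) := by
  rw [LinearMap.mem_ker]
  obtain _ | q := q
  -- Row `0` is Čech degree `c`; the next Čech term is zero, so every cochain there is a cocycle, as
  -- every element of row `0` is a vertical cycle.
  · have := cechTerm_subsingleton x (F.X p ⊗[R] X) (i := (c : ℤ) - (0 : ℕ) + 1)
      (Or.inr (by push_cast; omega))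
    exact ⟨fun _ => Subsingleton.elim _ _, fun _ => 
      TotalComplex.mem_vcyc_zero (T := cechBicomplex x F X) (p := p) t⟩
  · exact TotalComplex.mem_vcyc_succ.trans
      ((Eq.congr_left (dv_eq x F X p q t)).trans
        (cechD_congr x (by push_cast; ring) t))

/-- Vertical cycles of the double complex are Čech cocycles. -/
def toCocycles (p q : ℕ) : TotalComplex.vcyc (cechBicomplex x F X) p q →ₗ[R]
    cocycles x (F.X p ⊗[R] X) ((c : ℤ) - q) where
  toFun t := ⟨t.1, (mem_vcyc_iff x F X p q t.1).1 t.2⟩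
  map_add' _ _ := rfl
  map_smul' _ _ := rfl

variable [∀ p, Module.Flat R (F.X p)]

/-- The row of index `q` of the second page: the homology of `F ⊗ H^{c - q}(C(X))`. -/
theorem nonempty_secondPage_equiv (p q : ℕ) :
    Nonempty ((FilteredComplex.page
        (TotalComplex.isFirstQuadrantFiltration (cechBicomplex x F X)) 2).X (p, q) ≃ₗ[R]
      (((MonoidalCategory.tensorRight (((cechComplex x).obj X).homology ((c : ℤ) - q))
        ).mapHomologicalComplex (ComplexShape.down ℕ)).obj F).homology p) := by
  choose l hl hl0 hlu hu using fun p => exists_cocycle_map x (F.X p) X ((c : ℤ) - q)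
  refine TotalComplex.secondPage (cechBicomplex x F X) q _
    (fun p => l p ∘ₗ toCocycles x F X p q)
    (fun p w => ?_) (fun p t => ?_) (fun p t => ?_) p
  · obtain ⟨t, rfl⟩ := hl p w
    exact ⟨⟨t.1, (mem_vcyc_iff x F X p q t.1).2 t.2⟩, rfl⟩
  · refine (hl0 p _).trans (Iff.trans ?_ (exists_congr fun v => Eq.congr_left (dv_eq x F X p q v).symm))
    exact exists_cechD_congr x (show (c : ℤ) - q - 1 = c - (q + 1 : ℕ) by push_cast; ring) t.1
  -- Every cocycle comes from some `u` in `F_{p+1} ⊗ Z`, `Z` the cocycles of `X`. On such elements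
  -- the compatibility reduces to maps acting on different tensor factors.
  · obtain ⟨u, hu⟩ := hu (p + 1) t.1 ((mem_vcyc_iff x F X (p + 1) q t.1).1 t.2)
    let t' : TotalComplex.vcyc (cechBicomplex x F X) p q := ⟨_, TotalComplex.dh_mem_vcyc t.2⟩
    have h1 : toCocycles x F X (p + 1) q t =
        ⟨tensorTerm x (F.X (p + 1)) X ((c : ℤ) - q)
          ((cocycles x X ((c : ℤ) - q)).subtype.lTensor _ u), hu ▸ (toCocycles x F X _ q t).2⟩ :=
      Subtype.ext hu.symm
    have h2 : TotalComplex.dh (cechBicomplex x F X) p q t =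
        tensorTerm x (F.X p) X ((c : ℤ) - q)
          ((cocycles x X ((c : ℤ) - q)).subtype.lTensor _ ((diff F p).rTensor _ u)) := by
      refine (dh_eq x F X p q t.1).trans ((congrArg _ hu.symm).trans ?_)
      refine (tensorTerm_naturality x X (diff F p) ((c : ℤ) - q) _).trans (congrArg _ ?_)
      exact FlatResolution.rTensor_lTensor (diff F p) _ u
    have h3 : toCocycles x F X p q t' =
        ⟨tensorTerm x (F.X p) X ((c : ℤ) - q)
          ((cocycles x X ((c : ℤ) - q)).subtype.lTensor _ ((diff F p).rTensor _ u)),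
          h2 ▸ (toCocycles x F X p q t').2⟩ :=
      Subtype.ext h2
    calc _ = (diff F p).rTensor _ (l (p + 1) (toCocycles x F X (p + 1) q t)) := rfl
      _ = (diff F p).rTensor _ ((cocycleCls x X ((c : ℤ) - q)).lTensor _ u) := by
        rw [h1, hlu]
      _ = (cocycleCls x X ((c : ℤ) - q)).lTensor _ ((diff F p).rTensor _ u) :=
        FlatResolution.rTensor_lTensor (diff F p) _ u
      _ = l p (toCocycles x F X p q t') := by
        rw [h3, hlu]
      _ = _ := rfl
end CechBicomplex
end

/-! ### Existence of free resolutions -/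

noncomputable section

namespace FreeResolution

variable (R : Type u) [CommRing R]

/-- The property of being a free module. -/
abbrev isFree : ObjectProperty (ModuleCat.{u} R) := fun M => Module.Free R M

instance (X : Type u) : Module.Free R ((ModuleCat.free R).obj X) :=
  inferInstanceAs (Module.Free R (X →₀ R))

/-- Functorial presentations of modules as quotients of free modules. -/
def leftResolution : Abelian.LeftResolution (isFree R).ι where
  F := ObjectProperty.lift _ (forget _ ⋙ ModuleCat.free R) fun X =>
    inferInstanceAs (Module.Free R ((ModuleCat.free R).obj ((forget _).obj X)))
  π := (ModuleCat.adj R).counit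
  epi_π_app X := inferInstanceAs (Epi ((ModuleCat.adj R).counit.app X))

/-- The terms of a resolution by free modules. -/
def complex (N : ModuleCat.{u} R) : ChainComplex (ModuleCat.{u} R) ℕ :=
  ((isFree R).ι.mapHomologicalComplex _).obj ((leftResolution R).chainComplex N)

theorem free_complex (N : ModuleCat.{u} R) (p : ℕ) : Module.Free R ((complex R N).X p) :=
  (((leftResolution R).chainComplex N).X p).property

instance (N : ModuleCat.{u} R) (p : ℕ) : Projective ((complex R N).X p) := by
  have := free_complex R N p
  exact ModuleCat.projective_of_free (Module.Free.chooseBasis R ((complex R N).X p))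

theorem complex_exactAt_succ (N : ModuleCat.{u} R) (n : ℕ) : (complex R N).ExactAt (n + 1) :=
  (leftResolution R).exactAt_map_chainComplex_succ N n

/-- The term of degree `0` of the free resolution. -/
def isoZero (N : ModuleCat.{u} R) :
    (complex R N).X 0 ≅ (isFree R).ι.obj ((leftResolution R).F.obj N) :=
  (isFree R).ι.mapIso ((leftResolution R).chainComplexXZeroIso N)

/-- The term of degree `1` of the free resolution. -/
def isoOne (N : ModuleCat.{u} R) : (complex R N).X 1 ≅
    (isFree R).ι.obj ((leftResolution R).F.obj (kernel ((leftResolution R).π.app N))) :=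
  (isFree R).ι.mapIso ((leftResolution R).chainComplexXOneIso N)

theorem d_one_zero (N : ModuleCat.{u} R) :
    (complex R N).d 1 0 =
      (isoOne R N).hom ≫ (leftResolution R).π.app (kernel ((leftResolution R).π.app N)) ≫
        kernel.ι ((leftResolution R).π.app N) ≫ (isoZero R N).inv :=
  (leftResolution R).map_chainComplex_d_1_0 N

/-- The augmentation of the free resolution. -/
def augmentation (N : ModuleCat.{u} R) : (complex R N).X 0 ⟶ N :=
  (isoZero R N).hom ≫ (leftResolution R).π.app N

instance (N : ModuleCat.{u} R) : Epi (augmentation R N) := epi_comp _ _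

theorem d_comp_augmentation (N : ModuleCat.{u} R) :
    (complex R N).d 1 0 ≫ augmentation R N = 0 := by
  rw [augmentation, d_one_zero]
  simp

/-- The differential of degree one is an epimorphism onto the kernel of the presentation followed by
its inclusion, so exactness is inherited from the kernel sequence. -/
theorem exact_augmentation (N : ModuleCat.{u} R) :
    (ShortComplex.mk _ _ (d_comp_augmentation R N)).Exact := by
  let α : ShortComplex.mk _ _ (d_comp_augmentation R N) ⟶
      ShortComplex.mk _ _ (kernel.condition ((leftResolution R).π.app N)) :=
    { τ₁ := (isoOne R N).hom ≫ (leftResolution R).π.app (kernel ((leftResolution R).π.app N))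
      τ₂ := (isoZero R N).hom
      τ₃ := 𝟙 _
      comm₁₂ := by simp [d_one_zero]
      comm₂₃ := by simp [augmentation] }
  have : Epi α.τ₁ := epi_comp _ _
  have : IsIso α.τ₂ := inferInstanceAs (IsIso (isoZero R N).hom)
  have : Mono α.τ₃ := inferInstanceAs (Mono (𝟙 N))
  rw [ShortComplex.exact_iff_of_epi_of_isIso_of_mono α]
  exact ShortComplex.exact_of_f_is_kernel _ (kernelIsKernel _)

/-- A resolution of `N` by free modules. -/
def resolution (N : ModuleCat.{u} R) : ProjectiveResolution N where
  complex := complex R N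
  π := (ChainComplex.toSingle₀Equiv _ _).symm ⟨augmentation R N, d_comp_augmentation R N⟩
  quasiIso := ⟨fun n => by
    cases n
    · rw [ChainComplex.quasiIsoAt₀_iff, ShortComplex.quasiIso_iff_of_zeros']
      · refine (ShortComplex.exact_and_epi_g_iff_of_iso ?_).2
          ⟨exact_augmentation R N, inferInstanceAs (Epi (augmentation R N))⟩
        exact ShortComplex.isoMk (Iso.refl _) (Iso.refl _) (Iso.refl _)
          ((Category.id_comp _).trans (Category.comp_id _).symm)
          ((Category.id_comp _).trans (Category.comp_id _).symm)
      · exact (complex R N).shape 0 0 (by simp)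
      · rfl
      · rfl
    · rw [quasiIsoAt_iff_exactAt']
      · apply complex_exactAt_succ
      · apply ChainComplex.exactAt_succ_single_obj⟩

end FreeResolution
end

/-! ### Rows of the Čech double complex and the abutment -/

noncomputable section

namespace Cech

open TensorProduct

variable {R : Type u} [CommRing R] {c : ℕ} (x : Fin c → R)

/-- Stated for a degree merely equal to zero, since row `c` carries the degree `c - c`. -/
theorem toTerm_bijective (M : Type u) [AddCommGroup M] [Module R M] {i : ℤ} (hi : i = 0) :
    Function.Bijective (toTerm x (M := M) i) := by
  subst hi
  exact toTermZero_bijective x M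

theorem pieceMap_mk {A B : Type u} [AddCommGroup A] [Module R A] [AddCommGroup B] [Module R B]
    (f : A →ₗ[R] B) (S : Finset (Fin c)) (m : A) :
    cechPieceMap x f S (LocalizedModule.mkLinearMap (cechPowers x S) A m) =
      LocalizedModule.mkLinearMap (cechPowers x S) B (f m) :=
  LinearMap.congr_fun (cechPieceMap_comp_mk x f S) m

section

variable {A B C : Type u} [AddCommGroup A] [Module R A] [AddCommGroup B] [Module R B]
  [AddCommGroup C] [Module R C] {S : Finset (Fin c)}

theorem exists_pieceMap_eq {f : A →ₗ[R] B} {y : CechPiece x B S} {k : ℕ} {m : B}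
    (hy : (∏ j ∈ S, x j) ^ k • y = LocalizedModule.mkLinearMap (cechPowers x S) B m)
    (hm : ∃ (l : ℕ) (w : A), f w = (∏ j ∈ S, x j) ^ l • m) :
    ∃ v, cechPieceMap x f S v = y := by
  obtain ⟨l, w, hw⟩ := hm
  obtain ⟨v, hv⟩ := (pow_smul_bijective x A S (l + k)).2
    (LocalizedModule.mkLinearMap (cechPowers x S) A w)
  refine ⟨v, (pow_smul_bijective x B S (l + k)).1 ?_⟩
  have hv' : (∏ j ∈ S, x j) ^ (l + k) • v =
    LocalizedModule.mkLinearMap (cechPowers x S) A w := hv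
  change (∏ j ∈ S, x j) ^ (l + k) • cechPieceMap x f S v = (∏ j ∈ S, x j) ^ (l + k) • y
  rw [← map_smul, hv', pieceMap_mk, hw, map_smul, pow_add, mul_smul, hy]

theorem exists_pieceMap_eq_of_forall {f : A →ₗ[R] B}
    (h : ∀ m : B, ∃ (l : ℕ) (w : A), f w = (∏ j ∈ S, x j) ^ l • m) (y : CechPiece x B S) :
    ∃ v, cechPieceMap x f S v = y := by
  obtain ⟨k, m, hm⟩ := exists_pow_smul_eq_mk x B S y
  exact exists_pieceMap_eq x hm (h m)

/-- Exactness up to powers of `x_S` becomes exactness after localization: clear the denominator of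
`y`, then multiply by a further power so that the numerator lies in the kernel of `g` itself. -/
theorem exists_pieceMap_eq_of_ker {f : A →ₗ[R] B} {g : B →ₗ[R] C}
    (h : ∀ m : B, g m = 0 → ∃ (l : ℕ) (w : A), f w = (∏ j ∈ S, x j) ^ l • m)
    (y : CechPiece x B S) (hy : cechPieceMap x g S y = 0) :
    ∃ v, cechPieceMap x f S v = y := by
  obtain ⟨k, m, hm⟩ := exists_pow_smul_eq_mk x B S y
  have h0 : LocalizedModule.mkLinearMap (cechPowers x S) C (g m) = 0 := by
    rw [← pieceMap_mk, ← hm, map_smul, hy, smul_zero]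
  obtain ⟨l, hl⟩ := (mk_eq_zero_iff x C S _).1 h0
  rw [← map_smul] at hl
  exact exists_pieceMap_eq x (k := l + k) (by rw [pow_add, mul_smul, hm, map_smul]) (h _ hl)

end

end Cech

namespace CechBicomplex

open TensorProduct Cech

variable {R : Type u} [CommRing R] {c : ℕ} (x : Fin c → R)

section

variable {N : ModuleCat.{u} R} (F : ProjectiveResolution N) (X : ModuleCat.{u} R)

/-- The augmentation of a resolution. -/
abbrev augmentation : F.complex.X 0 →ₗ[R] N := (F.π.f 0).hom

theorem augmentation_surjective : Function.Surjective (augmentation F) :=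
  (ModuleCat.epi_iff_surjective (F.π.f 0)).1 inferInstance

theorem exact_diff_augmentation : Function.Exact (diff F.complex 0) (augmentation F) :=
  (ShortComplex.ShortExact.moduleCat_exact_iff_function_exact _).1 F.exact₀

theorem exact_diff (p : ℕ) : Function.Exact (diff F.complex (p + 1)) (diff F.complex p) :=
  (ShortComplex.ShortExact.moduleCat_exact_iff_function_exact _).1 (F.exact_succ p)

variable {F}

/-- For `q < c` each `S` with `|S| = c - q` contains some `j`, so powers of `x_S` kill every element
of `N` and every homology class of `F ⊗ X`; localizing at `x_S` makes that homology vanish. -/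
theorem exists_dh_eq [∀ p, Module.Flat R (F.complex.X p)]
    (hN : ∀ j (n : N), ∃ k : ℕ, x j ^ k • n = 0) (p q : ℕ) (hq : q < c)
    (t : CechTerm x (F.complex.X p ⊗[R] X) ((c : ℤ) - q))
    (ht : t ∈ TotalComplex.hcyc (cechBicomplex x F.complex X) p q) :
    ∃ s, TotalComplex.dh (cechBicomplex x F.complex X) p q s = t := by
  suffices h : ∀ S, ∃ v, cechPieceMap x ((diff F.complex p).rTensor X) S.1 v = t S by
    choose v hv using h
    exact ⟨v, funext hv⟩
  rintro ⟨S, hS⟩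
  have ha : ∀ n : N, ∃ k : ℕ, (∏ j ∈ S, x j) ^ k • n = 0 := by
    intro n
    have : S.Nonempty := Finset.card_pos.1 (by omega)
    obtain ⟨j, hj⟩ := this
    obtain ⟨k, hk⟩ := hN j n
    exact ⟨k, by rw [← Finset.prod_erase_mul S x hj, mul_pow, mul_smul, hk, smul_zero]⟩
  have key := FlatResolution.exists_pow_smul (F := fun p => F.complex.X p) (N := N) (diff F.complex) (exact_diff F)
    (π := augmentation F)
    (augmentation_surjective F) (exact_diff_augmentation F) _ ha p X
  obtain _ | p := p
  · exact exists_pieceMap_eq_of_forall x (fun m => key m Submodule.mem_top) _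
  · have h0 : termMap x ((diff F.complex p).rTensor X) ((c : ℤ) - q) t = 0 := ht
    exact exists_pieceMap_eq_of_ker x key _ (congrFun h0 ⟨S, hS⟩)

theorem nonempty_tor_equiv (p : ℕ) (H : ModuleCat.{u} R) :
    Nonempty ((((MonoidalCategory.tensorRight H).mapHomologicalComplex
      (ComplexShape.down ℕ)).obj F.complex).homology p ≃ₗ[R] torInt p N H) :=
  ⟨(F.isoLeftDerivedObj (MonoidalCategory.tensorRight H) p).symm.toLinearEquiv⟩

/-- Below degree `c` both sides vanish. From there on the total homology is that of row `c`, which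
is `F ⊗ X` because the Čech term of degree zero is the module itself. -/
theorem nonempty_homology_equiv [∀ p, Module.Flat R (F.complex.X p)]
    (hN : ∀ j (n : N), ∃ k : ℕ, x j ^ k • n = 0) (n : ℕ) :
    Nonempty ((totComplex (cechBicomplex x F.complex X)).homology n ≃ₗ[R]
      torInt ((n : ℤ) - c) N X) := by
  have hrow : ∀ q, q < c → ∀ p, ∀ t ∈ TotalComplex.hcyc (cechBicomplex x F.complex X) p q,
      ∃ s, TotalComplex.dh (cechBicomplex x F.complex X) p q s = t :=
    fun q hq p t ht => exists_dh_eq x X hN p q hq t ht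
  obtain hn | ⟨m, rfl⟩ : n < c ∨ ∃ m, n = m + c := by
    obtain h | h := lt_or_ge n c
    · exact Or.inl h
    · exact Or.inr ⟨n - c, by omega⟩
  · have h1 := TotalComplex.subsingleton_homology_of_rows_exact c hrow hn
    obtain ⟨k, hk⟩ : ∃ k : ℕ, (n : ℤ) - c = Int.negSucc k :=
      ⟨c - n - 1, by rw [Int.negSucc_eq]; omega⟩
    rw [hk]
    have h2 : Subsingleton (torInt (Int.negSucc k) N X) :=
      inferInstanceAs (Subsingleton PUnit)
    exact ⟨0, 0, fun _ => Subsingleton.elim _ _, fun _ => Subsingleton.elim _ _⟩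
  · let l : ∀ p, (F.complex.X p ⊗[R] X) ≃ₗ[R]
        CechTerm x (F.complex.X p ⊗[R] X) ((c : ℤ) - c) :=
      fun p => LinearEquiv.ofBijective _ (toTerm_bijective x _ (sub_self _))
    obtain ⟨e⟩ := TotalComplex.homology_of_rows_exact (cechBicomplex x F.complex X) c hrow
      (fun p q hq t => by
        have := cechTerm_subsingleton x (F.complex.X p ⊗[R] X) (i := (c : ℤ) - q)
          (Or.inl (by omega))
        exact this.elim t 0)
      (((MonoidalCategory.tensorRight X).mapHomologicalComplex
        (ComplexShape.down ℕ)).obj F.complex) (fun p => (l p).symm)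
      (fun p t => by
        obtain ⟨t, rfl⟩ := (l (p + 1)).surjective t
        refine (congrArg ((diff F.complex p).rTensor X) ((l (p + 1)).symm_apply_apply t)).trans
          ((l p).eq_symm_apply.2 ?_)
        exact (termMap_toTerm x ((diff F.complex p).rTensor X) _ t).symm) (m := m) rfl
    obtain ⟨e'⟩ := nonempty_tor_equiv (F := F) m X
    rw [show ((m + c : ℕ) : ℤ) - c = (m : ℤ) by push_cast; ring]
    exact ⟨e ≪≫ₗ e'⟩

theorem nonempty_localCohomologyInt_equiv [IsNoetherianRing R] {𝔞 : Ideal R}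
    (hx : (Ideal.span (Set.range x)).radical = 𝔞.radical) (i : ℤ) :
    Nonempty (((cechComplex x).obj X).homology i ≃ₗ[R] localCohomologyInt 𝔞 i X) := by
  match i with
  | Int.ofNat n => exact (nonempty_localCohomology_equiv x hx n X).map LinearEquiv.symm
  | Int.negSucc k =>
    have h1 : Subsingleton (((cechComplex x).obj X).homology (Int.negSucc k)) :=
      ModuleComplex.subsingleton_homology fun z _ => by
        have := cechTerm_subsingleton x X (i := Int.negSucc k) (Or.inl (Int.negSucc_lt_zero k))
        exact ⟨0, 0, (map_zero _).trans (this.elim 0 z)⟩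
    have h2 : Subsingleton (localCohomologyInt 𝔞 (Int.negSucc k) X) :=
      inferInstanceAs (Subsingleton PUnit)
    exact ⟨0, 0, fun _ => Subsingleton.elim _ _, fun _ => Subsingleton.elim _ _⟩

/-- The second page in terms of `Tor` and local cohomology. -/
theorem nonempty_secondPage_iso [IsNoetherianRing R] [∀ p, Module.Flat R (F.complex.X p)]
    {𝔞 : Ideal R} (hx : (Ideal.span (Set.range x)).radical = 𝔞.radical) (p q : ℕ) :
    Nonempty ((FilteredComplex.page
        (TotalComplex.isFirstQuadrantFiltration (cechBicomplex x F.complex X)) 2).X (p, q) ≅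
      torInt p N (localCohomologyInt 𝔞 ((c : ℤ) - q) X)) := by
  obtain ⟨e⟩ := nonempty_secondPage_equiv x F.complex X p q
  obtain ⟨e'⟩ := nonempty_tor_equiv (F := F) p (((cechComplex x).obj X).homology ((c : ℤ) - q))
  obtain ⟨e''⟩ := nonempty_localCohomologyInt_equiv x X hx ((c : ℤ) - q)
  exact ⟨(e ≪≫ₗ e').toModuleIso ≪≫ ((Tor' (ModuleCat.{u} R) p).obj N).mapIso e''.toModuleIso⟩

end

end CechBicomplex

end

/-! ### Generators up to radical, and the assembly of the theorem -/

theorem exists_arithmeticRank_generators {R : Type u} [CommRing R] [IsNoetherianRing R]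
    (𝔞 : Ideal R) :
    ∃ x : Fin (arithmeticRank 𝔞) → R, (Ideal.span (Set.range x)).radical = 𝔞.radical := by
  obtain ⟨n, s, hs⟩ := Submodule.fg_iff_exists_fin_generating_family.1
    (IsNoetherian.noetherian 𝔞)
  exact Nat.sInf_mem (s := {c : ℕ | ∃ x : Fin c → R,
    (Ideal.span (Set.range x)).radical = 𝔞.radical}) ⟨n, s, congrArg Ideal.radical hs⟩

theorem IsIdealTorsion.exists_pow_smul_eq_zero {R : Type u} [CommRing R] {𝔞 : Ideal R}
    {N : Type u} [AddCommGroup N] [Module R N] (hN : IsIdealTorsion 𝔞 N) {a : R}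
    (ha : a ∈ 𝔞.radical) (m : N) : ∃ k : ℕ, a ^ k • m = 0 := by
  obtain ⟨k, hk⟩ := hN m
  obtain ⟨l, hl⟩ := ha
  exact ⟨l * k, by rw [pow_mul]; exact hk _ (Ideal.pow_mem_pow hl k)⟩

theorem lemma2p1 {R : Type u} [CommRing R] [IsNoetherianRing R] (𝔞 : Ideal R)
    (X N : ModuleCat.{u} R) (hN : IsIdealTorsion 𝔞 N) :
    -- elements generating `𝔞` up to radical, as many as the arithmetic rank, exist
    (∃ x : Fin (arithmeticRank 𝔞) → R,
      (Ideal.span (Set.range x)).radical = 𝔞.radical) ∧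
    -- free resolutions exist
    (∃ F : ProjectiveResolution N, ∀ p : ℕ, Module.Free R (F.complex.X p)) ∧
    -- for every choice of these there is the asserted spectral sequence
    ∀ x : Fin (arithmeticRank 𝔞) → R,
      (Ideal.span (Set.range x)).radical = 𝔞.radical →
    ∀ F : ProjectiveResolution N, (∀ p : ℕ, Module.Free R (F.complex.X p)) →
    ∃ (E : FirstQuadrantSpectralSequence R)
      (e : ∀ n : ℕ, (totComplex (cechBicomplex x F.complex X)).homology n ≅
        torInt ((n : ℤ) - arithmeticRank 𝔞) N X),
      IsSpectralSequenceOf E (totComplex (cechBicomplex x F.complex X))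
        (firstFiltration (cechBicomplex x F.complex X)) ∧
      (∀ p q : ℕ, Nonempty ((E.page 2 le_rfl).X (p, q) ≅
        torInt p N (localCohomologyInt 𝔞 ((arithmeticRank 𝔞 : ℤ) - q) X))) ∧
      ConvergesTo E (fun n => torInt ((n : ℤ) - arithmeticRank 𝔞) N X)
        (fun n p => (homologyFiltration (totComplex (cechBicomplex x F.complex X))
          (firstFiltration (cechBicomplex x F.complex X)) n p).map (e n).hom.hom) := by

  refine ⟨exists_arithmeticRank_generators 𝔞,
    ⟨FreeResolution.resolution R N, FreeResolution.free_complex R N⟩, fun x hx F hF => ?_⟩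
  have hflat : ∀ p, Module.Flat R (F.complex.X p) := fun p => by
    have := hF p
    infer_instance
  -- Each `x j` lies in the radical of `𝔞`, so the `𝔞`-torsion of `N` makes it act locally
  -- nilpotently.
  have hx' : ∀ j (m : N), ∃ k : ℕ, x j ^ k • m = 0 := fun j m =>
    hN.exists_pow_smul_eq_zero
      (hx ▸ Ideal.le_radical (Ideal.subset_span (Set.mem_range_self j))) m
  have e := fun n => (CechBicomplex.nonempty_homology_equiv (F := F) x X hx' n).some
  exact ⟨FilteredComplex.spectralSequence (TotalComplex.isFirstQuadrantFiltration _),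
    fun n => (e n).toModuleIso, FilteredComplex.isSpectralSequenceOf _,
    CechBicomplex.nonempty_secondPage_iso x X hx, FilteredComplex.convergesTo _ _ _⟩
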